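/- Let $d\ge 1$. For each integer $n\ge 1$ let $\mathcal S_n=n^{-1}\mathbb Z^d$, let $\mu^n$ be the measure on $\mathcal S_n$ that gives mass $n^{-d}$ to each point, and let $C^n:\mathcal S_n\times\mathcal S_n\to[0,\infty)$ be symmetric with $C^n(x,x)=0$ for all $x$. Write $|\cdot|$ for the Euclidean norm. Assume the following. (A1) There are $c_1,c_2>0$ such that $c_1\le\sum_{y\in\mathcal S_n}C^n(x,y)\le c_2$ for all $n\ge 1$ and $x\in\mathcal S_n$. (A2) There are $M_0\ge 1$ and $\delta>0$ such that for all $n\ge1$ and all $x,y\in\mathcal S_n$ with $|x-y|=n^{-1}$ there are $N\ge 2$ and $x_1,\dots,x_N\in\mathcal S_n$ with $x_1=x$, $x_N=y$, $|x-x_i|<n^{-1}M_0$ for $1\le i\le N$, and $C^n(x_i,x_{i+1})\ge\delta$ for $1\le i\le N-1$. (A3) $\displaystyle\sup_{n\ge 1}\,\sup_{x\in\mathcal S_n}\, n^2\sum_{y\in\mathcal S_n}\bigl(1\wedge|x-y|^2\bigr)C^n(x,y)<\infty.$ Let $p^n(t,x,y)$ be the transition density with respect to $\mu^n$ of the continuous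 time symmetric Markov chain on $\mathcal S_n$ with generator $\mathcal A^nf(x)=\sum_{y\in\mathcal S_n}(f(y)-f(x))\,C^n(x,y)\,n^2$; that is, $p^n(t,x,y)=n^{d}\,\bigl(e^{t\mathcal A^n}\mathbf 1_{\{y\}}\bigr)(x)$, where $\mathcal A^n$ is regarded as a bounded operator on $L^2(\mathcal S_n,\mu^n)$. Then there is an $\varepsilon>0$ such that $$p^n(t,x,y)\ \ge\ \varepsilon\, t^{-d/2}$$ for all integers $n\ge 1$, all $t\in(n^{-1},1]$ and all $x,y\in\mathcal S_n$ with $|x-y|\le 2t^{1/2}$. -/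

import Mathlib

/-- The lattice `ℤ^d`. The point `k : IntLattice d` stands for the point `k / n` of
`S_n = n⁻¹ ℤ^d`, so that a function on `S_n` is a function on `IntLattice d`. -/
abbrev IntLattice (d : ℕ) : Type := Fin d → ℤ

/-- The point `k / n` of `S_n = n⁻¹ ℤ^d`, in Euclidean space. -/
noncomputable def latticePoint {d : ℕ} (n : ℕ) (k : IntLattice d) : EuclideanSpace ℝ (Fin d) :=
  WithLp.toLp 2 (fun i => (k i : ℝ) / (n : ℝ))

/-- Symmetric non-negative conductances on a lattice, given off the diagonal and extended by `0`
to the diagonal, with bounded total conductances `ν_x = ∑_y C(x, y)`. -/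
structure Conductance (d : ℕ) where
  /-- the conductance `C(x, y)` between `x` and `y` -/
  val : IntLattice d → IntLattice d → ℝ
  symm : ∀ x y, val x y = val y x
  nonneg : ∀ x y, 0 ≤ val x y
  diag : ∀ x, val x x = 0
  summable : ∀ x, Summable (val x)
  bounded : ∃ c, ∀ x, ∑' y, val x y ≤ c

namespace Conductance

variable {d : ℕ}

/-- The total conductance `ν_x = ∑_y C(x, y)`. -/
noncomputable def total (C : Conductance d) (x : IntLattice d) : ℝ := ∑' y, C.val x y

/-- Square summable functions on the lattice. The norm of `L²(S_n, μⁿ)`, where `μⁿ` gives the mass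
`n^{-d}` to each point, is a constant multiple of the norm of this space. -/
abbrev L2 (d : ℕ) : Type := lp (fun _ : IntLattice d => ℝ) 2

theorem L2.summable_sq (f : L2 d) : Summable fun x => f x ^ 2 := by
  have h := (lp.memℓp f).summable (by norm_num)
  simpa using h

theorem L2.norm_sq (f : L2 d) : ‖f‖ ^ 2 = ∑' x, f x ^ 2 := by
  have h := lp.norm_rpow_eq_tsum (p := 2) (by norm_num) f
  simpa using h

theorem L2.abs_apply_le (f : L2 d) (x : IntLattice d) : |f x| ≤ ‖f‖ :=
  lp.norm_apply_le_norm (by norm_num) f x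

theorem total_nonneg (C : Conductance d) (x : IntLattice d) : 0 ≤ C.total x :=
  tsum_nonneg (C.nonneg x)

theorem summable_mul_of_bounded (C : Conductance d) (x : IntLattice d) {g : IntLattice d → ℝ} {b : ℝ}
    (hg : ∀ y, |g y| ≤ b) : Summable fun y => C.val x y * g y := by
  refine Summable.of_norm_bounded (g := fun y => C.val x y * b) ((C.summable x).mul_right b) ?_
  intro y
  rw [Real.norm_eq_abs, abs_mul, abs_of_nonneg (C.nonneg x y)]
  exact mul_le_mul_of_nonneg_left (hg y) (C.nonneg x y)

theorem summable_mul_sub (C : Conductance d) (f : L2 d) (x : IntLattice d) :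
    Summable fun y => C.val x y * (f y - f x) :=
  C.summable_mul_of_bounded x (b := ‖f‖ + ‖f‖) fun y =>
    (abs_sub _ _).trans (add_le_add (L2.abs_apply_le f y) (L2.abs_apply_le f x))

theorem summable_mul_sq (C : Conductance d) (f : L2 d) (x : IntLattice d) :
    Summable fun y => C.val x y * f y ^ 2 :=
  C.summable_mul_of_bounded x (b := ‖f‖ ^ 2) fun y => by
    rw [abs_pow]
    exact pow_le_pow_left₀ (abs_nonneg _) (L2.abs_apply_le f y) 2

theorem sq_le (C : Conductance d) (f : L2 d) (x : IntLattice d) :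
    (∑' y, C.val x y * (f y - f x)) ^ 2 ≤
      C.total x * (2 * ∑' y, C.val x y * f y ^ 2 + 2 * (C.total x * f x ^ 2)) := by
  have hs := (C.summable_mul_sub f x).hasSum
  have hs2 : Filter.Tendsto (fun s : Finset (IntLattice d) =>
      (∑ y ∈ s, C.val x y * (f y - f x)) ^ 2) Filter.atTop
      (nhds ((∑' y, C.val x y * (f y - f x)) ^ 2)) := hs.pow 2
  refine le_of_tendsto' hs2 fun s => ?_
  have h1 : (∑ y ∈ s, C.val x y * (f y - f x)) ^ 2 ≤
      (∑ y ∈ s, C.val x y) * ∑ y ∈ s, C.val x y * (f y - f x) ^ 2 :=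
    Finset.sum_sq_le_sum_mul_sum_of_sq_le_mul s (fun y _ => C.nonneg x y)
      (fun y _ => mul_nonneg (C.nonneg x y) (sq_nonneg _)) (fun y _ => le_of_eq (by ring))
  have h2 : ∑ y ∈ s, C.val x y ≤ C.total x :=
    (C.summable x).sum_le_tsum s (fun y _ => C.nonneg x y)
  have h3 : ∑ y ∈ s, C.val x y * (f y - f x) ^ 2 ≤
      2 * ∑' y, C.val x y * f y ^ 2 + 2 * (C.total x * f x ^ 2) := by
    have h4 : ∑ y ∈ s, C.val x y * f y ^ 2 ≤ ∑' y, C.val x y * f y ^ 2 :=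
      (C.summable_mul_sq f x).sum_le_tsum s
        (fun y _ => mul_nonneg (C.nonneg x y) (sq_nonneg _))
    have h5 : (∑ y ∈ s, C.val x y) * f x ^ 2 ≤ C.total x * f x ^ 2 :=
      mul_le_mul_of_nonneg_right h2 (sq_nonneg _)
    calc ∑ y ∈ s, C.val x y * (f y - f x) ^ 2
        ≤ ∑ y ∈ s, (2 * (C.val x y * f y ^ 2) + 2 * (C.val x y * f x ^ 2)) := by
          refine Finset.sum_le_sum fun y _ => ?_
          nlinarith [mul_nonneg (C.nonneg x y) (sq_nonneg (f y + f x))]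
      _ = 2 * ∑ y ∈ s, C.val x y * f y ^ 2 + 2 * ((∑ y ∈ s, C.val x y) * f x ^ 2) := by
          rw [Finset.sum_add_distrib, ← Finset.mul_sum, ← Finset.mul_sum, Finset.sum_mul]
      _ ≤ _ := by linarith
  exact h1.trans (mul_le_mul h2 h3
    (Finset.sum_nonneg fun y _ => mul_nonneg (C.nonneg x y) (sq_nonneg _)) (C.total_nonneg x))

theorem sum_sq_le (C : Conductance d) {c : ℝ} (hc : ∀ x, C.total x ≤ c) (f : L2 d)
    (s : Finset (IntLattice d)) :
    ∑ x ∈ s, (∑' y, C.val x y * (f y - f x)) ^ 2 ≤ (2 * c * ‖f‖) ^ 2 := by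
  have hc0 : 0 ≤ c := (C.total_nonneg 0).trans (hc 0)
  have hA : ∑ x ∈ s, ∑' y, C.val x y * f y ^ 2 ≤ c * ‖f‖ ^ 2 := by
    rw [← Summable.tsum_finsetSum (fun x _ => C.summable_mul_sq f x), L2.norm_sq, ← tsum_mul_left]
    have hle : ∀ y, ∑ x ∈ s, C.val x y * f y ^ 2 ≤ c * f y ^ 2 := fun y => by
      rw [← Finset.sum_mul]
      refine mul_le_mul_of_nonneg_right ?_ (sq_nonneg _)
      simp only [fun x => C.symm x y]
      exact ((C.summable y).sum_le_tsum s (fun x _ => C.nonneg y x)).trans (hc y)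
    refine Summable.tsum_le_tsum hle ?_ ((L2.summable_sq f).mul_left c)
    exact summable_sum (fun x _ => C.summable_mul_sq f x)
  have hB : ∑ x ∈ s, f x ^ 2 ≤ ‖f‖ ^ 2 := by
    rw [L2.norm_sq]
    exact (L2.summable_sq f).sum_le_tsum s (fun x _ => sq_nonneg _)
  calc ∑ x ∈ s, (∑' y, C.val x y * (f y - f x)) ^ 2
      ≤ ∑ x ∈ s, c * (2 * ∑' y, C.val x y * f y ^ 2 + 2 * (c * f x ^ 2)) := by
        refine Finset.sum_le_sum fun x _ => (C.sq_le f x).trans ?_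
        have h0 : 0 ≤ ∑' y, C.val x y * f y ^ 2 :=
          tsum_nonneg fun y => mul_nonneg (C.nonneg x y) (sq_nonneg _)
        have h1 : C.total x * f x ^ 2 ≤ c * f x ^ 2 :=
          mul_le_mul_of_nonneg_right (hc x) (sq_nonneg _)
        have h2 : 0 ≤ C.total x * f x ^ 2 := mul_nonneg (C.total_nonneg x) (sq_nonneg _)
        exact mul_le_mul (hc x) (by linarith) (by linarith) hc0
    _ = c * (2 * ∑ x ∈ s, ∑' y, C.val x y * f y ^ 2 + 2 * (c * ∑ x ∈ s, f x ^ 2)) := by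
        rw [← Finset.mul_sum, Finset.sum_add_distrib, ← Finset.mul_sum, ← Finset.mul_sum,
          ← Finset.mul_sum]
    _ ≤ c * (2 * (c * ‖f‖ ^ 2) + 2 * (c * ‖f‖ ^ 2)) := by gcongr
    _ = (2 * c * ‖f‖) ^ 2 := by ring

theorem memLp_laplacian (C : Conductance d) (f : L2 d) :
    Memℓp (fun x => ∑' y, C.val x y * (f y - f x)) 2 := by
  obtain ⟨c, hc⟩ := C.bounded
  refine memℓp_gen' (C := (2 * c * ‖f‖) ^ 2) fun s => ?_
  simpa using C.sum_sq_le hc f s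

/-- The bounded operator `f ↦ (x ↦ ∑_y C(x, y) (f(y) - f(x)))` on `L²`. -/
noncomputable def laplacian (C : Conductance d) : L2 d →L[ℝ] L2 d :=
  LinearMap.mkContinuousOfExistsBound
    { toFun := fun f => ⟨fun x => ∑' y, C.val x y * (f y - f x), C.memLp_laplacian f⟩
      map_add' := fun f g => by
        ext x
        change ∑' y, C.val x y * ((f y + g y) - (f x + g x)) =
          ∑' y, C.val x y * (f y - f x) + ∑' y, C.val x y * (g y - g x)
        rw [← (C.summable_mul_sub f x).tsum_add (C.summable_mul_sub g x)]
        exact tsum_congr fun y => by ring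
      map_smul' := fun a f => by
        ext x
        change ∑' y, C.val x y * (a * f y - a * f x) = a * ∑' y, C.val x y * (f y - f x)
        rw [← tsum_mul_left]
        exact tsum_congr fun y => by ring }
    (by
      obtain ⟨c, hc⟩ := C.bounded
      have hc0 : 0 ≤ c := (C.total_nonneg 0).trans (hc 0)
      refine ⟨2 * c, fun f => lp.norm_le_of_forall_sum_le (by norm_num) (by positivity) ?_⟩
      intro s
      simpa using C.sum_sq_le hc f s)

theorem laplacian_apply (C : Conductance d) (f : L2 d) (x : IntLattice d) :
    C.laplacian f x = ∑' y, C.val x y * (f y - f x) := rfl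

/-- The infinitesimal generator `𝒜ⁿ f(x) = ∑_y (f(y) - f(x)) Cⁿ(x, y) n²` on `L²(S_n, μⁿ)` of the
chain on `S_n` with Dirichlet form `(n^{2-d} / 2) ∑_{x,y} (f(y) - f(x))² Cⁿ(x, y)`. -/
noncomputable def generator (C : Conductance d) (n : ℕ) : L2 d →L[ℝ] L2 d :=
  ((n : ℝ) ^ 2) • C.laplacian

/-- The semigroup `P_t = exp(t 𝒜ⁿ)` on `L²(S_n, μⁿ)`. -/
noncomputable def semigroup (C : Conductance d) (n : ℕ) (t : ℝ) : L2 d →L[ℝ] L2 d :=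
  NormedSpace.exp (t • C.generator n)

/-- The transition density `pⁿ(t, x, y) = P_t 1_{y} (x) / μⁿ(y)` with respect to `μⁿ`, which gives
the mass `n^{-d}` to each point. -/
noncomputable def heatKernel (C : Conductance d) (n : ℕ) (t : ℝ) (x y : IntLattice d) : ℝ :=
  (n : ℝ) ^ d * C.semigroup n t (lp.single 2 y (1 : ℝ)) x

end Conductance

/-!
The lower bound is a statement about one symmetric chain on `ℤ^d` at one scale. Time `t` and
conductances `Cⁿ` on `S_n` become time `n² t = 2 R²` for the unscaled chain, and `hA3` gives
that for all `R ≤ n` the truncated second moment `∑_y C(x, y) min(1, (|x - y|₁ / R)²)` is at most a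
multiple of `R⁻²` (`HasJumpBound`). Together with the chains of `hA2` (`HasChains`) this suffices for
`f_{2R²}(y) ≥ ε R^{-d}` at distance of order `R`, where `f_t` is the law of the chain at time `t`.
The argument goes back to Nash and to Fabes and Stroock.

* Upper bound (`exists_flow_le`). By `hA2` the Dirichlet form dominates the nearest neighbour one.
  Averaging over cubes of side `r` then gives `‖f‖² ≤ r^{-d} + K r² ℰ(f, f)` for probability
  densities, and optimizing in `r` yields `f_t ≤ A t^{-d/2}`.
* Mass retention (`exists_half_le_sum_flow`). For a cut-off `χ` at scale `R`, the loss of `∑ χ f_t`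
  is a flux that counts only where the larger mass sits inside the support of `χ`. Young's
  inequality bounds it by `∑_{ball} f^{1 - 1/d}`, controlled by the volume of the ball, and by the
  dissipation of `∑ f^{1 + 1/d}`, which is of order `t^{-1/2}` by the upper bound. Hence half of the
  mass remains in the ball up to the time `η R²`, although jumps longer than `R` cannot be excluded
  up to the time `R²`.
* The logarithm (`exists_le_logMean`). The mean `Γ` of `log (R^d f_t + δ)` for the weight
  `e^{-|y - x₀|₁ / R}` satisfies `Γ' ≥ c R⁻² Var(log) - C R⁻²`, by a weighted Poincaré inequality
  (`HasChains.tsum_poincare`). For `t ∈ [η R² / 2, η R²]` the density is of order `R^{-d}` on a set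
  of positive proportion, so the variance is at least a multiple of `Γ²` when `Γ` is very negative.
  This Riccati inequality bounds `Γ` from below at time `R²`, uniformly in `δ`.
* Conclusion (`exists_le_flow`). Therefore `f_{R²} ≥ ε R^{-d}` off a set of small weight, for both
  starting points, and `f_{2R²}(x, y) = ∑_z f_{R²}(x, z) f_{R²}(y, z)` is at least a multiple of
  `R^{-d}`.

The weighted Poincaré inequality is proved for exponential weights because these vary by a bounded
factor along the chains of `hA2`, and because they are products: a Hardy inequality on the half line
tensorizes. Sums over pairs that occur there are taken in `ℝ≥0∞`, where they may be rearranged.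
-/

/-! ### The Dirichlet form and the semigroup -/

namespace Conductance

variable {d : ℕ}

/-- The bilinear Dirichlet form `∑_{x,y} C(x, y) (g(x) - g(y)) (f(x) - f(y))`, the sum being over
ordered pairs, without the customary factor `1 / 2`. -/
noncomputable def dirichlet (C : Conductance d) (g f : IntLattice d → ℝ) : ℝ :=
  ∑' p : IntLattice d × IntLattice d,
    C.val p.1 p.2 * ((g p.1 - g p.2) * (f p.1 - f p.2))

theorem summable_pair_fst (C : Conductance d) {h : IntLattice d → ℝ} (hh : Summable h) :
    Summable fun p : IntLattice d × IntLattice d => C.val p.1 p.2 * h p.1 := by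
  obtain ⟨c, hc⟩ := C.bounded
  rw [← summable_abs_iff] at hh ⊢
  rw [summable_prod_of_nonneg (fun p => abs_nonneg _)]
  have key : ∀ x y, |C.val x y * h x| = C.val x y * |h x| := fun x y => by
    rw [abs_mul, abs_of_nonneg (C.nonneg x y)]
  simp only [key]
  refine ⟨fun x => (C.summable x).mul_right _, ?_⟩
  simp only [tsum_mul_right]
  refine Summable.of_nonneg_of_le (fun x => mul_nonneg (C.total_nonneg x) (abs_nonneg _))
    (fun x => mul_le_mul_of_nonneg_right (hc x) (abs_nonneg _)) (hh.mul_left c)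

theorem summable_pair_snd (C : Conductance d) {h : IntLattice d → ℝ} (hh : Summable h) :
    Summable fun p : IntLattice d × IntLattice d => C.val p.1 p.2 * h p.2 := by
  have := (Equiv.prodComm (IntLattice d) (IntLattice d)).summable_iff.mpr (C.summable_pair_fst hh)
  refine this.congr fun p => ?_
  simp [C.symm p.1 p.2]

/-- Symmetrization of the generator. -/
theorem tsum_mul_laplacian_of_summable (C : Conductance d) {g f : IntLattice d → ℝ}
    (h1 : Summable fun p : IntLattice d × IntLattice d => C.val p.1 p.2 * (g p.1 * f p.1))
    (h2 : Summable fun p : IntLattice d × IntLattice d => C.val p.1 p.2 * (g p.1 * f p.2)) :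
    (Summable fun p : IntLattice d × IntLattice d =>
      C.val p.1 p.2 * ((g p.1 - g p.2) * (f p.1 - f p.2))) ∧
    ∑' x, g x * ∑' y, C.val x y * (f y - f x) = -(C.dirichlet g f) / 2 := by
  have hs : Summable fun p : IntLattice d × IntLattice d =>
      g p.1 * (C.val p.1 p.2 * (f p.2 - f p.1)) :=
    (h2.sub h1).congr fun p => by ring
  have hs' : Summable fun p : IntLattice d × IntLattice d =>
      g p.2 * (C.val p.1 p.2 * (f p.1 - f p.2)) := by
    refine ((Equiv.prodComm (IntLattice d) (IntLattice d)).summable_iff.mpr hs).congr fun p => ?_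
    simp [C.symm p.1 p.2]
  have he : ∑' p : IntLattice d × IntLattice d, g p.2 * (C.val p.1 p.2 * (f p.1 - f p.2)) =
      ∑' p : IntLattice d × IntLattice d, g p.1 * (C.val p.1 p.2 * (f p.2 - f p.1)) := by
    rw [← (Equiv.prodComm (IntLattice d) (IntLattice d)).tsum_eq]
    exact tsum_congr fun p => by simp [C.symm p.1 p.2]
  have hsum := hs.add hs'
  have ht := hs.tsum_add hs'
  rw [he] at ht
  constructor
  · refine hsum.neg.congr fun p => ?_
    ring
  · have h3 : C.dirichlet g f = -∑' p : IntLattice d × IntLattice d,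
        (g p.1 * (C.val p.1 p.2 * (f p.2 - f p.1)) +
          g p.2 * (C.val p.1 p.2 * (f p.1 - f p.2))) := by
      rw [dirichlet, ← tsum_neg]
      exact tsum_congr fun p => by ring
    rw [h3, ht, hs.tsum_prod]
    simp only [tsum_mul_left]
    ring

theorem pair_summable_of_bounded (C : Conductance d) {g f : IntLattice d → ℝ} {b : ℝ}
    (hg : ∀ x, |g x| ≤ b) (hf : Summable f) :
    (Summable fun p : IntLattice d × IntLattice d => C.val p.1 p.2 * (g p.1 * f p.1)) ∧
    (Summable fun p : IntLattice d × IntLattice d => C.val p.1 p.2 * (g p.1 * f p.2)) := by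
  have hf' := hf.abs
  constructor
  · refine Summable.of_norm_bounded ((C.summable_pair_fst hf').mul_left b) fun p => ?_
    rw [Real.norm_eq_abs, abs_mul, abs_mul, abs_of_nonneg (C.nonneg _ _)]
    have := mul_le_mul_of_nonneg_right (hg p.1) (abs_nonneg (f p.1))
    nlinarith [mul_le_mul_of_nonneg_left this (C.nonneg p.1 p.2)]
  · refine Summable.of_norm_bounded ((C.summable_pair_snd hf').mul_left b) fun p => ?_
    rw [Real.norm_eq_abs, abs_mul, abs_mul, abs_of_nonneg (C.nonneg _ _)]
    have := mul_le_mul_of_nonneg_right (hg p.1) (abs_nonneg (f p.2))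
    nlinarith [mul_le_mul_of_nonneg_left this (C.nonneg p.1 p.2)]

theorem summable_dirichlet (C : Conductance d) {g f : IntLattice d → ℝ} {b : ℝ}
    (hg : ∀ x, |g x| ≤ b) (hf : Summable f) :
    Summable fun p : IntLattice d × IntLattice d =>
      C.val p.1 p.2 * ((g p.1 - g p.2) * (f p.1 - f p.2)) :=
  (C.tsum_mul_laplacian_of_summable (C.pair_summable_of_bounded hg hf).1
    (C.pair_summable_of_bounded hg hf).2).1

theorem tsum_mul_laplacian (C : Conductance d) {g : IntLattice d → ℝ} {f : L2 d} {b : ℝ}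
    (hg : ∀ x, |g x| ≤ b) (hf : Summable fun x => f x) :
    ∑' x, g x * C.laplacian f x = -(C.dirichlet g f) / 2 :=
  (C.tsum_mul_laplacian_of_summable (C.pair_summable_of_bounded hg hf).1
    (C.pair_summable_of_bounded hg hf).2).2

theorem inner_eq_tsum (f g : L2 d) : inner ℝ f g = ∑' x, f x * g x := by
  rw [lp.inner_eq_tsum]
  exact tsum_congr fun x => by simp [mul_comm]

theorem summable_mul (f g : L2 d) : Summable fun x => f x * g x := by
  refine (lp.hasSum_inner (𝕜 := ℝ) f g).summable.congr fun x => ?_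
  simp [mul_comm]

theorem inner_laplacian (C : Conductance d) (g f : L2 d) :
    inner ℝ g (C.laplacian f) = -(C.dirichlet g f) / 2 := by
  rw [inner_eq_tsum]
  refine (C.tsum_mul_laplacian_of_summable ?_ ?_).2
  · exact C.summable_pair_fst (summable_mul g f)
  · have h := (C.summable_pair_fst (L2.summable_sq g)).add
      (C.summable_pair_snd (L2.summable_sq f))
    refine Summable.of_norm_bounded h fun p => ?_
    rw [Real.norm_eq_abs, abs_mul, abs_of_nonneg (C.nonneg _ _), ← mul_add]
    refine mul_le_mul_of_nonneg_left ?_ (C.nonneg _ _)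
    rw [abs_le]
    constructor <;> nlinarith [sq_nonneg (g p.1 + f p.2), sq_nonneg (g p.1 - f p.2),
      sq_nonneg (g p.1), sq_nonneg (f p.2)]

theorem dirichlet_comm (C : Conductance d) (g f : IntLattice d → ℝ) :
    C.dirichlet g f = C.dirichlet f g :=
  tsum_congr fun p => by ring

theorem isSelfAdjoint_laplacian (C : Conductance d) : IsSelfAdjoint C.laplacian := by
  rw [ContinuousLinearMap.isSelfAdjoint_iff_isSymmetric]
  intro f g
  change inner ℝ (C.laplacian f) g = inner ℝ f (C.laplacian g)
  rw [real_inner_comm, inner_laplacian, inner_laplacian, dirichlet_comm]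

/-- The law `f_t = e^{tL} 1_{x}` at time `t` of the unscaled chain started at `x`; `f_t(y)` is its
transition density with respect to the counting measure. -/
noncomputable def flow (C : Conductance d) (x : IntLattice d) (t : ℝ) : L2 d :=
  NormedSpace.exp (t • C.laplacian) (lp.single 2 x (1 : ℝ))

theorem heatKernel_eq (C : Conductance d) (n : ℕ) (t : ℝ) (x y : IntLattice d) :
    C.heatKernel n t x y = (n : ℝ) ^ d * C.flow y ((n : ℝ) ^ 2 * t) x := by
  rw [heatKernel, semigroup, generator, flow, smul_smul, mul_comm t]

theorem flow_zero (C : Conductance d) (x : IntLattice d) :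
    C.flow x 0 = lp.single 2 x (1 : ℝ) := by
  simp [flow]

theorem hasDerivAt_flow (C : Conductance d) (x : IntLattice d) (t : ℝ) :
    HasDerivAt (C.flow x) (C.laplacian (C.flow x t)) t := by
  have h := hasDerivAt_exp_smul_const' (𝕂 := ℝ) C.laplacian t
  exact (ContinuousLinearMap.apply ℝ (L2 d) (lp.single 2 x (1 : ℝ))).hasFDerivAt.comp_hasDerivAt t h

theorem hasDerivAt_flow_apply (C : Conductance d) (x y : IntLattice d) (t : ℝ) :
    HasDerivAt (fun s => C.flow x s y) (C.laplacian (C.flow x t) y) t :=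
  (lp.evalCLM ℝ (fun _ : IntLattice d => ℝ) 2 y).hasFDerivAt.comp_hasDerivAt t
    (C.hasDerivAt_flow x t)

theorem flow_add (C : Conductance d) (x y : IntLattice d) (s t : ℝ) :
    C.flow y (s + t) x = ∑' z, C.flow x s z * C.flow y t z := by
  have hsa : IsSelfAdjoint (NormedSpace.exp (s • C.laplacian)) :=
    ((IsSelfAdjoint.all s).smul C.isSelfAdjoint_laplacian).exp
  rw [ContinuousLinearMap.isSelfAdjoint_iff_isSymmetric] at hsa
  have h1 : C.flow y (s + t) = NormedSpace.exp (s • C.laplacian) (C.flow y t) := by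
    let : NormedAlgebra ℚ (L2 d →L[ℝ] L2 d) := NormedAlgebra.restrictScalars ℚ ℝ _
    rw [flow, flow, add_smul, NormedSpace.exp_add_of_commute]
    · rfl
    · exact ((Commute.refl _).smul_left s).smul_right t
  have h2 := hsa (lp.single 2 x (1 : ℝ)) (C.flow y t)
  simp only [ContinuousLinearMap.coe_coe] at h2
  rw [h1, ← inner_eq_tsum]
  refine Eq.trans ?_ h2.symm
  rw [lp.inner_single_left]
  simp

end Conductance

/-! ### Positivity and conservation of mass -/

namespace Conductance

variable {d : ℕ}

theorem laplacian_apply_eq (C : Conductance d) {f : L2 d} (x : IntLattice d) :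
    C.laplacian f x = ∑' y, C.val x y * f y - C.total x * f x := by
  have h1 : Summable fun y => C.val x y * f y :=
    C.summable_mul_of_bounded x (L2.abs_apply_le f)
  have h2 : Summable fun y => C.val x y * f x := (C.summable x).mul_right _
  rw [laplacian_apply, total, ← tsum_mul_right, ← h1.tsum_sub h2]
  exact tsum_congr fun y => by ring

/-- The operator `L + c`, which preserves positivity once `c` bounds the total conductances. -/
noncomputable def shifted (C : Conductance d) (c : ℝ) : L2 d →L[ℝ] L2 d := C.laplacian + c • 1

theorem shifted_apply (C : Conductance d) (c : ℝ) (f : L2 d) (x : IntLattice d) :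
    C.shifted c f x = ∑' y, C.val x y * f y + (c - C.total x) * f x := by
  have : C.shifted c f x = C.laplacian f x + c * f x := rfl
  rw [this, laplacian_apply_eq]
  ring

theorem tsum_tsum_val_mul (C : Conductance d) {f : IntLattice d → ℝ} (hf : Summable f) :
    (Summable fun x => ∑' y, C.val x y * f y) ∧
      ∑' x, ∑' y, C.val x y * f y = ∑' y, C.total y * f y := by
  have h := C.summable_pair_snd hf
  refine ⟨h.prod, ?_⟩
  rw [← Summable.tsum_comm (f := fun x y => C.val x y * f y) h]
  refine tsum_congr fun y => ?_
  rw [tsum_mul_right, total]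
  congr 1
  exact tsum_congr fun x => C.symm x y

theorem summable_total_mul (C : Conductance d) {f : IntLattice d → ℝ} (hf : Summable f) :
    Summable fun x => C.total x * f x := by
  obtain ⟨c, hc⟩ := C.bounded
  refine Summable.of_norm_bounded (hf.abs.mul_left c) fun x => ?_
  rw [Real.norm_eq_abs, abs_mul, abs_of_nonneg (C.total_nonneg x)]
  exact mul_le_mul_of_nonneg_right (hc x) (abs_nonneg _)

theorem shifted_spec (C : Conductance d) {c : ℝ} (hc : ∀ x, C.total x ≤ c) {f : L2 d}
    (h0 : ∀ x, 0 ≤ f x) (hs : Summable fun x => f x) :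
    (∀ x, 0 ≤ C.shifted c f x) ∧ (Summable fun x => C.shifted c f x) ∧
      ∑' x, C.shifted c f x = c * ∑' x, f x := by
  obtain ⟨h1, h2⟩ := C.tsum_tsum_val_mul hs
  have h3 : Summable fun x => (c - C.total x) * f x :=
    ((hs.mul_left c).sub (C.summable_total_mul hs)).congr fun x => by ring
  have h4 : ∑' x, (c - C.total x) * f x = c * ∑' x, f x - ∑' x, C.total x * f x := by
    rw [← tsum_mul_left, ← (hs.mul_left c).tsum_sub (C.summable_total_mul hs)]
    exact tsum_congr fun x => by ring
  simp only [shifted_apply]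
  refine ⟨fun x => ?_, h1.add h3, ?_⟩
  · exact add_nonneg (tsum_nonneg fun y => mul_nonneg (C.nonneg x y) (h0 y))
      (mul_nonneg (sub_nonneg.mpr (hc x)) (h0 x))
  · rw [h1.tsum_add h3, h2, h4]
    ring

theorem shifted_pow_spec (C : Conductance d) {c : ℝ} (hc : ∀ x, C.total x ≤ c)
    (x : IntLattice d) (k : ℕ) :
    (∀ y, 0 ≤ (C.shifted c ^ k) (lp.single 2 x (1 : ℝ)) y) ∧
    (Summable fun y => (C.shifted c ^ k) (lp.single 2 x (1 : ℝ)) y) ∧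
      ∑' y, (C.shifted c ^ k) (lp.single 2 x (1 : ℝ)) y = c ^ k := by
  induction k with
  | zero =>
    have h : HasSum (fun y => (lp.single 2 x (1 : ℝ) : L2 d) y) 1 := by
      have := hasSum_single (f := fun y => (lp.single 2 x (1 : ℝ) : L2 d) y) x
        (fun z hz => by simp [lp.single_apply, hz])
      simpa using this
    refine ⟨fun y => ?_, by simpa using h.summable, by simp⟩
    rw [pow_zero, one_apply_eq_self, lp.single_apply, Pi.single_apply]
    split_ifs <;> norm_num
  | succ k ih =>
    have h := C.shifted_spec hc ih.1 ih.2.1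
    rw [pow_succ']
    refine ⟨h.1, h.2.1, h.2.2.trans ?_⟩
    rw [ih.2.2, pow_succ']

theorem hasSum_flow (C : Conductance d) (c : ℝ) (x y : IntLattice d) (t : ℝ) :
    HasSum (fun k : ℕ => ((k.factorial : ℝ)⁻¹ * t ^ k) *
      (C.shifted c ^ k) (lp.single 2 x (1 : ℝ)) y) (Real.exp (t * c) * C.flow x t y) := by
  have he : NormedSpace.exp (t • C.shifted c) =
      Real.exp (t * c) • NormedSpace.exp (t • C.laplacian) := by
    let : NormedAlgebra ℚ (L2 d →L[ℝ] L2 d) := NormedAlgebra.restrictScalars ℚ ℝ _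
    have h1 : t • C.shifted c = t • C.laplacian + algebraMap ℝ (L2 d →L[ℝ] L2 d) (t * c) := by
      rw [shifted, smul_add, smul_smul, Algebra.algebraMap_eq_smul_one]
    rw [h1, NormedSpace.exp_add_of_commute (Algebra.commutes _ _).symm,
      ← NormedSpace.algebraMap_exp_comm, ← Real.exp_eq_exp_ℝ, Algebra.algebraMap_eq_smul_one,
      mul_smul_comm, mul_one]
  have h := NormedSpace.exp_series_hasSum_exp' (𝕂 := ℝ) (t • C.shifted c)
  rw [he] at h
  have h2 := (h.mapL (ContinuousLinearMap.apply ℝ (L2 d) (lp.single 2 x (1 : ℝ)))).mapL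
    (lp.evalCLM ℝ (fun _ : IntLattice d => ℝ) 2 y)
  simp only [smul_pow, smul_smul] at h2
  exact h2

theorem flow_nonneg (C : Conductance d) (x y : IntLattice d) {t : ℝ} (ht : 0 ≤ t) :
    0 ≤ C.flow x t y := by
  obtain ⟨c, hc⟩ := C.bounded
  have h := (C.hasSum_flow c x y t).nonneg fun k =>
    mul_nonneg (by positivity) ((C.shifted_pow_spec hc x k).1 y)
  exact nonneg_of_mul_nonneg_right h (Real.exp_pos _)

theorem sum_flow_le_one (C : Conductance d) (x : IntLattice d) {t : ℝ} (ht : 0 ≤ t)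
    (s : Finset (IntLattice d)) : ∑ y ∈ s, C.flow x t y ≤ 1 := by
  obtain ⟨c, hc⟩ := C.bounded
  have h1 := hasSum_sum (s := s) fun y _ => C.hasSum_flow c x y t
  rw [← Finset.mul_sum] at h1
  have h2 : HasSum (fun k : ℕ => ((k.factorial : ℝ)⁻¹ * t ^ k) * c ^ k) (Real.exp (t * c)) := by
    have := NormedSpace.exp_series_hasSum_exp' (𝕂 := ℝ) (t * c)
    rw [← Real.exp_eq_exp_ℝ] at this
    simpa [mul_pow, mul_assoc] using this
  have h3 := hasSum_le (fun k => ?_) h1 h2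
  · exact le_of_mul_le_mul_left (by simpa using h3) (Real.exp_pos (t * c))
  · rw [← Finset.mul_sum]
    obtain ⟨a1, a2, a3⟩ := C.shifted_pow_spec hc x k
    refine mul_le_mul_of_nonneg_left ?_ (by positivity)
    rw [← a3]
    exact a2.sum_le_tsum s fun y _ => a1 y

theorem summable_flow (C : Conductance d) (x : IntLattice d) {t : ℝ} (ht : 0 ≤ t) :
    Summable fun y => C.flow x t y :=
  summable_of_sum_le (fun y => C.flow_nonneg x y ht) (C.sum_flow_le_one x ht)

theorem tsum_flow_le_one (C : Conductance d) (x : IntLattice d) {t : ℝ} (ht : 0 ≤ t) :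
    ∑' y, C.flow x t y ≤ 1 :=
  (C.summable_flow x ht).tsum_le_of_sum_le (C.sum_flow_le_one x ht)

theorem flow_le_one (C : Conductance d) (x y : IntLattice d) {t : ℝ} (ht : 0 ≤ t) :
    C.flow x t y ≤ 1 := by
  simpa using C.sum_flow_le_one x ht {y}

theorem abs_flow_le_one (C : Conductance d) (x y : IntLattice d) {t : ℝ} (ht : 0 ≤ t) :
    |C.flow x t y| ≤ 1 := by
  rw [abs_of_nonneg (C.flow_nonneg x y ht)]
  exact C.flow_le_one x y ht

/-- The chain stays at its position with probability `e^{-ct}`, so `e^{ct} f_t` increases. -/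
theorem flow_le_exp_mul (C : Conductance d) {c : ℝ} (hc : ∀ x, C.total x ≤ c)
    (x y : IntLattice d) {s t : ℝ} (hs : 0 ≤ s) (hst : s ≤ t) :
    Real.exp (s * c) * C.flow x s y ≤ Real.exp (t * c) * C.flow x t y := by
  refine hasSum_le (fun k => ?_) (C.hasSum_flow c x y s) (C.hasSum_flow c x y t)
  refine mul_le_mul_of_nonneg_right ?_ ((C.shifted_pow_spec hc x k).1 y)
  gcongr

end Conductance

/-! ### Chains and comparison with the nearest neighbour energy -/

/-- The cube of the lattice points whose coordinates differ from those of `x` by at most `m`. -/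
noncomputable def latticeBox {d : ℕ} (x : IntLattice d) (m : ℕ) : Finset (IntLattice d) :=
  Fintype.piFinset fun i => Finset.Icc (x i - m) (x i + m)

theorem mem_latticeBox {d : ℕ} {x y : IntLattice d} {m : ℕ} :
    y ∈ latticeBox x m ↔ ∀ i, |x i - y i| ≤ m := by
  simp only [latticeBox, Fintype.mem_piFinset, Finset.mem_Icc, abs_le]
  exact forall_congr' fun i => by constructor <;> rintro ⟨h1, h2⟩ <;> constructor <;> linarith

theorem mem_latticeBox_comm {d : ℕ} {x y : IntLattice d} {m : ℕ} :
    y ∈ latticeBox x m ↔ x ∈ latticeBox y m := by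
  simp only [mem_latticeBox, abs_sub_comm]

theorem card_latticeBox {d : ℕ} (x : IntLattice d) (m : ℕ) :
    (latticeBox x m).card = (2 * m + 1) ^ d := by
  have h : ∀ i, (x i + m + 1 - (x i - m)).toNat = 2 * m + 1 := fun i => by omega
  simp [latticeBox, Fintype.card_piFinset, Int.card_Icc, h]

/-- If neighbouring values of `g` along a chain in a finite set `s` differ by at most `σ`, then the
values at the two ends differ by at most `|s| σ`, however long the chain is: it can be shortened to
a path without repeated vertices. -/
theorem abs_sub_le_card_mul_of_chain {α : Type*} (s : Finset α) (g : α → ℝ)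
    {σ : ℝ} (hσ : 0 ≤ σ) {N : ℕ} (hN : 1 ≤ N) (z : ℕ → α) (hz : ∀ j, 1 ≤ j → j ≤ N → z j ∈ s)
    (hg : ∀ j, 1 ≤ j → j < N → |g (z j) - g (z (j + 1))| ≤ σ) :
    |g (z 1) - g (z N)| ≤ s.card * σ := by
  classical
  let G : SimpleGraph s :=
    { Adj := fun a b => a ≠ b ∧ |g a - g b| ≤ σ
      symm := ⟨fun a b h => ⟨h.1.symm, by rw [abs_sub_comm]; exact h.2⟩⟩
      loopless := ⟨fun a h => h.1 rfl⟩ }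
  have hreach : ∀ j (h1 : 1 ≤ j) (h2 : j ≤ N),
      G.Reachable ⟨z 1, hz 1 le_rfl hN⟩ ⟨z j, hz j h1 h2⟩ := by
    intro j h1
    induction j, h1 using Nat.le_induction with
    | base => intro _; exact SimpleGraph.Reachable.refl _
    | succ j h1 ih =>
      intro h2
      refine (ih (by omega)).trans ?_
      by_cases he : z j = z (j + 1)
      · simp only [he]; exact SimpleGraph.Reachable.refl _
      · exact SimpleGraph.Adj.reachable (G := G) ⟨fun h => he (congrArg Subtype.val h),
          hg j h1 (by omega)⟩
  have hwalk : ∀ {a b : s} (p : G.Walk a b), |g a - g b| ≤ p.length * σ := by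
    intro a b p
    induction p with
    | nil => simp
    | @cons a b c h p ih =>
      have h2 : |g a - g b| ≤ σ := h.2
      have h3 := abs_sub_le (g a) (g b) (g c)
      rw [SimpleGraph.Walk.length_cons]
      push_cast
      linarith
  obtain ⟨p⟩ := hreach N hN le_rfl
  refine (hwalk p.toPath.1).trans (mul_le_mul_of_nonneg_right ?_ hσ)
  have h := p.toPath.2.length_lt
  rw [Fintype.card_coe] at h
  exact_mod_cast h.le

namespace Conductance

variable {d : ℕ}

/-- Any two neighbouring lattice points are joined, inside the cube of radius `m` around the first
one, by a chain of edges of conductance at least `δ`. -/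
def HasChains (C : Conductance d) (m : ℕ) (δ : ℝ) : Prop :=
  ∀ (x : IntLattice d) (i : Fin d), ∃ N : ℕ, 1 ≤ N ∧ ∃ z : ℕ → IntLattice d,
    z 1 = x ∧ z N = x + Pi.single i 1 ∧ (∀ j, 1 ≤ j → j ≤ N → z j ∈ latticeBox x m) ∧
      ∀ j, 1 ≤ j → j < N → δ ≤ C.val (z j) (z (j + 1))

/-- The energy `∑_{x,y} C(x, y) min(ρ(x), ρ(y)) (g(x) - g(y))²`, as an extended real. -/
noncomputable def energy (C : Conductance d) (ρ g : IntLattice d → ℝ) : ENNReal :=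
  ∑' p : IntLattice d × IntLattice d,
    ENNReal.ofReal (C.val p.1 p.2 * (min (ρ p.1) (ρ p.2) * (g p.1 - g p.2) ^ 2))

theorem HasChains.sq_sub_le {C : Conductance d} {m : ℕ} {δ : ℝ} (h : C.HasChains m δ) (hδ : 0 < δ)
    (g : IntLattice d → ℝ) (x : IntLattice d) (i : Fin d) :
    (g (x + Pi.single i 1) - g x) ^ 2 ≤ (((2 * m + 1) ^ d : ℕ) : ℝ) ^ 2 / δ *
      ∑ p ∈ latticeBox x m ×ˢ latticeBox x m, C.val p.1 p.2 * (g p.1 - g p.2) ^ 2 := by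
  obtain ⟨N, hN, z, h1, h2, h3, h4⟩ := h x i
  set S := ∑ p ∈ latticeBox x m ×ˢ latticeBox x m, C.val p.1 p.2 * (g p.1 - g p.2) ^ 2 with hS
  have hpos : ∀ p : IntLattice d × IntLattice d, 0 ≤ C.val p.1 p.2 * (g p.1 - g p.2) ^ 2 :=
    fun p => mul_nonneg (C.nonneg _ _) (sq_nonneg _)
  have hS0 : 0 ≤ S := Finset.sum_nonneg fun p _ => hpos p
  have key := abs_sub_le_card_mul_of_chain (latticeBox x m) g (σ := √(S / δ)) (Real.sqrt_nonneg _)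
    hN z h3 (fun j hj1 hj2 => by
      refine Real.abs_le_sqrt ?_
      rw [le_div_iff₀ hδ]
      have h5 : C.val (z j) (z (j + 1)) * (g (z j) - g (z (j + 1))) ^ 2 ≤ S :=
        Finset.single_le_sum (f := fun p : IntLattice d × IntLattice d =>
          C.val p.1 p.2 * (g p.1 - g p.2) ^ 2) (fun p _ => hpos p)
          (Finset.mem_product.mpr ⟨h3 j hj1 hj2.le, h3 (j + 1) (by omega) hj2⟩ :
            (z j, z (j + 1)) ∈ _)
      nlinarith [h4 j hj1 hj2, sq_nonneg (g (z j) - g (z (j + 1)))])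
  rw [h1, h2, card_latticeBox, abs_sub_comm] at key
  rw [← sq_abs]
  refine (pow_le_pow_left₀ (abs_nonneg _) key 2).trans (le_of_eq ?_)
  rw [mul_pow, Real.sq_sqrt (by positivity)]
  ring

/-- Comparison of the nearest neighbour energy with the energy of `C`, for weights that vary by a
bounded factor at the scale of the chains. -/
theorem HasChains.tsum_le_energy {C : Conductance d} {m : ℕ} {δ : ℝ} (h : C.HasChains m δ)
    (hδ : 0 < δ) {ρ : IntLattice d → ℝ} {κ : ℝ} (hρ0 : ∀ x, 0 ≤ ρ x) (hκ : 0 ≤ κ)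
    (hρ : ∀ x, ∀ y ∈ latticeBox x m, ρ x ≤ κ * ρ y) (g : IntLattice d → ℝ) (i : Fin d) :
    ∑' x, ENNReal.ofReal (ρ x * (g (x + Pi.single i 1) - g x) ^ 2) ≤
      ENNReal.ofReal ((((2 * m + 1) ^ d : ℕ) : ℝ) ^ 3 * κ / δ) * C.energy ρ g := by
  classical
  set V : ℝ := (((2 * m + 1) ^ d : ℕ) : ℝ) with hV
  have hV0 : 0 ≤ V := Nat.cast_nonneg _
  set F : IntLattice d × IntLattice d → ℝ :=
    fun p => C.val p.1 p.2 * (min (ρ p.1) (ρ p.2) * (g p.1 - g p.2) ^ 2) with hF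
  have hF0 : ∀ p, 0 ≤ F p := fun p =>
    mul_nonneg (C.nonneg _ _) (mul_nonneg (le_min (hρ0 _) (hρ0 _)) (sq_nonneg _))
  have h1 : ∀ x, ρ x * (g (x + Pi.single i 1) - g x) ^ 2 ≤
      V ^ 2 * κ / δ * ∑ p ∈ latticeBox x m ×ˢ latticeBox x m, F p := by
    intro x
    have h2 := mul_le_mul_of_nonneg_left (h.sq_sub_le hδ g x i) (hρ0 x)
    have h3 : ρ x * ∑ p ∈ latticeBox x m ×ˢ latticeBox x m, C.val p.1 p.2 * (g p.1 - g p.2) ^ 2 ≤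
        κ * ∑ p ∈ latticeBox x m ×ˢ latticeBox x m, F p := by
      rw [Finset.mul_sum, Finset.mul_sum]
      refine Finset.sum_le_sum fun p hp => ?_
      obtain ⟨hp1, hp2⟩ := Finset.mem_product.mp hp
      have h4 : ρ x ≤ κ * min (ρ p.1) (ρ p.2) := by
        rw [mul_min_of_nonneg _ _ hκ]
        exact le_min (hρ x _ hp1) (hρ x _ hp2)
      have h5 := mul_le_mul_of_nonneg_right h4
        (mul_nonneg (C.nonneg p.1 p.2) (sq_nonneg (g p.1 - g p.2)))
      simp only [hF]
      linarith
    calc _ ≤ _ := h2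
      _ = V ^ 2 / δ * (ρ x * ∑ p ∈ latticeBox x m ×ˢ latticeBox x m,
            C.val p.1 p.2 * (g p.1 - g p.2) ^ 2) := by ring
      _ ≤ V ^ 2 / δ * (κ * ∑ p ∈ latticeBox x m ×ˢ latticeBox x m, F p) :=
          mul_le_mul_of_nonneg_left h3 (by positivity)
      _ = _ := by ring
  have h6 : ∀ x, ENNReal.ofReal (ρ x * (g (x + Pi.single i 1) - g x) ^ 2) ≤
      ENNReal.ofReal (V ^ 2 * κ / δ) *
        ∑' p : IntLattice d × IntLattice d,
          (if x ∈ latticeBox p.1 m then ENNReal.ofReal (F p) else 0) := by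
    intro x
    refine (ENNReal.ofReal_le_ofReal (h1 x)).trans ?_
    rw [ENNReal.ofReal_mul (by positivity), ENNReal.ofReal_sum_of_nonneg fun p _ => hF0 p]
    refine mul_le_mul_right ?_ _
    refine le_trans (Finset.sum_le_sum fun p hp => ?_) (ENNReal.sum_le_tsum _)
    rw [if_pos (mem_latticeBox_comm.mp (Finset.mem_product.mp hp).1)]
  refine (ENNReal.tsum_le_tsum h6).trans ?_
  rw [ENNReal.tsum_mul_left, ENNReal.tsum_comm]
  have h7 : ∀ p : IntLattice d × IntLattice d,
      ∑' x, (if x ∈ latticeBox p.1 m then ENNReal.ofReal (F p) else 0) =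
        ENNReal.ofReal V * ENNReal.ofReal (F p) := by
    intro p
    rw [tsum_eq_sum (s := latticeBox p.1 m) fun x hx => if_neg hx,
      Finset.sum_congr rfl fun x hx => if_pos hx, Finset.sum_const, card_latticeBox, hV,
      ENNReal.ofReal_natCast, nsmul_eq_mul]
  simp only [h7]
  rw [ENNReal.tsum_mul_left, ← mul_assoc, ← ENNReal.ofReal_mul (by positivity)]
  rw [energy]
  refine mul_le_mul_left (ENNReal.ofReal_le_ofReal (le_of_eq ?_)) _
  ring

end Conductance

/-! ### The Nash inequality and the upper bound -/

theorem tsum_ofReal_eq {α : Type*} {F : α → ℝ} (h0 : ∀ a, 0 ≤ F a) (hs : Summable F) :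
    ∑' a, ENNReal.ofReal (F a) = ENNReal.ofReal (∑' a, F a) :=
  (ENNReal.ofReal_tsum_of_nonneg h0 hs).symm

theorem monotoneOn_of_hasDerivAt {s : Set ℝ} (hs : Convex ℝ s) {f f' : ℝ → ℝ}
    (hf : ∀ t ∈ s, HasDerivAt f (f' t) t) (h0 : ∀ t ∈ s, 0 ≤ f' t) : MonotoneOn f s :=
  monotoneOn_of_deriv_nonneg hs (fun t ht => (hf t ht).continuousAt.continuousWithinAt)
    (fun t ht => (hf t (interior_subset ht)).differentiableAt.differentiableWithinAt)
    (fun t ht => by rw [(hf t (interior_subset ht)).deriv]; exact h0 t (interior_subset ht))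

namespace Conductance

variable {d : ℕ}

/-- The translate `y ↦ f(y + v)` of a square summable function. -/
noncomputable def translate (v : IntLattice d) (f : L2 d) : L2 d :=
  ⟨fun y => f (y + v), memℓp_gen (by
    have h := (Equiv.addRight v).summable_iff.mpr (L2.summable_sq f)
    simpa [Function.comp_def] using h)⟩

theorem translate_apply (v : IntLattice d) (f : L2 d) (y : IntLattice d) :
    translate v f y = f (y + v) := rfl

theorem norm_translate (v : IntLattice d) (f : L2 d) : ‖translate v f‖ = ‖f‖ := by
  rw [← sq_eq_sq₀ (norm_nonneg _) (norm_nonneg _), L2.norm_sq, L2.norm_sq]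
  exact (Equiv.addRight v).tsum_eq fun y => f y ^ 2

theorem norm_translate_add_sub_le (v w : IntLattice d) (f : L2 d) :
    ‖translate (v + w) f - f‖ ≤ ‖translate v f - f‖ + ‖translate w f - f‖ := by
  have h : translate (v + w) f - f =
      translate v (translate w f - f) + (translate v f - f) := by
    ext y
    change f (y + (v + w)) - f y = (f (y + v + w) - f (y + v)) + (f (y + v) - f y)
    rw [add_assoc]
    ring
  rw [h, add_comm ‖translate v f - f‖]
  refine (norm_add_le _ _).trans ?_
  rw [norm_translate]

theorem translate_zero (f : L2 d) : translate 0 f = f := by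
  ext y
  rw [translate_apply, add_zero]

theorem norm_translate_nsmul_sub_le (k : ℕ) (v : IntLattice d) (f : L2 d) :
    ‖translate (k • v) f - f‖ ≤ k * ‖translate v f - f‖ := by
  induction k with
  | zero => simp [translate_zero]
  | succ k ih =>
    rw [succ_nsmul]
    refine (norm_translate_add_sub_le _ _ _).trans ?_
    push_cast
    linarith

theorem norm_translate_sum_sub_le {ι : Type*} (s : Finset ι) (v : ι → IntLattice d) (f : L2 d) :
    ‖translate (∑ i ∈ s, v i) f - f‖ ≤ ∑ i ∈ s, ‖translate (v i) f - f‖ := by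
  classical
  induction s using Finset.induction_on with
  | empty => simp [translate_zero]
  | insert i s hi ih =>
    rw [Finset.sum_insert hi, Finset.sum_insert hi]
    exact (norm_translate_add_sub_le _ _ _).trans (by linarith)

theorem norm_translate_sub_le {r : ℕ} {v : IntLattice d} (hv : ∀ i, 0 ≤ v i ∧ v i < r) (f : L2 d)
    {σ : ℝ} (hσ : ∀ i : Fin d, ‖translate (Pi.single i 1) f - f‖ ≤ σ) :
    ‖translate v f - f‖ ≤ d * (r * σ) := by
  rw [← Finset.univ_sum_single v]
  refine (norm_translate_sum_sub_le _ _ _).trans ?_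
  have h : ∀ i ∈ (Finset.univ : Finset (Fin d)),
      ‖translate (Pi.single i (v i)) f - f‖ ≤ r * σ := by
    intro i _
    have h1 : (Pi.single i (v i) : IntLattice d) = (v i).toNat • Pi.single i 1 := by
      rw [← Pi.single_smul]
      congr 1
      have := (hv i).1
      simp [this]
    rw [h1]
    refine (norm_translate_nsmul_sub_le _ _ _).trans ?_
    have h2 : ((v i).toNat : ℝ) ≤ r := by
      have := hv i
      exact_mod_cast (by omega : (v i).toNat ≤ r)
    exact mul_le_mul h2 (hσ i) (norm_nonneg _) (Nat.cast_nonneg _)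
  refine (Finset.sum_le_sum h).trans (le_of_eq ?_)
  simp

/-- Averaging over cubes: `‖f‖²` is controlled at every scale `r` by the `ℓ¹` norm and by the
increments of `f` in the coordinate directions. -/
theorem norm_sq_le_of_translate (f : L2 d) (h0 : ∀ y, 0 ≤ f y) (hs : Summable fun y => f y)
    (h1 : ∑' y, f y ≤ 1) {σ : ℝ} (hσ : ∀ i : Fin d, ‖translate (Pi.single i 1) f - f‖ ≤ σ)
    (r : ℕ) (hr : 1 ≤ r) :
    ‖f‖ ^ 2 ≤ ((r : ℝ) ^ d)⁻¹ + (d * (r * σ)) ^ 2 / 2 := by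
  set B : Finset (IntLattice d) := Fintype.piFinset fun _ => Finset.Ico (0 : ℤ) r with hB
  have hcard : (B.card : ℝ) = (r : ℝ) ^ d := by
    simp [hB, Fintype.card_piFinset]
  have hr0 : (0 : ℝ) < (r : ℝ) ^ d := by positivity
  have h2 : ∀ v ∈ B, ‖f‖ ^ 2 ≤ inner ℝ f (translate v f) + (d * (r * σ)) ^ 2 / 2 := by
    intro v hv
    have hv' : ∀ i, 0 ≤ v i ∧ v i < r := fun i => by
      simpa using (Fintype.mem_piFinset.mp hv) i
    have h3 := pow_le_pow_left₀ (norm_nonneg _) (norm_translate_sub_le hv' f hσ) 2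
    rw [norm_sub_sq_real, norm_translate, real_inner_comm] at h3
    linarith
  have h3 := Finset.sum_le_sum h2
  rw [Finset.sum_add_distrib, Finset.sum_const, Finset.sum_const, nsmul_eq_mul, nsmul_eq_mul,
    hcard] at h3
  have h4 : ∑ v ∈ B, inner ℝ f (translate v f) ≤ 1 := by
    simp only [inner_eq_tsum]
    rw [← Summable.tsum_finsetSum fun v _ => summable_mul f (translate v f)]
    refine le_trans (Summable.tsum_le_tsum (g := fun y => f y) (fun y => ?_)
      (summable_sum fun v _ => summable_mul f (translate v f)) hs) h1
    simp only [translate_apply]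
    rw [← Finset.mul_sum]
    have h5 : Summable fun v => f (y + v) := (Equiv.addLeft y).summable_iff.mpr hs
    have h6 : ∑' v, f (y + v) ≤ 1 := ((Equiv.addLeft y).tsum_eq fun z => f z).trans_le h1
    have h7 : ∑ v ∈ B, f (y + v) ≤ ∑' v, f (y + v) := h5.sum_le_tsum B fun v _ => h0 (y + v)
    exact mul_le_of_le_one_right (h0 y) (h7.trans h6)
  have h5 : (r : ℝ) ^ d * ‖f‖ ^ 2 ≤ (r : ℝ) ^ d * (((r : ℝ) ^ d)⁻¹ + (d * (r * σ)) ^ 2 / 2) := by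
    rw [mul_add, mul_inv_cancel₀ hr0.ne']
    linarith
  exact le_of_mul_le_mul_left h5 hr0

/-- The constant in the Nash inequality. -/
noncomputable def nashConst (d m : ℕ) (δ : ℝ) : ℝ :=
  (d : ℝ) ^ 2 * ((((2 * m + 1) ^ d : ℕ) : ℝ) ^ 3 / δ) / 2

theorem dirichlet_self_nonneg (C : Conductance d) (f : IntLattice d → ℝ) :
    0 ≤ C.dirichlet f f :=
  tsum_nonneg fun _ => mul_nonneg (C.nonneg _ _) (mul_self_nonneg _)

theorem HasChains.norm_sq_le {C : Conductance d} {m : ℕ} {δ : ℝ} (h : C.HasChains m δ)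
    (hδ : 0 < δ) (f : L2 d) (h0 : ∀ y, 0 ≤ f y) (hs : Summable fun y => f y)
    (h1 : ∑' y, f y ≤ 1) (r : ℕ) (hr : 1 ≤ r) :
    ‖f‖ ^ 2 ≤ ((r : ℝ) ^ d)⁻¹ + nashConst d m δ * r ^ 2 * C.dirichlet f f := by
  set K : ℝ := (((2 * m + 1) ^ d : ℕ) : ℝ) ^ 3 / δ with hK
  have hK0 : 0 ≤ K := by positivity
  have hD0 := C.dirichlet_self_nonneg f
  have hE : C.energy (fun _ => 1) f = ENNReal.ofReal (C.dirichlet f f) := by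
    rw [energy, dirichlet, ← tsum_ofReal_eq (fun _ => mul_nonneg (C.nonneg _ _) (mul_self_nonneg _))
      (C.summable_dirichlet (L2.abs_apply_le f) hs)]
    refine tsum_congr fun p => ?_
    rw [min_self, one_mul, sq]
  have hσ : ∀ i : Fin d, ‖translate (Pi.single i 1) f - f‖ ≤ √(K * C.dirichlet f f) := by
    intro i
    refine Real.le_sqrt_of_sq_le ?_
    have h2 := h.tsum_le_energy hδ (ρ := fun _ => 1) (κ := 1) (fun _ => zero_le_one) zero_le_one
      (fun _ _ _ => by norm_num) f i
    rw [hE, mul_one, ← ENNReal.ofReal_mul hK0] at h2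
    have h3 : ∑' x, ENNReal.ofReal (1 * (f (x + Pi.single i 1) - f x) ^ 2) =
        ENNReal.ofReal (‖translate (Pi.single i 1) f - f‖ ^ 2) := by
      rw [L2.norm_sq, ← tsum_ofReal_eq (fun _ => sq_nonneg _) (L2.summable_sq _)]
      refine tsum_congr fun x => ?_
      rw [one_mul]
      rfl
    rw [h3] at h2
    exact (ENNReal.ofReal_le_ofReal_iff (by positivity)).mp h2
  refine (norm_sq_le_of_translate f h0 hs h1 hσ r hr).trans (le_of_eq ?_)
  rw [mul_pow, mul_pow, Real.sq_sqrt (by positivity), nashConst]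
  ring

end Conductance

/-- The differential inequality behind Nash's bound: `w ≤ r^{-d} + K r² (-w')` at all scales `r`
forces `w(t) = O(t^{-d/2})`. -/
theorem le_rpow_of_nash {d : ℕ} (hd : 1 ≤ d) {K : ℝ} (hK : 0 < K) :
    ∃ A : ℝ, 0 < A ∧ ∀ w D : ℝ → ℝ, (∀ t, 0 ≤ t → HasDerivAt w (-D t) t) → (∀ t, 0 ≤ t → 0 < w t) →
      (∀ t, 0 ≤ t → w t ≤ 1) → (∀ t, 0 ≤ t → 0 ≤ D t) →
      (∀ t, 0 ≤ t → ∀ r : ℕ, 1 ≤ r → w t ≤ ((r : ℝ) ^ d)⁻¹ + K * r ^ 2 * D t) →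
      ∀ t, 0 < t → w t ≤ A * t ^ (-(d : ℝ) / 2) := by
  have hd0 : (0 : ℝ) < d := by exact_mod_cast hd
  set c : ℝ := 1 / (8 * K * 2 ^ (2 / (d : ℝ))) with hc
  have hc0 : 0 < c := by positivity
  refine ⟨(2 * c / d) ^ (-(d : ℝ) / 2), by positivity, ?_⟩
  intro w D hw hpos hle hD hN t ht
  have key : ∀ s, 0 ≤ s → c * w s ^ (1 + 2 / (d : ℝ)) ≤ D s := by
    intro s hs
    have hws := hpos s hs
    -- The scale `r` is the least one with `r ^ (-d) ≤ w / 2`.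
    set q : ℝ := (2 / w s) ^ (1 / (d : ℝ)) with hq
    have hq1 : 1 ≤ q := by
      refine Real.one_le_rpow ?_ (by positivity)
      rw [le_div_iff₀ hws]
      linarith [hle s hs]
    set r : ℕ := ⌈q⌉₊ with hr
    have hr1 : 1 ≤ r := Nat.one_le_ceil_iff.mpr (by linarith)
    have hqr : q ≤ r := Nat.le_ceil q
    have hrq : (r : ℝ) ≤ 2 * q := by
      have := (Nat.ceil_lt_add_one (by linarith : (0:ℝ) ≤ q)).le
      linarith
    have hqd : q ^ d = 2 / w s := by
      rw [hq, ← Real.rpow_natCast, ← Real.rpow_mul (by positivity), one_div_mul_cancel hd0.ne',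
        Real.rpow_one]
    have hrd : ((r : ℝ) ^ d)⁻¹ ≤ w s / 2 := by
      rw [← inv_div, ← hqd]
      exact inv_anti₀ (by positivity) (pow_le_pow_left₀ (by linarith) hqr d)
    have hq2 : q ^ 2 = 2 ^ (2 / (d : ℝ)) / w s ^ (2 / (d : ℝ)) := by
      rw [hq, ← Real.rpow_natCast, ← Real.rpow_mul (by positivity), ← Real.div_rpow (by norm_num)
        hws.le]
      congr 1
      push_cast
      ring
    have h1 := hN s hs r hr1
    have h2 : K * r ^ 2 * D s ≤ K * (4 * q ^ 2) * D s := by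
      have h4 : (r : ℝ) ^ 2 ≤ 4 * q ^ 2 := by nlinarith [(Nat.cast_nonneg r : (0:ℝ) ≤ r)]
      exact mul_le_mul_of_nonneg_right (mul_le_mul_of_nonneg_left h4 hK.le) (hD s hs)
    have h3 : w s ≤ 8 * K * q ^ 2 * D s := by linarith
    rw [hq2] at h3
    have hwp : 0 < w s ^ (2 / (d : ℝ)) := by positivity
    rw [Real.rpow_add hws, Real.rpow_one, hc]
    rw [div_mul_eq_mul_div, one_mul, div_le_iff₀ (by positivity)]
    have h5 := mul_le_mul_of_nonneg_right h3 hwp.le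
    refine h5.trans (le_of_eq ?_)
    field_simp
  -- Hence `w ^ (-2 / d)` grows at least linearly.
  have hu : ∀ s, 0 ≤ s → HasDerivAt (fun s => w s ^ (-(2 / (d : ℝ))))
      (-D s * (-(2 / (d : ℝ))) * w s ^ (-(2 / (d : ℝ)) - 1)) s := fun s hs =>
    (hw s hs).rpow_const (Or.inl (hpos s hs).ne')
  have hmono : MonotoneOn (fun s => w s ^ (-(2 / (d : ℝ))) - 2 * c / d * s) (Set.Ici 0) := by
    refine monotoneOn_of_hasDerivAt (convex_Ici 0)
      (fun s hs => (hu s hs).sub ((hasDerivAt_id s).const_mul (2 * c / d))) ?_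
    · intro s hs
      have hs' : 0 ≤ s := hs
      have h1 := key s hs'
      have hws := hpos s hs'
      have h2 : w s ^ (1 + 2 / (d : ℝ)) * w s ^ (-(2 / (d : ℝ)) - 1) = 1 := by
        rw [← Real.rpow_add hws]
        ring_nf
        exact Real.rpow_zero _
      have h3 := mul_le_mul_of_nonneg_right h1
        (Real.rpow_pos_of_pos hws (-(2 / (d : ℝ)) - 1)).le
      rw [mul_assoc, h2] at h3
      have h4 := mul_le_mul_of_nonneg_left h3 (by positivity : 0 ≤ 2 / (d : ℝ))
      have e1 : 2 / (d : ℝ) * (c * 1) = 2 * c / d * 1 := by ring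
      linarith
  have h1 := hmono (Set.self_mem_Ici) (Set.mem_Ici.mpr ht.le) ht.le
  simp only [mul_zero, sub_zero] at h1
  have hw0 : 0 < w 0 ^ (-(2 / (d : ℝ))) := Real.rpow_pos_of_pos (hpos 0 le_rfl) _
  have h2 : 2 * c / d * t ≤ w t ^ (-(2 / (d : ℝ))) := by linarith
  have h3 := Real.rpow_le_rpow_of_nonpos (by positivity : 0 < 2 * c / d * t) h2
    (by rw [neg_div]; exact neg_nonpos.mpr (by positivity) : -(d : ℝ) / 2 ≤ 0)
  rw [← Real.rpow_mul (hpos t ht.le).le, Real.mul_rpow (by positivity) ht.le] at h3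
  have e : -(2 / (d : ℝ)) * (-(d : ℝ) / 2) = 1 := by field_simp
  rwa [e, Real.rpow_one] at h3

namespace Conductance

variable {d : ℕ}

theorem flow_ne_zero (C : Conductance d) (x : IntLattice d) (t : ℝ) : C.flow x t ≠ 0 := by
  intro h
  have h1 := C.flow_add x x (-t) t
  rw [neg_add_cancel, flow_zero, h] at h1
  simp at h1

theorem norm_sq_flow_le_one (C : Conductance d) (x : IntLattice d) {t : ℝ} (ht : 0 ≤ t) :
    ‖C.flow x t‖ ^ 2 ≤ 1 := by
  rw [L2.norm_sq]
  refine le_trans (Summable.tsum_le_tsum (fun y => ?_) (L2.summable_sq _) (C.summable_flow x ht))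
    (C.tsum_flow_le_one x ht)
  rw [sq]
  exact mul_le_of_le_one_right (C.flow_nonneg x y ht) (C.flow_le_one x y ht)

theorem hasDerivAt_norm_sq_flow (C : Conductance d) (x : IntLattice d) (t : ℝ) :
    HasDerivAt (fun t => ‖C.flow x t‖ ^ 2) (-C.dirichlet (C.flow x t) (C.flow x t)) t := by
  have h := (C.hasDerivAt_flow x t).norm_sq
  rw [inner_laplacian] at h
  convert h using 1
  ring

/-- On-diagonal upper bound, uniform over the conductances with the same chain constants. -/
theorem exists_flow_le (hd : 1 ≤ d) (m : ℕ) {δ : ℝ} (hδ : 0 < δ) :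
    ∃ A : ℝ, 0 < A ∧ ∀ C : Conductance d, C.HasChains m δ → ∀ x y : IntLattice d, ∀ t : ℝ, 0 < t →
      C.flow x t y ≤ A * t ^ (-(d : ℝ) / 2) := by
  have hK : 0 < nashConst d m δ := by
    have : (0 : ℝ) < d := by exact_mod_cast hd
    rw [nashConst]
    positivity
  obtain ⟨A, hA, h⟩ := le_rpow_of_nash hd hK
  refine ⟨A * (1 / 2) ^ (-(d : ℝ) / 2), by positivity, fun C hC x y t ht => ?_⟩
  have hb : ∀ z, ‖C.flow z (t / 2)‖ ^ 2 ≤ A * (t / 2) ^ (-(d : ℝ) / 2) := fun z =>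
    h (fun t => ‖C.flow z t‖ ^ 2) (fun t => C.dirichlet (C.flow z t) (C.flow z t))
      (fun t _ => C.hasDerivAt_norm_sq_flow z t)
      (fun t _ => by have := norm_pos_iff.mpr (C.flow_ne_zero z t); positivity)
      (fun t ht => C.norm_sq_flow_le_one z ht) (fun t _ => C.dirichlet_self_nonneg _)
      (fun t ht r hr => hC.norm_sq_le hδ _ (fun y => C.flow_nonneg z y ht) (C.summable_flow z ht)
        (C.tsum_flow_le_one z ht) r hr) (t / 2) (by positivity)
  have h1 := C.flow_add y x (t / 2) (t / 2)
  rw [add_halves, ← inner_eq_tsum] at h1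
  rw [h1, mul_assoc, ← Real.mul_rpow (by norm_num) ht.le, one_div_mul_eq_div]
  refine (real_inner_le_norm _ _).trans ?_
  nlinarith [hb x, hb y, sq_nonneg (‖C.flow x (t / 2)‖ - ‖C.flow y (t / 2)‖)]

end Conductance

/-! ### Truncated jumps, cut-off functions and fluxes -/

/-- The `ℓ¹` distance of lattice points. -/
noncomputable def gridDist {d : ℕ} (x y : IntLattice d) : ℝ := ∑ i, |(x i : ℝ) - y i|

theorem gridDist_nonneg {d : ℕ} (x y : IntLattice d) : 0 ≤ gridDist x y :=
  Finset.sum_nonneg fun _ _ => abs_nonneg _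

theorem gridDist_self {d : ℕ} (x : IntLattice d) : gridDist x x = 0 := by
  simp [gridDist]

theorem gridDist_comm {d : ℕ} (x y : IntLattice d) : gridDist x y = gridDist y x :=
  Finset.sum_congr rfl fun _ _ => abs_sub_comm _ _

theorem gridDist_triangle {d : ℕ} (x y z : IntLattice d) :
    gridDist x z ≤ gridDist x y + gridDist y z := by
  rw [gridDist, gridDist, gridDist, ← Finset.sum_add_distrib]
  exact Finset.sum_le_sum fun _ _ => abs_sub_le _ _ _

theorem abs_gridDist_sub_le {d : ℕ} (x y z : IntLattice d) :
    |gridDist x y - gridDist x z| ≤ gridDist y z := by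
  rw [abs_le]
  have h1 := gridDist_triangle x y z
  have h2 := gridDist_triangle x z y
  rw [gridDist_comm z y] at h2
  constructor <;> linarith

theorem mem_latticeBox_of_gridDist_le {d : ℕ} {x y : IntLattice d} {R : ℝ}
    (h : gridDist x y ≤ R) : y ∈ latticeBox x ⌊R⌋₊ := by
  rw [mem_latticeBox]
  intro i
  have h1 : |(x i : ℝ) - y i| ≤ R :=
    (Finset.single_le_sum (f := fun i => |(x i : ℝ) - y i|) (fun _ _ => abs_nonneg _)
      (Finset.mem_univ i)).trans h
  have h2 : ((x i - y i).natAbs : ℝ) ≤ R := by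
    rw [Nat.cast_natAbs]
    push_cast
    exact h1
  have h3 := Nat.le_floor h2
  rw [Int.abs_eq_natAbs]
  exact_mod_cast h3

theorem card_latticeBox_floor_le {d : ℕ} (x : IntLattice d) {R : ℝ} (hR : 1 ≤ R) :
    ((latticeBox x ⌊R⌋₊).card : ℝ) ≤ 3 ^ d * R ^ d := by
  rw [card_latticeBox, ← mul_pow]
  push_cast
  refine pow_le_pow_left₀ (by positivity) ?_ d
  linarith [Nat.floor_le (by linarith : 0 ≤ R)]

/-- For `u > v` the increment `u - v` is controlled by `u ^ (1 - b) * (u ^ b - v ^ b)`. -/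
theorem mul_sub_le_rpow_mul {b u v : ℝ} (hb0 : 0 ≤ b) (hb1 : b ≤ 1) (hu : 0 ≤ u) (hv : 0 ≤ v) :
    b * (u - v) ≤ u ^ (1 - b) * (u ^ b - v ^ b) := by
  have h1 := Real.geom_mean_le_arith_mean2_weighted (sub_nonneg.mpr hb1) hb0 hu hv (by ring)
  have h2 : u ^ (1 - b) * u ^ b = u := by
    rw [← Real.rpow_add_of_nonneg hu (sub_nonneg.mpr hb1) hb0]
    simp
  rw [mul_sub (u ^ (1 - b)), h2]
  linarith

theorem rpow_sub_mul_sub_nonneg {b u v : ℝ} (hb0 : 0 ≤ b) (hu : 0 ≤ u) (hv : 0 ≤ v) :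
    0 ≤ (u ^ b - v ^ b) * (u - v) := by
  rcases le_total u v with h | h
  · exact mul_nonneg_of_nonpos_of_nonpos (by linarith [Real.rpow_le_rpow hu h hb0]) (by linarith)
  · exact mul_nonneg (by linarith [Real.rpow_le_rpow hv h hb0]) (by linarith)

/-- The flux of a mass profile `u, v` through a cut-off `p, q`. The product is positive only if the
larger mass sits where the cut-off is larger, hence positive: only masses inside the support of
the cut-off enter. -/
theorem flux_le {b u v p q θ : ℝ} (hb0 : 0 < b) (hb1 : b ≤ 1) (hu : 0 ≤ u) (hv : 0 ≤ v)
    (hp : 0 ≤ p) (hq : 0 ≤ q) (hθ : 0 < θ) :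
    (p - q) * (u - v) ≤
      θ / (2 * b) * ((p - q) ^ 2 * (if 0 < p then u ^ (1 - b) else 0) +
        (p - q) ^ 2 * (if 0 < q then v ^ (1 - b) else 0)) +
        1 / (2 * θ) * ((u ^ b - v ^ b) * (u - v)) := by
  have main : ∀ {u v p q : ℝ}, 0 ≤ u → 0 ≤ v → 0 ≤ q → q < p → v < u →
      (p - q) * (u - v) ≤ θ / (2 * b) * ((p - q) ^ 2 * u ^ (1 - b)) +
        1 / (2 * θ) * ((u ^ b - v ^ b) * (u - v)) := by
    intro u v p q hu hv hq hqp hvu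
    have h1 := mul_sub_le_rpow_mul hb0.le hb1 hu hv
    set s := u ^ (1 - b) with hs
    have hs0 : 0 < s := Real.rpow_pos_of_pos (by linarith) _
    have h2 : (u - v) ^ 2 ≤ s / b * ((u ^ b - v ^ b) * (u - v)) := by
      have h3 := mul_le_mul_of_nonneg_right h1 (sub_nonneg.mpr hvu.le)
      rw [div_mul_eq_mul_div, le_div_iff₀ hb0]
      linarith
    have h4 : (p - q) * (u - v) ≤
        θ / (2 * b) * ((p - q) ^ 2 * s) + 1 / (2 * θ) * (b / s * (u - v) ^ 2) := by
      have e : θ / (2 * b) * ((p - q) ^ 2 * s) + 1 / (2 * θ) * (b / s * (u - v) ^ 2) -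
          (p - q) * (u - v) = (θ * s * (p - q) - b * (u - v)) ^ 2 / (2 * b * θ * s) := by
        field_simp
        ring
      have : 0 ≤ (θ * s * (p - q) - b * (u - v)) ^ 2 / (2 * b * θ * s) := by positivity
      linarith
    have h5 : b / s * (u - v) ^ 2 ≤ (u ^ b - v ^ b) * (u - v) := by
      rw [div_mul_eq_mul_div, div_le_iff₀ hs0]
      rw [div_mul_eq_mul_div, le_div_iff₀ hb0] at h2
      linarith
    have h6 := mul_le_mul_of_nonneg_left h5 (by positivity : 0 ≤ 1 / (2 * θ))
    linarith
  have hD := rpow_sub_mul_sub_nonneg hb0.le hu hv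
  have hI : ∀ {w r : ℝ}, 0 ≤ w → 0 ≤ (p - q) ^ 2 * (if 0 < r then w ^ (1 - b) else 0) := by
    intro w r hw
    split_ifs <;> positivity
  have ht0 : 0 ≤ θ / (2 * b) := by positivity
  have ht1 : 0 ≤ 1 / (2 * θ) * ((u ^ b - v ^ b) * (u - v)) := mul_nonneg (by positivity) hD
  have hrest : 0 ≤ θ / (2 * b) * ((p - q) ^ 2 * (if 0 < p then u ^ (1 - b) else 0) +
      (p - q) ^ 2 * (if 0 < q then v ^ (1 - b) else 0)) :=
    mul_nonneg ht0 (add_nonneg (hI hu) (hI hv))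
  rcases le_or_gt ((p - q) * (u - v)) 0 with h0 | h0
  · linarith
  rcases pos_and_pos_or_neg_and_neg_of_mul_pos h0 with ⟨h1, h2⟩ | ⟨h1, h2⟩
  · have h3 := main hu hv hq (sub_pos.mp h1) (sub_pos.mp h2)
    rw [if_pos (by linarith : 0 < p)]
    have h4 := mul_le_mul_of_nonneg_left (hI (r := q) hv) ht0
    rw [mul_add]
    linarith
  · have h3 := main hv hu hp (sub_neg.mp h1) (sub_neg.mp h2)
    rw [if_pos (by linarith : 0 < q)]
    have h4 := mul_le_mul_of_nonneg_left (hI (r := p) hu) ht0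
    have e1 : (q - p) ^ 2 = (p - q) ^ 2 := by ring
    have e2 : (v ^ b - u ^ b) * (v - u) = (u ^ b - v ^ b) * (u - v) := by ring
    have e3 : (q - p) * (v - u) = (p - q) * (u - v) := by ring
    rw [e1, e2, e3] at h3
    rw [mul_add]
    linarith

namespace Conductance

variable {d : ℕ}

/-- The truncated second moment of the jumps is at most `M` at scale `R`. -/
def HasJumpBound (C : Conductance d) (R M : ℝ) : Prop :=
  ∀ x, ∑' y, C.val x y * min 1 ((gridDist x y / R) ^ 2) ≤ M / R ^ 2

theorem summable_val_mul_min (C : Conductance d) (x : IntLattice d) (R : ℝ) :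
    Summable fun y => C.val x y * min 1 ((gridDist x y / R) ^ 2) :=
  C.summable_mul_of_bounded x (b := 1) fun y => by
    rw [abs_of_nonneg (le_min zero_le_one (sq_nonneg _))]
    exact min_le_left _ _

theorem HasJumpBound.nonneg {C : Conductance d} {R M : ℝ} (h : C.HasJumpBound R M) (hR : 0 < R) :
    0 ≤ M := by
  have h1 : 0 ≤ M / R ^ 2 := (tsum_nonneg fun y => mul_nonneg (C.nonneg 0 y)
    (le_min zero_le_one (sq_nonneg _))).trans (h 0)
  have := mul_nonneg h1 (sq_nonneg R)
  rwa [div_mul_cancel₀ _ (by positivity)] at this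

/-- Summation of the jump bound against a summable density, over pairs. -/
theorem HasJumpBound.tsum_pair_le {C : Conductance d} {R M : ℝ} (h : C.HasJumpBound R M)
    {w : IntLattice d → ℝ} (hw0 : ∀ x, 0 ≤ w x) (hw : Summable w) :
    (Summable fun p : IntLattice d × IntLattice d =>
      C.val p.1 p.2 * (min 1 ((gridDist p.1 p.2 / R) ^ 2) * (w p.1 + w p.2))) ∧
    ∑' p : IntLattice d × IntLattice d,
      C.val p.1 p.2 * (min 1 ((gridDist p.1 p.2 / R) ^ 2) * (w p.1 + w p.2)) ≤
        2 * (M / R ^ 2) * ∑' x, w x := by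
  have hs : Summable fun p : IntLattice d × IntLattice d =>
      w p.1 * (C.val p.1 p.2 * min 1 ((gridDist p.1 p.2 / R) ^ 2)) := by
    refine Summable.of_nonneg_of_le (fun p => mul_nonneg (hw0 _) (mul_nonneg (C.nonneg _ _)
      (le_min zero_le_one (sq_nonneg _)))) (fun p => ?_) (C.summable_pair_fst hw)
    rw [mul_comm]
    exact mul_le_mul_of_nonneg_right (mul_le_of_le_one_right (C.nonneg _ _) (min_le_left _ _))
      (hw0 _)
  have hs' : Summable fun p : IntLattice d × IntLattice d =>
      w p.2 * (C.val p.1 p.2 * min 1 ((gridDist p.1 p.2 / R) ^ 2)) := by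
    refine ((Equiv.prodComm (IntLattice d) (IntLattice d)).summable_iff.mpr hs).congr fun p => ?_
    simp [C.symm p.1 p.2, gridDist_comm p.1 p.2]
  have he : ∑' p : IntLattice d × IntLattice d,
      w p.2 * (C.val p.1 p.2 * min 1 ((gridDist p.1 p.2 / R) ^ 2)) =
      ∑' p : IntLattice d × IntLattice d,
      w p.1 * (C.val p.1 p.2 * min 1 ((gridDist p.1 p.2 / R) ^ 2)) := by
    rw [← (Equiv.prodComm (IntLattice d) (IntLattice d)).tsum_eq]
    exact tsum_congr fun p => by simp [C.symm p.1 p.2, gridDist_comm p.1 p.2]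
  have hb : ∑' p : IntLattice d × IntLattice d,
      w p.1 * (C.val p.1 p.2 * min 1 ((gridDist p.1 p.2 / R) ^ 2)) ≤ M / R ^ 2 * ∑' x, w x := by
    rw [hs.tsum_prod]
    simp only [tsum_mul_left]
    rw [← tsum_mul_left]
    refine Summable.tsum_le_tsum (fun x => ?_) ?_ (hw.mul_left _)
    · rw [mul_comm]
      exact mul_le_mul_of_nonneg_right (h x) (hw0 x)
    · have := hs.prod
      simpa only [tsum_mul_left] using this
  have e : ∀ p : IntLattice d × IntLattice d,
      C.val p.1 p.2 * (min 1 ((gridDist p.1 p.2 / R) ^ 2) * (w p.1 + w p.2)) =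
      w p.1 * (C.val p.1 p.2 * min 1 ((gridDist p.1 p.2 / R) ^ 2)) +
      w p.2 * (C.val p.1 p.2 * min 1 ((gridDist p.1 p.2 / R) ^ 2)) := fun p => by ring
  simp only [e]
  refine ⟨hs.add hs', ?_⟩
  rw [hs.tsum_add hs', he]
  linarith

/-- The cut-off function `(1 - |y - x|₁ / R)₊`. -/
noncomputable def cutoff (x : IntLattice d) (R : ℝ) (y : IntLattice d) : ℝ :=
  max 0 (1 - gridDist x y / R)

theorem cutoff_nonneg (x : IntLattice d) (R : ℝ) (y : IntLattice d) : 0 ≤ cutoff x R y :=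
  le_max_left _ _

theorem cutoff_le_one (x : IntLattice d) {R : ℝ} (hR : 0 < R) (y : IntLattice d) :
    cutoff x R y ≤ 1 :=
  max_le zero_le_one (by have := div_nonneg (gridDist_nonneg x y) hR.le; linarith)

theorem mem_latticeBox_of_cutoff_pos {x y : IntLattice d} {R : ℝ} (hR : 0 < R)
    (h : 0 < cutoff x R y) : y ∈ latticeBox x ⌊R⌋₊ := by
  rw [cutoff, lt_max_iff] at h
  rcases h with h | h
  · exact absurd h (lt_irrefl _)
  · refine mem_latticeBox_of_gridDist_le ?_
    rw [sub_pos, div_lt_one hR] at h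
    exact h.le

theorem cutoff_sub_sq_le (x : IntLattice d) {R : ℝ} (hR : 0 < R) (y z : IntLattice d) :
    (cutoff x R y - cutoff x R z) ^ 2 ≤ min 1 ((gridDist y z / R) ^ 2) := by
  refine le_min ?_ ?_
  · rw [sq_le_one_iff_abs_le_one, abs_le]
    constructor <;> linarith [cutoff_nonneg x R y, cutoff_nonneg x R z, cutoff_le_one x hR y,
      cutoff_le_one x hR z]
  · rw [sq_le_sq, abs_of_nonneg (div_nonneg (gridDist_nonneg y z) hR.le)]
    have h1 := abs_max_sub_max_le_abs (1 - gridDist x y / R) (1 - gridDist x z / R) 0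
    rw [max_comm, max_comm _ (0 : ℝ)] at h1
    refine h1.trans ?_
    have e : 1 - gridDist x y / R - (1 - gridDist x z / R) =
        (gridDist x z - gridDist x y) / R := by ring
    rw [e, abs_div, abs_of_pos hR, abs_sub_comm]
    exact div_le_div_of_nonneg_right (abs_gridDist_sub_le x y z) hR.le

theorem abs_laplacian_flow_le (C : Conductance d) (x y : IntLattice d) {t : ℝ} (ht : 0 ≤ t) :
    |C.laplacian (C.flow x t) y| ≤
      ∑' z, C.val y z * C.flow x t z + C.total y * C.flow x t y := by
  rw [laplacian_apply_eq, abs_le]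
  have h1 : 0 ≤ ∑' z, C.val y z * C.flow x t z :=
    tsum_nonneg fun z => mul_nonneg (C.nonneg _ _) (C.flow_nonneg x z ht)
  have h2 := mul_nonneg (C.total_nonneg y) (C.flow_nonneg x y ht)
  constructor <;> linarith

theorem summable_flow_rpow (C : Conductance d) (x : IntLattice d) {b t : ℝ} (hb : 0 ≤ b)
    (ht : 0 ≤ t) : Summable fun y => C.flow x t y ^ (1 + b) := by
  refine Summable.of_nonneg_of_le (fun y => Real.rpow_nonneg (C.flow_nonneg x y ht) _) (fun y => ?_)
    (C.summable_flow x ht)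
  have h := Real.rpow_le_rpow_of_exponent_ge_of_imp (C.flow_nonneg x y ht) (C.flow_le_one x y ht)
    (by linarith : 1 ≤ 1 + b) (by intro _ h; linarith)
  rwa [Real.rpow_one] at h

theorem abs_flow_rpow_le_one (C : Conductance d) (x y : IntLattice d) {b t : ℝ} (hb : 0 ≤ b)
    (ht : 0 ≤ t) : |C.flow x t y ^ b| ≤ 1 := by
  rw [abs_of_nonneg (Real.rpow_nonneg (C.flow_nonneg x y ht) _)]
  exact Real.rpow_le_one (C.flow_nonneg x y ht) (C.flow_le_one x y ht) hb

/-- Dissipation of the functional `∑ f_t^{1+b}`. -/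
theorem hasDerivAt_tsum_flow_rpow (C : Conductance d) (x : IntLattice d) {b t : ℝ} (hb : 0 ≤ b)
    (ht : 0 < t) :
    HasDerivAt (fun t => ∑' y, C.flow x t y ^ (1 + b))
      (-((1 + b) / 2) * C.dirichlet (fun y => C.flow x t y ^ b) (C.flow x t)) t := by
  obtain ⟨c, hc⟩ := C.bounded
  have hc0 : 0 ≤ c := (C.total_nonneg 0).trans (hc 0)
  set T := t + 1 with hT
  have hT0 : 0 ≤ T := by linarith
  -- On `(0, T)` the flow is dominated by a multiple of its value at time `T`.
  have hdom : ∀ s ∈ Set.Ioo 0 T, ∀ y, C.flow x s y ≤ Real.exp (T * c) * C.flow x T y := by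
    intro s hs y
    refine le_trans ?_ (C.flow_le_exp_mul hc x y hs.1.le hs.2.le)
    exact le_mul_of_one_le_left (C.flow_nonneg x y hs.1.le)
      (Real.one_le_exp (mul_nonneg hs.1.le hc0))
  set u : IntLattice d → ℝ := fun y => (1 + b) * (∑' z, C.val y z * (Real.exp (T * c) *
    C.flow x T z) + C.total y * (Real.exp (T * c) * C.flow x T y)) with hu
  have hsT : Summable fun y => Real.exp (T * c) * C.flow x T y :=
    (C.summable_flow x hT0).mul_left _
  have hus : Summable u :=
    ((C.tsum_tsum_val_mul hsT).1.add (C.summable_total_mul hsT)).mul_left _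
  have hder : ∀ y s, s ∈ Set.Ioo 0 T → HasDerivAt (fun s => C.flow x s y ^ (1 + b))
      (C.laplacian (C.flow x s) y * (1 + b) * C.flow x s y ^ (1 + b - 1)) s := fun y s _ =>
    (C.hasDerivAt_flow_apply x y s).rpow_const (Or.inr (by linarith))
  have hbound : ∀ y s, s ∈ Set.Ioo 0 T →
      ‖C.laplacian (C.flow x s) y * (1 + b) * C.flow x s y ^ (1 + b - 1)‖ ≤ u y := by
    intro y s hs
    rw [add_sub_cancel_left, Real.norm_eq_abs, abs_mul, abs_mul,
      abs_of_nonneg (by linarith : 0 ≤ 1 + b)]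
    have h1 := C.abs_flow_rpow_le_one x y hb hs.1.le
    have h2 := C.abs_laplacian_flow_le x y hs.1.le
    have h3 : ∑' z, C.val y z * C.flow x s z ≤
        ∑' z, C.val y z * (Real.exp (T * c) * C.flow x T z) := by
      refine Summable.tsum_le_tsum
        (fun z => mul_le_mul_of_nonneg_left (hdom s hs z) (C.nonneg y z))
        (C.summable_mul_of_bounded y (L2.abs_apply_le (C.flow x s)))
        (C.summable_mul_of_bounded y (b := Real.exp (T * c)) fun z => ?_)
      rw [abs_mul, abs_of_pos (Real.exp_pos _)]
      exact mul_le_of_le_one_right (Real.exp_pos _).le (C.abs_flow_le_one x z hT0)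
    have h4 := mul_le_mul_of_nonneg_left (hdom s hs y) (C.total_nonneg y)
    calc _ ≤ |C.laplacian (C.flow x s) y| * (1 + b) * 1 :=
          mul_le_mul_of_nonneg_left h1 (by positivity)
      _ = (1 + b) * |C.laplacian (C.flow x s) y| := by ring
      _ ≤ u y := mul_le_mul_of_nonneg_left (by linarith) (by linarith)
  have htm : t ∈ Set.Ioo 0 T := ⟨ht, by linarith⟩
  have h := hasDerivAt_tsum_of_isPreconnected hus isOpen_Ioo isPreconnected_Ioo hder hbound htm
    (C.summable_flow_rpow x hb ht.le) htm
  have h1 := C.tsum_mul_laplacian (g := fun y => C.flow x t y ^ b) (f := C.flow x t)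
    (fun y => C.abs_flow_rpow_le_one x y hb ht.le) (C.summable_flow x ht.le)
  have h2 : ∀ y, C.laplacian (C.flow x t) y * (1 + b) * C.flow x t y ^ (1 + b - 1) =
      (1 + b) * (C.flow x t y ^ b * C.laplacian (C.flow x t) y) := fun y => by
    rw [add_sub_cancel_left]; ring
  rw [tsum_congr h2, tsum_mul_left, h1] at h
  refine h.congr_deriv ?_
  ring

end Conductance

/-! ### Mass retention -/

namespace Conductance

variable {d : ℕ}

theorem tsum_cutoff_rpow_le (hd : 1 ≤ d) (C : Conductance d) (x : IntLattice d) {R t : ℝ}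
    (hR : 1 ≤ R) (ht : 0 ≤ t) :
    (Summable fun y => if 0 < cutoff x R y then C.flow x t y ^ (1 - 1 / (d : ℝ)) else 0) ∧
    ∑' y, (if 0 < cutoff x R y then C.flow x t y ^ (1 - 1 / (d : ℝ)) else 0) ≤
      R * (1 + 3 ^ d) := by
  have hd0 : (1 : ℝ) ≤ d := by exact_mod_cast hd
  have hR0 : 0 < R := by linarith
  have hb0 : 0 ≤ 1 / (d : ℝ) := by positivity
  have hb1 : 1 / (d : ℝ) ≤ 1 := by rw [div_le_one (by linarith)]; exact hd0
  have hz : ∀ y ∉ latticeBox x ⌊R⌋₊,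
      (if 0 < cutoff x R y then C.flow x t y ^ (1 - 1 / (d : ℝ)) else 0) = 0 := fun y hy =>
    if_neg fun h => hy (mem_latticeBox_of_cutoff_pos hR0 h)
  refine ⟨summable_of_ne_finset_zero hz, ?_⟩
  rw [tsum_eq_sum hz]
  have h1 : ∀ y ∈ latticeBox x ⌊R⌋₊,
      (if 0 < cutoff x R y then C.flow x t y ^ (1 - 1 / (d : ℝ)) else 0) ≤
        R * C.flow x t y + R * (R ^ d)⁻¹ := by
    intro y _
    have hf := C.flow_nonneg x y ht
    have hτ : 0 ≤ (R ^ d)⁻¹ := by positivity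
    have h2 := Real.geom_mean_le_arith_mean2_weighted (sub_nonneg.mpr hb1) hb0 hf hτ (by ring)
    have h3 : ((R ^ d)⁻¹) ^ (1 / (d : ℝ)) = R⁻¹ := by
      rw [← inv_pow, ← Real.rpow_natCast, ← Real.rpow_mul (by positivity),
        mul_one_div_cancel (by linarith), Real.rpow_one]
    rw [h3] at h2
    have h4 : (1 - 1 / (d : ℝ)) * C.flow x t y + 1 / (d : ℝ) * (R ^ d)⁻¹ ≤
        C.flow x t y + (R ^ d)⁻¹ := by
      nlinarith [mul_nonneg hb0 hf, mul_le_mul_of_nonneg_right hb1 hτ]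
    have h5 := mul_le_mul_of_nonneg_left (h2.trans h4) hR0.le
    have h6 : R * (C.flow x t y ^ (1 - 1 / (d : ℝ)) * R⁻¹) = C.flow x t y ^ (1 - 1 / (d : ℝ)) := by
      field_simp
    rw [h6] at h5
    split_ifs
    · linarith
    · positivity
  refine (Finset.sum_le_sum h1).trans ?_
  rw [Finset.sum_add_distrib, ← Finset.mul_sum, Finset.sum_const, nsmul_eq_mul, mul_add, mul_one]
  have h7 := mul_le_mul_of_nonneg_left (C.sum_flow_le_one x ht (latticeBox x ⌊R⌋₊)) hR0.le
  have h8 := mul_le_mul_of_nonneg_right (card_latticeBox_floor_le x hR)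
    (by positivity : 0 ≤ R * (R ^ d)⁻¹)
  have h9 : 3 ^ d * R ^ d * (R * (R ^ d)⁻¹) = R * 3 ^ d := by field_simp
  linarith

/-- The loss of mass of the cut-off ball is controlled by the jump bound and by the dissipation of
`∑ f^{1 + 1/d}`; the parameter `θ` balances the two. -/
theorem dirichlet_cutoff_le (hd : 1 ≤ d) (C : Conductance d) (x : IntLattice d) {R M t θ : ℝ}
    (hR : 1 ≤ R) (ht : 0 ≤ t) (hθ : 0 < θ) (hM : C.HasJumpBound R M) :
    C.dirichlet (cutoff x R) (C.flow x t) ≤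
      θ * d * (M / R ^ 2) * (R * (1 + 3 ^ d)) +
        1 / (2 * θ) * C.dirichlet (fun y => C.flow x t y ^ (1 / (d : ℝ))) (C.flow x t) := by
  have hd0 : (1 : ℝ) ≤ d := by exact_mod_cast hd
  have hR0 : 0 < R := by linarith
  have hb0 : 0 < 1 / (d : ℝ) := by positivity
  have hb1 : 1 / (d : ℝ) ≤ 1 := by rw [div_le_one (by linarith)]; exact hd0
  set h : IntLattice d → ℝ :=
    fun y => if 0 < cutoff x R y then C.flow x t y ^ (1 - 1 / (d : ℝ)) else 0 with hh
  have hh0 : ∀ y, 0 ≤ h y := fun y => by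
    simp only [hh]
    split_ifs
    · exact Real.rpow_nonneg (C.flow_nonneg x y ht) _
    · exact le_rfl
  obtain ⟨hs, hle⟩ := C.tsum_cutoff_rpow_le hd x hR ht
  obtain ⟨p1, p2⟩ := hM.tsum_pair_le hh0 hs
  have q1 := C.summable_dirichlet (g := fun y => C.flow x t y ^ (1 / (d : ℝ)))
    (fun y => C.abs_flow_rpow_le_one x y hb0.le ht) (C.summable_flow x ht)
  have q2 := C.summable_dirichlet (g := cutoff x R) (b := 1) (fun y => by
    rw [abs_of_nonneg (cutoff_nonneg x R y)]; exact cutoff_le_one x hR0 y) (C.summable_flow x ht)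
  have hθd : θ / (2 * (1 / (d : ℝ))) = θ * d / 2 := by field_simp
  have main := Summable.tsum_le_tsum (fun p => ?_) q2
    ((p1.mul_left (θ * d / 2)).add (q1.mul_left (1 / (2 * θ))))
  · rw [(p1.mul_left (θ * d / 2)).tsum_add (q1.mul_left (1 / (2 * θ))), tsum_mul_left,
      tsum_mul_left] at main
    refine main.trans (add_le_add ?_ le_rfl)
    have h1 : 0 ≤ M := hM.nonneg hR0
    have h2 : 2 * (M / R ^ 2) * ∑' y, h y ≤ 2 * (M / R ^ 2) * (R * (1 + 3 ^ d)) :=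
      mul_le_mul_of_nonneg_left hle (by positivity)
    have h3 := mul_le_mul_of_nonneg_left (p2.trans h2) (by positivity : 0 ≤ θ * d / 2)
    linarith
  · have h1 := flux_le hb0 hb1 (C.flow_nonneg x p.1 ht) (C.flow_nonneg x p.2 ht)
      (cutoff_nonneg x R p.1) (cutoff_nonneg x R p.2) hθ
    rw [hθd, ← mul_add] at h1
    have h2 := mul_le_mul_of_nonneg_right (cutoff_sub_sq_le x hR0 p.1 p.2)
      (add_nonneg (hh0 p.1) (hh0 p.2))
    have h3 := mul_le_mul_of_nonneg_left h2 (by positivity : 0 ≤ θ * d / 2)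
    have h4 := mul_le_mul_of_nonneg_left (h1.trans (add_le_add h3 le_rfl)) (C.nonneg p.1 p.2)
    refine h4.trans (le_of_eq ?_)
    ring

theorem tsum_flow_rpow_le (hd : 1 ≤ d) (C : Conductance d) (x : IntLattice d) {A t : ℝ}
    (hA : 0 ≤ A) (ht : 0 < t) (h : ∀ y, C.flow x t y ≤ A * t ^ (-(d : ℝ) / 2)) :
    ∑' y, C.flow x t y ^ (1 + 1 / (d : ℝ)) ≤ A ^ (1 / (d : ℝ)) * t ^ (-(1 / 2 : ℝ)) := by
  have hd0 : (1 : ℝ) ≤ d := by exact_mod_cast hd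
  have hb0 : 0 < 1 / (d : ℝ) := by positivity
  have e : (A * t ^ (-(d : ℝ) / 2)) ^ (1 / (d : ℝ)) = A ^ (1 / (d : ℝ)) * t ^ (-(1 / 2 : ℝ)) := by
    rw [Real.mul_rpow hA (by positivity), ← Real.rpow_mul ht.le]
    congr 2
    field_simp
  have hs := C.summable_flow x ht.le
  have h0 : 0 ≤ A ^ (1 / (d : ℝ)) * t ^ (-(1 / 2 : ℝ)) := by positivity
  calc ∑' y, C.flow x t y ^ (1 + 1 / (d : ℝ))
      ≤ ∑' y, A ^ (1 / (d : ℝ)) * t ^ (-(1 / 2 : ℝ)) * C.flow x t y := by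
        refine Summable.tsum_le_tsum (fun y => ?_) (C.summable_flow_rpow x hb0.le ht.le)
          (hs.mul_left _)
        have hf := C.flow_nonneg x y ht.le
        rw [Real.rpow_add_of_nonneg hf zero_le_one hb0.le, Real.rpow_one, mul_comm, ← e]
        exact mul_le_mul_of_nonneg_right (Real.rpow_le_rpow hf (h y) hb0.le) hf
    _ ≤ _ := by
        rw [tsum_mul_left]
        exact mul_le_of_le_one_right h0 (C.tsum_flow_le_one x ht.le)

/-- Up to a small multiple of the time `R²`, half of the mass stays within distance `R`. -/
theorem exists_half_le_sum_flow (hd : 1 ≤ d) (m : ℕ) {δ : ℝ} (hδ : 0 < δ) {M : ℝ} (hM0 : 0 ≤ M) :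
    ∃ η : ℝ, 0 < η ∧ η ≤ 1 ∧ ∀ C : Conductance d, C.HasChains m δ → ∀ R : ℝ, 1 ≤ R →
      C.HasJumpBound R M → ∀ x : IntLattice d, ∀ T : ℝ, 0 < T → T ≤ η * R ^ 2 →
        1 / 2 ≤ ∑ y ∈ latticeBox x ⌊R⌋₊, C.flow x T y := by
  have hd0 : (1 : ℝ) ≤ d := by exact_mod_cast hd
  obtain ⟨A, hA, hup⟩ := exists_flow_le hd m hδ
  set a : ℝ := A ^ (1 / (d : ℝ)) with ha
  have ha0 : 0 ≤ a := by positivity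
  set K₂ : ℝ := d * M * (1 + 3 ^ d) / 4 with hK₂
  have hK₂0 : 0 ≤ K₂ := by positivity
  set K₃ : ℝ := 4 * K₂ + 3 * a with hK₃
  have hK₃0 : 0 ≤ K₃ := by positivity
  refine ⟨(1 / (2 * K₃ + 2)) ^ 4, by positivity, ?_, ?_⟩
  · refine pow_le_one₀ (by positivity) ?_
    rw [div_le_one (by positivity)]
    linarith
  intro C hC R hR hM x T hT hTη
  have hR0 : 0 < R := by linarith
  set b : ℝ := 1 / (d : ℝ) with hb
  have hb0 : 0 < b := by positivity
  set φ : ℝ → ℝ := fun t => ∑' y, C.flow x t y ^ (1 + b) with hφ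
  set B := latticeBox x ⌊R⌋₊ with hB
  set μ : ℝ → ℝ := fun t => ∑ y ∈ B, cutoff x R y * C.flow x t y with hμ
  set D : ℝ → ℝ := fun t => C.dirichlet (fun y => C.flow x t y ^ b) (C.flow x t) with hD
  have hμ' : ∀ t, 0 ≤ t → HasDerivAt μ (-(C.dirichlet (cutoff x R) (C.flow x t)) / 2) t := by
    intro t ht
    have h1 : HasDerivAt μ (∑ y ∈ B, cutoff x R y * C.laplacian (C.flow x t) y) t :=
      HasDerivAt.fun_sum fun y _ => (C.hasDerivAt_flow_apply x y t).const_mul _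
    refine h1.congr_deriv ?_
    rw [← C.tsum_mul_laplacian (g := cutoff x R) (b := 1) (fun y => by
      rw [abs_of_nonneg (cutoff_nonneg x R y)]; exact cutoff_le_one x hR0 y)
      (C.summable_flow x ht), tsum_eq_sum]
    intro y hy
    have : cutoff x R y = 0 := le_antisymm
      (not_lt.mp fun h => hy (mem_latticeBox_of_cutoff_pos hR0 h)) (cutoff_nonneg x R y)
    rw [this, zero_mul]
  have hφ' : ∀ t, 0 < t → HasDerivAt φ (-((1 + b) / 2) * D t) t := fun t ht =>
    C.hasDerivAt_tsum_flow_rpow x hb0.le ht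
  have hD0 : ∀ t, 0 ≤ t → 0 ≤ D t := fun t ht => tsum_nonneg fun p =>
    mul_nonneg (C.nonneg _ _) (rpow_sub_mul_sub_nonneg hb0.le (C.flow_nonneg x _ ht)
      (C.flow_nonneg x _ ht))
  have hφ0 : ∀ t, 0 ≤ t → 0 ≤ φ t := fun t ht => tsum_nonneg fun y =>
    Real.rpow_nonneg (C.flow_nonneg x y ht) _
  have hφ1 : ∀ t, 0 ≤ t → φ t ≤ 1 := by
    intro t ht
    refine le_trans (Summable.tsum_le_tsum (fun y => ?_) (C.summable_flow_rpow x hb0.le ht)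
      (C.summable_flow x ht)) (C.tsum_flow_le_one x ht)
    have hf := C.flow_nonneg x y ht
    rw [Real.rpow_add_of_nonneg hf zero_le_one hb0.le, Real.rpow_one]
    exact mul_le_of_le_one_right hf (le_of_abs_le (C.abs_flow_rpow_le_one x y hb0.le ht))
  have hφ2 : ∀ t, 0 < t → φ t ≤ a * t ^ (-(1 / 2 : ℝ)) := fun t ht =>
    C.tsum_flow_rpow_le hd x hA.le ht fun y => hup C hC x y t ht
  -- The weight `t ^ (3 / 4)` makes the total dissipation integrable at `0`.
  have hmono : MonotoneOn (fun t => √R * μ t - t ^ (3 / 4 : ℝ) * φ t + K₃ * t ^ (1 / 4 : ℝ))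
      (Set.Ioi 0) := by
    refine monotoneOn_of_hasDerivAt (convex_Ioi 0) (fun t ht =>
      (((hμ' t (le_of_lt ht)).const_mul (√R)).sub
        ((Real.hasDerivAt_rpow_const (Or.inl (ne_of_gt ht))).mul (hφ' t ht))).add
        ((Real.hasDerivAt_rpow_const (Or.inl (ne_of_gt ht))).const_mul K₃)) ?_
    intro t ht
    have ht0 : 0 < t := ht
    have hsR : 0 < √R := Real.sqrt_pos.mpr hR0
    have hRR : √R * √R = R := Real.mul_self_sqrt hR0.le
    have hp : 0 < t ^ (3 / 4 : ℝ) := by positivity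
    have e1 : (3 / 4 - 1 : ℝ) = -(1 / 4) := by norm_num
    have e2 : (1 / 4 - 1 : ℝ) = -(3 / 4) := by norm_num
    have e3 : t ^ (-(1 / 4) : ℝ) * t ^ (-(1 / 2) : ℝ) = (t ^ (3 / 4 : ℝ))⁻¹ := by
      rw [← Real.rpow_add ht0, ← Real.rpow_neg ht0.le]; norm_num
    have e4 : t ^ (-(3 / 4) : ℝ) = (t ^ (3 / 4 : ℝ))⁻¹ := Real.rpow_neg ht0.le _
    rw [e1, e2, e4]
    set τ := t ^ (3 / 4 : ℝ) with hτ
    -- With this `θ` the dissipation term is absorbed by the derivative of `φ`.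
    have hflux := C.dirichlet_cutoff_le hd x hR ht0.le
      (by positivity : 0 < √R / (2 * τ)) hM
    change C.dirichlet (cutoff x R) (C.flow x t) ≤ _ + 1 / (2 * (√R / (2 * τ))) * D t at hflux
    have h1 : √R / (2 * τ) * d * (M / R ^ 2) * (R * (1 + 3 ^ d)) = 2 * K₂ * τ⁻¹ / √R := by
      rw [hK₂]
      rw [eq_div_iff hsR.ne']
      have : √R / (2 * τ) * d * (M / R ^ 2) * (R * (1 + 3 ^ d)) * √R =
        (√R * √R) / (2 * τ) * d * (M / R ^ 2) * (R * (1 + 3 ^ d)) := by ring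
      rw [this, hRR]
      field_simp
      ring
    have h2 : 1 / (2 * (√R / (2 * τ))) = τ / √R := by field_simp
    rw [h1, h2] at hflux
    have h3 : √R * C.dirichlet (cutoff x R) (C.flow x t) ≤ 2 * K₂ * τ⁻¹ + τ * D t := by
      have h4 := mul_le_mul_of_nonneg_left hflux hsR.le
      refine h4.trans (le_of_eq ?_)
      field_simp
    have h5 : t ^ (-(1 / 4) : ℝ) * φ t ≤ a * τ⁻¹ := by
      have h6 := mul_le_mul_of_nonneg_left (hφ2 t ht0)
        (by positivity : 0 ≤ t ^ (-(1 / 4) : ℝ))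
      calc _ ≤ _ := h6
        _ = a * (t ^ (-(1 / 4) : ℝ) * t ^ (-(1 / 2) : ℝ)) := by ring
        _ = _ := by rw [e3]
    have h6 : 0 ≤ b * (τ * D t) := mul_nonneg hb0.le (mul_nonneg hp.le (hD0 t ht0.le))
    rw [hK₃]
    linarith
  have h1 : ∀ s ∈ Set.Ioo 0 T, √R * μ s - s ^ (3 / 4 : ℝ) ≤ √R * μ T + K₃ * T ^ (1 / 4 : ℝ) := by
    intro s hs
    have h2 := hmono (Set.mem_Ioi.mpr hs.1) (Set.mem_Ioi.mpr hT) hs.2.le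
    simp only at h2
    have h3 : 0 ≤ T ^ (3 / 4 : ℝ) * φ T := mul_nonneg (by positivity) (hφ0 T hT.le)
    have h4 : 0 ≤ K₃ * s ^ (1 / 4 : ℝ) := mul_nonneg hK₃0 (Real.rpow_nonneg hs.1.le _)
    have h5 : s ^ (3 / 4 : ℝ) * φ s ≤ s ^ (3 / 4 : ℝ) :=
      mul_le_of_le_one_right (Real.rpow_nonneg hs.1.le _) (hφ1 s hs.1.le)
    linarith
  have hμ0 : μ 0 = 1 := by
    simp only [hμ, flow_zero]
    rw [Finset.sum_eq_single x]
    · simp [cutoff, gridDist_self]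
    · intro y _ hy
      simp [lp.single_apply, hy]
    · intro hx
      exact absurd (mem_latticeBox.mpr fun i => by simp) hx
  have hlim : Filter.Tendsto (fun s => √R * μ s - s ^ (3 / 4 : ℝ)) (nhdsWithin 0 (Set.Ioi 0))
      (nhds (√R)) := by
    have h2 : ContinuousAt (fun s => √R * μ s - s ^ (3 / 4 : ℝ)) 0 :=
      (continuousAt_const.mul (hμ' 0 le_rfl).continuousAt).sub
        (Real.continuousAt_rpow_const _ _ (Or.inr (by norm_num)))
    have h3 := h2.tendsto
    rw [hμ0, Real.zero_rpow (by norm_num), mul_one, sub_zero] at h3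
    exact h3.mono_left nhdsWithin_le_nhds
  have h2 : √R ≤ √R * μ T + K₃ * T ^ (1 / 4 : ℝ) :=
    le_of_tendsto hlim (Filter.mem_of_superset (Ioo_mem_nhdsGT hT) h1)
  have hsR : 0 < √R := Real.sqrt_pos.mpr hR0
  have h3 : T ^ (1 / 4 : ℝ) ≤ 1 / (2 * K₃ + 2) * √R := by
    have e : (1 / (2 * K₃ + 2)) ^ 4 * R ^ 2 = (1 / (2 * K₃ + 2) * √R) ^ 4 := by
      rw [mul_pow]
      congr 1
      rw [show (4 : ℕ) = 2 * 2 from rfl, pow_mul, Real.sq_sqrt hR0.le]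
    rw [e] at hTη
    have h4 := Real.rpow_le_rpow hT.le hTη (by norm_num : (0 : ℝ) ≤ 1 / 4)
    rwa [← Real.rpow_natCast (_ * √R) 4, ← Real.rpow_mul (by positivity),
      show ((4 : ℕ) : ℝ) * (1 / 4) = 1 by norm_num, Real.rpow_one] at h4
  have h4 : K₃ * T ^ (1 / 4 : ℝ) ≤ 1 / 2 * √R := by
    refine (mul_le_mul_of_nonneg_left h3 hK₃0).trans ?_
    rw [← mul_assoc]
    refine mul_le_mul_of_nonneg_right ?_ hsR.le
    rw [mul_one_div, div_le_iff₀ (by positivity)]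
    linarith
  have h5 : 1 / 2 ≤ μ T := by
    have : √R * (1 / 2) ≤ √R * μ T := by linarith
    exact le_of_mul_le_mul_left this hsR
  refine h5.trans (Finset.sum_le_sum fun y _ => ?_)
  exact mul_le_of_le_one_left (C.flow_nonneg x y hT.le) (cutoff_le_one x hR0 y)

end Conductance

/-! ### Hardy and Poincaré inequalities on the integers -/

open scoped ENNReal

/-- The weight `e^{-|c - k| / R}` on `ℤ`. -/
noncomputable def expWeight (R : ℝ) (c k : ℤ) : ℝ := Real.exp (-|(c : ℝ) - k| / R)

theorem expWeight_pos (R : ℝ) (c k : ℤ) : 0 < expWeight R c k := Real.exp_pos _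

/-- A Hardy inequality on the half line for geometric weights. -/
theorem tsum_hardy_nat {q : ℝ} (hq0 : 0 < q) (hq1 : q < 1) (φ : ℕ → ℝ) :
    ∑' a : ℕ, ENNReal.ofReal (q ^ (2 * a) * (φ a - φ 0) ^ 2) ≤
      ENNReal.ofReal ((q * (1 - q) ^ 2)⁻¹) *
        ∑' j : ℕ, ENNReal.ofReal (q ^ (2 * (j + 1)) * (φ (j + 1) - φ j) ^ 2) := by
  have h1q : 0 < 1 - q := by linarith
  have h1 : ∀ a : ℕ, q ^ (2 * a) * (φ a - φ 0) ^ 2 ≤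
      ∑ j ∈ Finset.range a, q ^ a * ((1 - q)⁻¹ * q ^ j * (φ (j + 1) - φ j) ^ 2) := by
    intro a
    -- Cauchy–Schwarz with the weights `q ^ j`, the square roots of the geometric weights.
    have h2 : (φ a - φ 0) ^ 2 ≤ (∑ j ∈ Finset.range a, (q⁻¹) ^ j) *
        ∑ j ∈ Finset.range a, q ^ j * (φ (j + 1) - φ j) ^ 2 := by
      rw [← Finset.sum_range_sub]
      refine Finset.sum_sq_le_sum_mul_sum_of_sq_le_mul _ (fun j _ => by positivity)
        (fun j _ => by positivity) (fun j _ => le_of_eq ?_)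
      rw [← mul_assoc, ← mul_pow, inv_mul_cancel₀ hq0.ne', one_pow, one_mul]
    have h3 : q ^ a * ∑ j ∈ Finset.range a, (q⁻¹) ^ j ≤ (1 - q)⁻¹ := by
      have e : q ^ a * ∑ j ∈ Finset.range a, (q⁻¹) ^ j =
          ∑ j ∈ Finset.range a, q ^ (j + 1) := by
        rw [Finset.mul_sum, ← Finset.sum_range_reflect]
        refine Finset.sum_congr rfl fun j hj => ?_
        have hj' := Finset.mem_range.mp hj
        have : a = (a - 1 - j) + (j + 1) := by omega
        conv_lhs => rw [this]
        rw [pow_add, inv_pow]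
        have e1 : a - 1 - j + (j + 1) - 1 - j = a - 1 - j := by omega
        rw [e1]
        field_simp
      rw [e]
      have hg := (summable_geometric_of_lt_one hq0.le hq1).sum_le_tsum (Finset.range a)
        (fun j _ => by positivity)
      rw [tsum_geometric_of_lt_one hq0.le hq1] at hg
      refine le_trans (Finset.sum_le_sum fun j _ => ?_) hg
      exact pow_le_pow_of_le_one hq0.le hq1.le (Nat.le_succ j)
    have h4 : 0 ≤ ∑ j ∈ Finset.range a, q ^ j * (φ (j + 1) - φ j) ^ 2 :=
      Finset.sum_nonneg fun j _ => by positivity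
    calc q ^ (2 * a) * (φ a - φ 0) ^ 2
        ≤ q ^ (2 * a) * ((∑ j ∈ Finset.range a, (q⁻¹) ^ j) *
            ∑ j ∈ Finset.range a, q ^ j * (φ (j + 1) - φ j) ^ 2) :=
          mul_le_mul_of_nonneg_left h2 (by positivity)
      _ = q ^ a * ((q ^ a * ∑ j ∈ Finset.range a, (q⁻¹) ^ j) *
            ∑ j ∈ Finset.range a, q ^ j * (φ (j + 1) - φ j) ^ 2) := by
          rw [two_mul, pow_add]; ring
      _ ≤ q ^ a * ((1 - q)⁻¹ * ∑ j ∈ Finset.range a, q ^ j * (φ (j + 1) - φ j) ^ 2) :=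
          mul_le_mul_of_nonneg_left (mul_le_mul_of_nonneg_right h3 h4) (by positivity)
      _ = _ := by
          rw [← Finset.mul_sum]
          congr 1
          rw [Finset.mul_sum]
          exact Finset.sum_congr rfl fun j _ => by ring
  set E : ℕ → ℝ := fun j => (1 - q)⁻¹ * q ^ j * (φ (j + 1) - φ j) ^ 2 with hE
  have hE0 : ∀ j, 0 ≤ E j := fun j => by positivity
  have h5 : ∀ a : ℕ, ENNReal.ofReal (q ^ (2 * a) * (φ a - φ 0) ^ 2) ≤
      ∑' j : ℕ, (if j < a then ENNReal.ofReal (q ^ a) * ENNReal.ofReal (E j) else 0) := by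
    intro a
    refine (ENNReal.ofReal_le_ofReal (h1 a)).trans ?_
    rw [ENNReal.ofReal_sum_of_nonneg fun j _ => mul_nonneg (by positivity) (hE0 j)]
    refine le_trans (Finset.sum_le_sum fun j hj => ?_) (ENNReal.sum_le_tsum (Finset.range a))
    rw [if_pos (Finset.mem_range.mp hj), ENNReal.ofReal_mul (by positivity)]
  refine (ENNReal.tsum_le_tsum h5).trans ?_
  rw [ENNReal.tsum_comm, ← ENNReal.tsum_mul_left]
  refine ENNReal.tsum_le_tsum fun j => ?_
  have h6 : ∑' a : ℕ, (if j < a then ENNReal.ofReal (q ^ a) * ENNReal.ofReal (E j) else 0) =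
      ENNReal.ofReal (q ^ (j + 1) * (1 - q)⁻¹) * ENNReal.ofReal (E j) := by
    rw [← Summable.sum_add_tsum_nat_add' (k := j + 1) ENNReal.summable, Finset.sum_eq_zero, zero_add]
    · have h7 : ∀ a : ℕ, (if j < a + (j + 1) then
          ENNReal.ofReal (q ^ (a + (j + 1))) * ENNReal.ofReal (E j) else 0) =
          ENNReal.ofReal (q ^ (j + 1) * q ^ a) * ENNReal.ofReal (E j) := fun a => by
        rw [if_pos (by omega), pow_add, mul_comm (q ^ a)]
      rw [tsum_congr h7, ENNReal.tsum_mul_right, tsum_ofReal_eq (fun a => by positivity)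
        ((summable_geometric_of_lt_one hq0.le hq1).mul_left _), tsum_mul_left,
        tsum_geometric_of_lt_one hq0.le hq1]
    · intro a ha
      rw [if_neg (by have := Finset.mem_range.mp ha; omega)]
  rw [h6, ← ENNReal.ofReal_mul (by positivity), ← ENNReal.ofReal_mul (by positivity)]
  refine ENNReal.ofReal_le_ofReal (le_of_eq ?_)
  simp only [hE]
  field_simp
  ring

theorem tsum_int_eq (F : ℤ → ℝ≥0∞) :
    ∑' a : ℤ, F a = ∑' n : ℕ, F n + ∑' n : ℕ, F (-(n + 1 : ℤ)) :=
  (HasSum.of_nat_of_neg_add_one ENNReal.summable.hasSum ENNReal.summable.hasSum).tsum_eq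

theorem tsum_int_le (F : ℤ → ℝ≥0∞) :
    ∑' a : ℤ, F a ≤ ∑' n : ℕ, F n + ∑' n : ℕ, F (-(n : ℤ)) := by
  rw [tsum_int_eq]
  refine add_le_add le_rfl ?_
  rw [← Summable.sum_add_tsum_nat_add' (f := fun n : ℕ => F (-(n : ℤ))) (k := 1) ENNReal.summable]
  refine le_add_left (le_of_eq (tsum_congr fun n => ?_))
  push_cast
  rfl

theorem one_sub_exp_neg_ge {u : ℝ} (hu : 0 ≤ u) (hu1 : u ≤ 1) : u / 2 ≤ 1 - Real.exp (-u) := by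
  have h1 := Real.add_one_le_exp u
  have h2 : Real.exp (-u) ≤ 1 / (1 + u) := by
    rw [Real.exp_neg, ← one_div]
    exact one_div_le_one_div_of_le (by linarith) (by linarith)
  have h3 : 1 / (1 + u) ≤ 1 - u / 2 := by
    rw [div_le_iff₀ (by linarith)]
    nlinarith
  linarith

theorem tsum_hardy_int {R : ℝ} (hR : 1 ≤ R) (φ : ℤ → ℝ) :
    ∑' a : ℤ, ENNReal.ofReal (expWeight R 0 a * (φ a - φ 0) ^ 2) ≤
      ENNReal.ofReal (32 * R ^ 2) *
        ∑' a : ℤ, ENNReal.ofReal (expWeight R 0 a * (φ (a + 1) - φ a) ^ 2) := by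
  have hR0 : 0 < R := by linarith
  set q := Real.exp (-(1 / (2 * R))) with hq
  have hq0 : 0 < q := Real.exp_pos _
  have hu1 : 1 / (2 * R) ≤ 1 / 2 := by
    rw [div_le_div_iff₀ (by positivity) (by norm_num)]; linarith
  have hq1 : q < 1 := Real.exp_lt_one_iff.mpr (by rw [neg_lt_zero]; positivity)
  have hwq : ∀ n : ℕ, expWeight R 0 n = q ^ (2 * n) := by
    intro n
    rw [expWeight, hq, ← Real.exp_nat_mul]
    congr 1
    push_cast
    rw [zero_sub, abs_neg, Nat.abs_cast]
    field_simp
  have hwq' : ∀ n : ℕ, expWeight R 0 (-(n : ℤ)) = q ^ (2 * n) := by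
    intro n
    rw [← hwq, expWeight, expWeight]
    push_cast
    rw [zero_sub, zero_sub, neg_neg, abs_neg]
  have hK : (q * (1 - q) ^ 2)⁻¹ ≤ 32 * R ^ 2 := by
    have h1 := one_sub_exp_neg_ge (by positivity : 0 ≤ 1 / (2 * R)) (by linarith)
    rw [← hq] at h1
    have h2 : 1 / 2 ≤ q := by
      have := Real.add_one_le_exp (-(1 / (2 * R)))
      rw [← hq] at this
      linarith
    have h3 : 1 / (32 * R ^ 2) ≤ q * (1 - q) ^ 2 := by
      have h4 : (1 / (2 * R) / 2) ^ 2 ≤ (1 - q) ^ 2 := pow_le_pow_left₀ (by positivity) h1 2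
      have h5 : 1 / 2 * (1 / (2 * R) / 2) ^ 2 ≤ q * (1 - q) ^ 2 :=
        mul_le_mul h2 h4 (by positivity) hq0.le
      refine le_trans (le_of_eq ?_) h5
      field_simp
      norm_num
    rw [← one_div]
    refine (one_div_le_one_div_of_le (by positivity) h3).trans (le_of_eq ?_)
    rw [one_div_one_div]
  refine (tsum_int_le _).trans ?_
  have hpos := tsum_hardy_nat hq0 hq1 (fun n : ℕ => φ n)
  have hneg := tsum_hardy_nat hq0 hq1 (fun n : ℕ => φ (-(n : ℤ)))
  have e1 : ∀ n : ℕ, ENNReal.ofReal (expWeight R 0 n * (φ n - φ 0) ^ 2) =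
      ENNReal.ofReal (q ^ (2 * n) * (φ n - φ (0 : ℕ)) ^ 2) := fun n => by rw [hwq]; rfl
  have e2 : ∀ n : ℕ, ENNReal.ofReal (expWeight R 0 (-(n : ℤ)) * (φ (-(n : ℤ)) - φ 0) ^ 2) =
      ENNReal.ofReal (q ^ (2 * n) * (φ (-(n : ℤ)) - φ (-((0 : ℕ) : ℤ))) ^ 2) := fun n => by
    rw [hwq']; rfl
  rw [tsum_congr e1, tsum_congr e2]
  refine (add_le_add hpos hneg).trans ?_
  rw [← mul_add, tsum_int_eq]
  refine mul_le_mul' (ENNReal.ofReal_le_ofReal hK) (add_le_add ?_ ?_)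
  · refine ENNReal.tsum_le_tsum fun n => ENNReal.ofReal_le_ofReal ?_
    rw [hwq]
    push_cast
    exact mul_le_mul_of_nonneg_right (pow_le_pow_of_le_one hq0.le hq1.le (by omega))
      (sq_nonneg _)
  · refine ENNReal.tsum_le_tsum fun n => ENNReal.ofReal_le_ofReal (le_of_eq ?_)
    have h1 : -((n : ℤ) + 1) + 1 = -(n : ℤ) := by ring
    have h2 := hwq' (n + 1)
    push_cast at h2
    rw [h1, h2]
    push_cast
    ring

theorem tsum_expWeight_le {R : ℝ} (hR : 1 ≤ R) (c : ℤ) :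
    ∑' a : ℤ, ENNReal.ofReal (expWeight R c a) ≤ ENNReal.ofReal (4 * R) := by
  have hR0 : 0 < R := by linarith
  set q := Real.exp (-(1 / R)) with hq
  have hq0 : 0 < q := Real.exp_pos _
  have hq1 : q < 1 := Real.exp_lt_one_iff.mpr (by rw [neg_lt_zero]; positivity)
  have h0 : ∑' a : ℤ, ENNReal.ofReal (expWeight R c a) =
      ∑' a : ℤ, ENNReal.ofReal (expWeight R 0 a) := by
    rw [← (Equiv.addRight c).tsum_eq]
    refine tsum_congr fun a => ?_
    rw [expWeight, expWeight, Equiv.coe_addRight]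
    push_cast
    congr 5
    ring
  have h1 : ∀ n : ℕ, expWeight R 0 n = q ^ n := by
    intro n
    rw [expWeight, hq, ← Real.exp_nat_mul]
    congr 1
    push_cast
    rw [zero_sub, abs_neg, Nat.abs_cast]
    field_simp
  have h2 : ∀ n : ℕ, expWeight R 0 (-(n : ℤ)) = q ^ n := by
    intro n
    rw [← h1, expWeight, expWeight]
    push_cast
    rw [zero_sub, zero_sub, neg_neg, abs_neg]
  rw [h0]
  refine (tsum_int_le _).trans ?_
  simp only [h1, h2]
  rw [tsum_ofReal_eq (fun n => by positivity) (summable_geometric_of_lt_one hq0.le hq1),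
    tsum_geometric_of_lt_one hq0.le hq1, ← ENNReal.ofReal_add (by
      rw [inv_nonneg]; linarith) (by rw [inv_nonneg]; linarith)]
  refine ENNReal.ofReal_le_ofReal ?_
  have h3 := one_sub_exp_neg_ge (by positivity : 0 ≤ 1 / R) (by rw [div_le_one hR0]; exact hR)
  rw [← hq] at h3
  have h4 : (1 - q)⁻¹ ≤ 2 * R := by
    rw [← one_div]
    refine (one_div_le_one_div_of_le (by positivity) h3).trans (le_of_eq ?_)
    field_simp
  linarith

/-- The Poincaré inequality on `ℤ` for the two-sided geometric weight. -/
theorem tsum_poincare_int {R : ℝ} (hR : 1 ≤ R) (c : ℤ) (φ : ℤ → ℝ) :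
    ∑' a : ℤ, ∑' b : ℤ, ENNReal.ofReal (expWeight R c a) * (ENNReal.ofReal (expWeight R c b) *
        ENNReal.ofReal ((φ a - φ b) ^ 2)) ≤
      ENNReal.ofReal (128 * R ^ 2) * (∑' a : ℤ, ENNReal.ofReal (expWeight R c a)) *
        ∑' a : ℤ, ENNReal.ofReal (expWeight R c a) * ENNReal.ofReal ((φ (a + 1) - φ a) ^ 2) := by
  set w : ℤ → ℝ≥0∞ := fun a => ENNReal.ofReal (expWeight R c a) with hw
  set W := ∑' a, w a with hW
  set S := ∑' a, w a * ENNReal.ofReal ((φ a - φ c) ^ 2) with hS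
  have hS1 : S ≤ ENNReal.ofReal (32 * R ^ 2) *
      ∑' a : ℤ, w a * ENNReal.ofReal ((φ (a + 1) - φ a) ^ 2) := by
    have h := tsum_hardy_int hR (fun a => φ (a + c))
    have hshift : ∀ a, expWeight R 0 a = expWeight R c (a + c) := fun a => by
      rw [expWeight, expWeight]
      push_cast
      congr 3
      ring_nf
    have e1 : S = ∑' a : ℤ, ENNReal.ofReal (expWeight R 0 a * (φ (a + c) - φ (0 + c)) ^ 2) := by
      rw [hS, ← (Equiv.addRight c).tsum_eq]
      refine tsum_congr fun a => ?_
      rw [ENNReal.ofReal_mul (expWeight_pos _ _ _).le, zero_add, hshift]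
      rfl
    have e2 : ∑' a : ℤ, w a * ENNReal.ofReal ((φ (a + 1) - φ a) ^ 2) =
        ∑' a : ℤ, ENNReal.ofReal (expWeight R 0 a * (φ (a + 1 + c) - φ (a + c)) ^ 2) := by
      rw [← (Equiv.addRight c).tsum_eq]
      refine tsum_congr fun a => ?_
      rw [ENNReal.ofReal_mul (expWeight_pos _ _ _).le, hshift, add_right_comm]
      rfl
    rw [e1, e2]
    exact h
  have h1 : ∀ a b, ENNReal.ofReal ((φ a - φ b) ^ 2) ≤
      2 * ENNReal.ofReal ((φ a - φ c) ^ 2) + 2 * ENNReal.ofReal ((φ b - φ c) ^ 2) := by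
    intro a b
    have e : (2 : ℝ≥0∞) = ENNReal.ofReal 2 := by norm_num
    rw [e, ← ENNReal.ofReal_mul (by norm_num), ← ENNReal.ofReal_mul (by norm_num),
      ← ENNReal.ofReal_add (by positivity) (by positivity)]
    refine ENNReal.ofReal_le_ofReal ?_
    nlinarith [sq_nonneg (φ a - φ c + (φ b - φ c))]
  calc ∑' a : ℤ, ∑' b : ℤ, w a * (w b * ENNReal.ofReal ((φ a - φ b) ^ 2))
      ≤ ∑' a : ℤ, ∑' b : ℤ, (2 * (w a * ENNReal.ofReal ((φ a - φ c) ^ 2)) * w b +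
          2 * w a * (w b * ENNReal.ofReal ((φ b - φ c) ^ 2))) := by
        refine ENNReal.tsum_le_tsum fun a => ENNReal.tsum_le_tsum fun b => ?_
        refine (mul_le_mul_right (mul_le_mul_right (h1 a b) (w b)) (w a)).trans (le_of_eq ?_)
        ring
    _ = 4 * W * S := by
        simp only [ENNReal.tsum_add, ENNReal.tsum_mul_left, ENNReal.tsum_mul_right]
        rw [← hW, ← hS]
        ring
    _ ≤ 4 * W * (ENNReal.ofReal (32 * R ^ 2) *
          ∑' a : ℤ, w a * ENNReal.ofReal ((φ (a + 1) - φ a) ^ 2)) := mul_le_mul_right hS1 _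
    _ = _ := by
        have e : ENNReal.ofReal (128 * R ^ 2) = 4 * ENNReal.ofReal (32 * R ^ 2) := by
          have : (4 : ℝ≥0∞) = ENNReal.ofReal 4 := by norm_num
          rw [this, ← ENNReal.ofReal_mul (by norm_num)]
          congr 1
          ring
        rw [e]
        ring

/-! ### The weighted Poincaré inequality on the lattice -/

section Tensorization

variable {d : ℕ}

/-- The point whose coordinates before the `j`-th are those of `z`, the others those of `y`. -/
def hybrid (j : ℕ) (y z : IntLattice d) : IntLattice d := fun i => if (i : ℕ) < j then z i else y i

theorem hybrid_zero (y z : IntLattice d) : hybrid 0 y z = y := by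
  funext i; simp [hybrid]

theorem hybrid_top (y z : IntLattice d) : hybrid d y z = z := by
  funext i; simp [hybrid]

theorem hybrid_succ (i : Fin d) (y z : IntLattice d) :
    hybrid (i + 1) y z = Function.update (hybrid i y z) i (hybrid i z y i) := by
  funext k
  by_cases hk : k = i
  · subst hk; simp [hybrid]
  · have : (k : ℕ) ≠ i := fun h => hk (Fin.ext h)
    rw [Function.update_of_ne hk]
    simp only [hybrid]
    have e : (k : ℕ) < i + 1 ↔ (k : ℕ) < i := by omega
    simp only [e]

/-- Exchanging the coordinates before the `j`-th of a pair of points. -/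
def hybridSwap (j : ℕ) : Equiv.Perm (IntLattice d × IntLattice d) where
  toFun p := (hybrid j p.1 p.2, hybrid j p.2 p.1)
  invFun p := (hybrid j p.1 p.2, hybrid j p.2 p.1)
  left_inv p := by
    ext i <;> simp only [hybrid] <;> split_ifs <;> rfl
  right_inv p := by
    ext i <;> simp only [hybrid] <;> split_ifs <;> rfl

theorem prod_hybrid_mul (w : Fin d → ℤ → ℝ≥0∞) (j : ℕ) (y z : IntLattice d) :
    (∏ i, w i (hybrid j y z i)) * ∏ i, w i (hybrid j z y i) =
      (∏ i, w i (y i)) * ∏ i, w i (z i) := by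
  rw [← Finset.prod_mul_distrib, ← Finset.prod_mul_distrib]
  refine Finset.prod_congr rfl fun i _ => ?_
  simp only [hybrid]
  split_ifs
  · exact mul_comm _ _
  · rfl

theorem sq_sub_le_sum_hybrid (g : IntLattice d → ℝ) (y z : IntLattice d) :
    (g y - g z) ^ 2 ≤ d * ∑ i : Fin d, (g (hybrid i y z) - g (hybrid (i + 1) y z)) ^ 2 := by
  have h : g y - g z = ∑ i : Fin d, (g (hybrid i y z) - g (hybrid (i + 1) y z)) := by
    rw [Fin.sum_univ_eq_sum_range fun j => g (hybrid j y z) - g (hybrid (j + 1) y z),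
      Finset.sum_range_sub', hybrid_zero, hybrid_top]
  rw [h]
  have := sq_sum_le_card_mul_sum_sq (s := (Finset.univ : Finset (Fin d)))
    (f := fun i : Fin d => g (hybrid i y z) - g (hybrid (i + 1) y z))
  simpa using this

/-- Tensorization of the variance for a product weight. Passing from `y` to `z` one coordinate at
a time, each step is an increment in one direction, and exchanging coordinates turns the law of
the intermediate pair back into the product law. -/
theorem tsum_sq_sub_le_sum (w : Fin d → ℤ → ℝ≥0∞) (g : IntLattice d → ℝ) :
    ∑' p : IntLattice d × IntLattice d, (∏ i, w i (p.1 i)) * (∏ i, w i (p.2 i)) *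
        ENNReal.ofReal ((g p.1 - g p.2) ^ 2) ≤
      d * ∑ k : Fin d, ∑' p : IntLattice d × IntLattice d,
        (∏ i, w i (p.1 i)) * (∏ i, w i (p.2 i)) *
          ENNReal.ofReal ((g p.1 - g (Function.update p.1 k (p.2 k))) ^ 2) := by
  have h1 : ∀ p : IntLattice d × IntLattice d, ENNReal.ofReal ((g p.1 - g p.2) ^ 2) ≤
      d * ∑ k : Fin d,
        ENNReal.ofReal ((g (hybrid k p.1 p.2) - g (hybrid (k + 1) p.1 p.2)) ^ 2) := by
    intro p
    refine (ENNReal.ofReal_le_ofReal (sq_sub_le_sum_hybrid g p.1 p.2)).trans (le_of_eq ?_)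
    rw [ENNReal.ofReal_mul (Nat.cast_nonneg _), ENNReal.ofReal_natCast,
      ENNReal.ofReal_sum_of_nonneg fun i _ => sq_nonneg _]
  have h2 : ∀ k : Fin d, ∑' p : IntLattice d × IntLattice d,
      (∏ i, w i (p.1 i)) * (∏ i, w i (p.2 i)) *
          ENNReal.ofReal ((g p.1 - g (Function.update p.1 k (p.2 k))) ^ 2) =
      ∑' p : IntLattice d × IntLattice d, (∏ i, w i (p.1 i)) * (∏ i, w i (p.2 i)) *
        ENNReal.ofReal ((g (hybrid k p.1 p.2) - g (hybrid (k + 1) p.1 p.2)) ^ 2) := by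
    intro k
    rw [← (hybridSwap (d := d) k).tsum_eq]
    refine tsum_congr fun p => ?_
    simp only [hybridSwap, Equiv.coe_fn_mk]
    rw [prod_hybrid_mul, hybrid_succ]
  simp only [h2]
  rw [← Summable.tsum_finsetSum fun _ _ => ENNReal.summable, ← ENNReal.tsum_mul_left]
  refine ENNReal.tsum_le_tsum fun p => ?_
  refine (mul_le_mul_right (h1 p) _).trans (le_of_eq ?_)
  rw [← Finset.mul_sum]
  ring

theorem tsum_split_coordinate (k : Fin d) (F : IntLattice d → ℝ≥0∞) :
    ∑' y, F y = ∑' u : {j // j ≠ k} → ℤ, ∑' a : ℤ, F ((Equiv.funSplitAt k ℤ).symm (a, u)) := by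
  rw [ENNReal.tsum_comm, ← ENNReal.tsum_prod, ← (Equiv.funSplitAt k ℤ).symm.tsum_eq]

/-- A Poincaré inequality on `ℤ` for the `k`-th factor of a product weight controls the increments
in the `k`-th direction. -/
theorem tsum_update_le (w : Fin d → ℤ → ℝ≥0∞) (g : IntLattice d → ℝ) (k : Fin d) {K : ℝ≥0∞}
    (hK : ∀ φ : ℤ → ℝ, ∑' a : ℤ, ∑' b : ℤ, w k a * (w k b * ENNReal.ofReal ((φ a - φ b) ^ 2)) ≤
      K * (∑' a, w k a) * ∑' a, w k a * ENNReal.ofReal ((φ (a + 1) - φ a) ^ 2)) :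
    ∑' p : IntLattice d × IntLattice d, (∏ i, w i (p.1 i)) * (∏ i, w i (p.2 i)) *
        ENNReal.ofReal ((g p.1 - g (Function.update p.1 k (p.2 k))) ^ 2) ≤
      K * (∑' y : IntLattice d, ∏ i, w i (y i)) *
        ∑' y : IntLattice d, (∏ i, w i (y i)) *
          ENNReal.ofReal ((g (y + Pi.single k 1) - g y) ^ 2) := by
  set E := (Equiv.funSplitAt k ℤ).symm with hE
  set ρ' : ({j // j ≠ k} → ℤ) → ℝ≥0∞ := fun u => ∏ i : {j // j ≠ k}, w i (u i) with hρ'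
  have hEk : ∀ a u, E (a, u) k = a := fun a u => by simp [hE]
  have hEj : ∀ a u (j : {j // j ≠ k}), E (a, u) j = u j := fun a u j => by
    simp [hE, j.2]
  have hprod : ∀ a u, ∏ i, w i (E (a, u) i) = w k a * ρ' u := fun a u => by
    rw [Fintype.prod_eq_mul_prod_subtype_ne _ k, hEk]
    simp only [hEj, hρ']
  have hupd : ∀ a u b, Function.update (E (a, u)) k b = E (b, u) := fun a u b => by
    funext j
    by_cases hj : j = k
    · subst hj; simp [hEk]
    · rw [Function.update_of_ne hj]
      exact (hEj a u ⟨j, hj⟩).trans (hEj b u ⟨j, hj⟩).symm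
  have hadd : ∀ a u, E (a, u) + Pi.single k 1 = E (a + 1, u) := fun a u => by
    funext j
    by_cases hj : j = k
    · subst hj; simp [hEk]
    · rw [Pi.add_apply, Pi.single_eq_of_ne hj, add_zero]
      exact (hEj a u ⟨j, hj⟩).trans (hEj (a + 1) u ⟨j, hj⟩).symm
  have hZ : ∑' y : IntLattice d, ∏ i, w i (y i) = (∑' a, w k a) * ∑' u, ρ' u := by
    rw [tsum_split_coordinate k]
    change ∑' u, ∑' a, ∏ i, w i (E (a, u) i) = _
    simp only [hprod, ENNReal.tsum_mul_left, ENNReal.tsum_mul_right]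
  have hR : ∑' y : IntLattice d, (∏ i, w i (y i)) *
      ENNReal.ofReal ((g (y + Pi.single k 1) - g y) ^ 2) =
      ∑' u, ρ' u * ∑' a, w k a * ENNReal.ofReal ((g (E (a + 1, u)) - g (E (a, u))) ^ 2) := by
    rw [tsum_split_coordinate k]
    refine tsum_congr fun u => ?_
    rw [← ENNReal.tsum_mul_left]
    refine tsum_congr fun a => ?_
    change (∏ i, w i (E (a, u) i)) *
      ENNReal.ofReal ((g (E (a, u) + Pi.single k 1) - g (E (a, u))) ^ 2) = _
    rw [hprod, hadd]
    ring
  have hL : ∑' p : IntLattice d × IntLattice d, (∏ i, w i (p.1 i)) * (∏ i, w i (p.2 i)) *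
        ENNReal.ofReal ((g p.1 - g (Function.update p.1 k (p.2 k))) ^ 2) =
      (∑' v, ρ' v) * ∑' u, ρ' u * ∑' a : ℤ, ∑' b : ℤ,
        w k a * (w k b * ENNReal.ofReal ((g (E (a, u)) - g (E (b, u))) ^ 2)) := by
    rw [ENNReal.tsum_prod', tsum_split_coordinate k, ← ENNReal.tsum_mul_left]
    refine tsum_congr fun u => ?_
    rw [← ENNReal.tsum_mul_left, ← ENNReal.tsum_mul_left]
    refine tsum_congr fun a => ?_
    rw [tsum_split_coordinate k]
    change ∑' v, ∑' b, (∏ i, w i (E (a, u) i)) * (∏ i, w i (E (b, v) i)) *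
      ENNReal.ofReal ((g (E (a, u)) - g (Function.update (E (a, u)) k (E (b, v) k))) ^ 2) = _
    simp only [hprod, hupd, hEk]
    rw [← ENNReal.tsum_mul_right]
    refine tsum_congr fun v => ?_
    rw [← ENNReal.tsum_mul_left, ← ENNReal.tsum_mul_left]
    refine tsum_congr fun b => ?_
    ring
  rw [hL, hR, hZ]
  calc (∑' v, ρ' v) * ∑' u, ρ' u * ∑' a : ℤ, ∑' b : ℤ,
        w k a * (w k b * ENNReal.ofReal ((g (E (a, u)) - g (E (b, u))) ^ 2))
      ≤ (∑' v, ρ' v) * ∑' u, ρ' u * (K * (∑' a, w k a) *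
          ∑' a, w k a * ENNReal.ofReal ((g (E (a + 1, u)) - g (E (a, u))) ^ 2)) :=
        mul_le_mul_right (ENNReal.tsum_le_tsum fun u =>
          mul_le_mul_right (hK fun a => g (E (a, u))) _) _
    _ = _ := by
        have e : ∀ u, ρ' u * (K * (∑' a, w k a) *
            ∑' a, w k a * ENNReal.ofReal ((g (E (a + 1, u)) - g (E (a, u))) ^ 2)) =
            K * (∑' a, w k a) * (ρ' u *
              ∑' a, w k a * ENNReal.ofReal ((g (E (a + 1, u)) - g (E (a, u))) ^ 2)) :=
          fun u => by ring
        simp only [e, ENNReal.tsum_mul_left]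
        ring

theorem tsum_prod_eq_prod_tsum : ∀ {d : ℕ} (w : Fin d → ℤ → ℝ≥0∞),
    ∑' y : IntLattice d, ∏ i, w i (y i) = ∏ i, ∑' a, w i a := by
  intro d
  induction d with
  | zero => intro w; simp
  | succ d ih =>
    intro w
    rw [← (Fin.consEquiv fun _ => ℤ).tsum_eq, ENNReal.tsum_prod', Fin.prod_univ_succ,
      ← ih fun i => w i.succ, ← ENNReal.tsum_mul_right]
    refine tsum_congr fun a => ?_
    rw [← ENNReal.tsum_mul_left]
    refine tsum_congr fun u => ?_
    simp [Fin.consEquiv, Fin.prod_univ_succ]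

end Tensorization

/-- The weight `e^{-|y - x|₁ / R}` on the lattice, which is a product weight. -/
noncomputable def latticeWeight {d : ℕ} (R : ℝ) (x y : IntLattice d) : ℝ :=
  Real.exp (-gridDist x y / R)

section LatticeWeight

variable {d : ℕ}

theorem latticeWeight_pos (R : ℝ) (x y : IntLattice d) : 0 < latticeWeight R x y := Real.exp_pos _

theorem latticeWeight_le_one {R : ℝ} (hR : 0 < R) (x y : IntLattice d) :
    latticeWeight R x y ≤ 1 := by
  rw [latticeWeight, Real.exp_le_one_iff, neg_div, neg_nonpos]
  exact div_nonneg (gridDist_nonneg _ _) hR.le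

theorem latticeWeight_eq_prod (R : ℝ) (x y : IntLattice d) :
    latticeWeight R x y = ∏ i, expWeight R (x i) (y i) := by
  simp only [latticeWeight, expWeight]
  rw [← Real.exp_sum, gridDist, ← Finset.sum_neg_distrib, Finset.sum_div]

theorem ofReal_latticeWeight (R : ℝ) (x y : IntLattice d) :
    ENNReal.ofReal (latticeWeight R x y) = ∏ i, ENNReal.ofReal (expWeight R (x i) (y i)) := by
  rw [latticeWeight_eq_prod, ENNReal.ofReal_prod_of_nonneg fun i _ => (expWeight_pos _ _ _).le]

theorem latticeWeight_le_mul (R : ℝ) (hR : 0 < R) (x y z : IntLattice d) :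
    latticeWeight R x y ≤ Real.exp (gridDist y z / R) * latticeWeight R x z := by
  rw [latticeWeight, latticeWeight, ← Real.exp_add, Real.exp_le_exp, ← add_div]
  refine div_le_div_of_nonneg_right ?_ hR.le
  linarith [gridDist_triangle x y z]

theorem tsum_ofReal_latticeWeight_le {R : ℝ} (hR : 1 ≤ R) (x : IntLattice d) :
    ∑' y, ENNReal.ofReal (latticeWeight R x y) ≤ ENNReal.ofReal ((4 * R) ^ d) := by
  simp only [ofReal_latticeWeight]
  rw [tsum_prod_eq_prod_tsum fun i a => ENNReal.ofReal (expWeight R (x i) a)]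
  refine (Finset.prod_le_prod' fun i _ => tsum_expWeight_le hR (x i)).trans (le_of_eq ?_)
  rw [Finset.prod_const, Finset.card_univ, Fintype.card_fin, ENNReal.ofReal_pow (by positivity)]

theorem summable_latticeWeight {R : ℝ} (hR : 1 ≤ R) (x : IntLattice d) :
    Summable (latticeWeight R x) := by
  have h := tsum_ofReal_latticeWeight_le hR x
  have h2 := ENNReal.summable_toReal (ne_top_of_le_ne_top ENNReal.ofReal_ne_top h)
  exact h2.congr fun y => ENNReal.toReal_ofReal (latticeWeight_pos R x y).le

theorem tsum_latticeWeight_le {R : ℝ} (hR : 1 ≤ R) (x : IntLattice d) :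
    ∑' y, latticeWeight R x y ≤ (4 * R) ^ d := by
  have h := tsum_ofReal_latticeWeight_le hR x
  rw [tsum_ofReal_eq (fun y => (latticeWeight_pos R x y).le) (summable_latticeWeight hR x)] at h
  exact (ENNReal.ofReal_le_ofReal_iff (by positivity)).mp h

theorem gridDist_le_of_mem_latticeBox {x y : IntLattice d} {m : ℕ} (h : y ∈ latticeBox x m) :
    gridDist x y ≤ d * m := by
  rw [mem_latticeBox] at h
  have h1 : ∀ i ∈ (Finset.univ : Finset (Fin d)), |(x i : ℝ) - y i| ≤ m := fun i _ => by
    exact_mod_cast h i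
  refine (Finset.sum_le_sum h1).trans (le_of_eq ?_)
  simp

theorem le_latticeWeight_of_mem {R : ℝ} (hR : 1 ≤ R) {x y : IntLattice d}
    (h : y ∈ latticeBox x ⌊R⌋₊) : Real.exp (-d) ≤ latticeWeight R x y := by
  rw [latticeWeight, Real.exp_le_exp, neg_div, neg_le_neg_iff, div_le_iff₀ (by linarith)]
  refine (gridDist_le_of_mem_latticeBox h).trans ?_
  exact mul_le_mul_of_nonneg_left (Nat.floor_le (by linarith)) (Nat.cast_nonneg _)

theorem le_tsum_latticeWeight {R : ℝ} (hR : 1 ≤ R) (x : IntLattice d) :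
    Real.exp (-d) * R ^ d ≤ ∑' y, latticeWeight R x y := by
  refine le_trans ?_ ((summable_latticeWeight hR x).sum_le_tsum (latticeBox x ⌊R⌋₊)
    fun y _ => (latticeWeight_pos R x y).le)
  refine le_trans ?_ (Finset.card_nsmul_le_sum _ _ _ fun y hy => le_latticeWeight_of_mem hR hy)
  rw [nsmul_eq_mul, card_latticeBox, mul_comm]
  refine mul_le_mul_of_nonneg_right ?_ (Real.exp_pos _).le
  push_cast
  refine pow_le_pow_left₀ (by linarith) ?_ d
  linarith [(Nat.lt_floor_add_one R).le, (Nat.cast_nonneg ⌊R⌋₊ : (0 : ℝ) ≤ _)]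

namespace Conductance

/-- The Poincaré constant of the lattice weights. -/
noncomputable def poincareConst (d m : ℕ) (δ : ℝ) : ℝ :=
  d * 128 * (d * ((((2 * m + 1) ^ d : ℕ) : ℝ) ^ 3 * Real.exp (d * m) / δ))

/-- The weighted Poincaré inequality at scale `R`. -/
theorem HasChains.tsum_poincare {C : Conductance d} {m : ℕ} {δ : ℝ} (h : C.HasChains m δ)
    (hδ : 0 < δ) {R : ℝ} (hR : 1 ≤ R) (x : IntLattice d) (g : IntLattice d → ℝ) :
    ∑' p : IntLattice d × IntLattice d, ENNReal.ofReal
        (latticeWeight R x p.1 * latticeWeight R x p.2 * (g p.1 - g p.2) ^ 2) ≤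
      ENNReal.ofReal (poincareConst d m δ * R ^ 2 * ∑' y, latticeWeight R x y) *
        C.energy (latticeWeight R x) g := by
  have hR0 : 0 < R := by linarith
  set w : Fin d → ℤ → ℝ≥0∞ := fun i a => ENNReal.ofReal (expWeight R (x i) a) with hw
  set κ : ℝ := (((2 * m + 1) ^ d : ℕ) : ℝ) ^ 3 * Real.exp (d * m) / δ with hκ
  have hκ0 : 0 ≤ κ := by positivity
  have hρ : ∀ y, ENNReal.ofReal (latticeWeight R x y) = ∏ i, w i (y i) := ofReal_latticeWeight R x
  have hZ0 : 0 ≤ ∑' y, latticeWeight R x y := tsum_nonneg fun y => (latticeWeight_pos R x y).le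
  have hZ : ∑' y : IntLattice d, ∏ i, w i (y i) =
      ENNReal.ofReal (∑' y, latticeWeight R x y) := by
    rw [← tsum_ofReal_eq (fun y => (latticeWeight_pos R x y).le) (summable_latticeWeight hR x)]
    exact tsum_congr fun y => (hρ y).symm
  have e1 : ∀ p : IntLattice d × IntLattice d, ENNReal.ofReal
        (latticeWeight R x p.1 * latticeWeight R x p.2 * (g p.1 - g p.2) ^ 2) =
      (∏ i, w i (p.1 i)) * (∏ i, w i (p.2 i)) * ENNReal.ofReal ((g p.1 - g p.2) ^ 2) := fun p => by
    rw [ENNReal.ofReal_mul (mul_nonneg (latticeWeight_pos _ _ _).le (latticeWeight_pos _ _ _).le),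
      ENNReal.ofReal_mul (latticeWeight_pos _ _ _).le, hρ, hρ]
  have e2 : ∀ k : Fin d, ∑' y : IntLattice d, (∏ i, w i (y i)) *
      ENNReal.ofReal ((g (y + Pi.single k 1) - g y) ^ 2) ≤
      ENNReal.ofReal κ * C.energy (latticeWeight R x) g := by
    intro k
    refine le_trans (le_of_eq (tsum_congr fun y => ?_)) (h.tsum_le_energy hδ
      (fun y => (latticeWeight_pos R x y).le) (Real.exp_pos _).le (fun y z hz => ?_) g k)
    · rw [← hρ, ← ENNReal.ofReal_mul (latticeWeight_pos _ _ _).le]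
    · refine (latticeWeight_le_mul R hR0 x y z).trans ?_
      refine mul_le_mul_of_nonneg_right (Real.exp_le_exp.mpr ?_) (latticeWeight_pos _ _ _).le
      refine (div_le_self (gridDist_nonneg _ _) hR).trans (gridDist_le_of_mem_latticeBox hz)
  rw [tsum_congr e1]
  refine (tsum_sq_sub_le_sum w g).trans ?_
  have e3 : ∀ k ∈ (Finset.univ : Finset (Fin d)), ∑' p : IntLattice d × IntLattice d,
        (∏ i, w i (p.1 i)) * (∏ i, w i (p.2 i)) *
          ENNReal.ofReal ((g p.1 - g (Function.update p.1 k (p.2 k))) ^ 2) ≤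
      ENNReal.ofReal (128 * R ^ 2) * ENNReal.ofReal (∑' y, latticeWeight R x y) *
        (ENNReal.ofReal κ * C.energy (latticeWeight R x) g) := by
    intro k _
    refine (tsum_update_le w g k (K := ENNReal.ofReal (128 * R ^ 2)) fun φ =>
      tsum_poincare_int hR (x k) φ).trans ?_
    rw [hZ]
    exact mul_le_mul_right (e2 k) _
  refine (mul_le_mul_right (Finset.sum_le_sum e3) _).trans (le_of_eq ?_)
  have hd0 : (0 : ℝ) ≤ d := Nat.cast_nonneg d
  rw [Finset.sum_const, Finset.card_univ, Fintype.card_fin, nsmul_eq_mul, poincareConst, ← hκ]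
  have e4 : (d : ℝ) * 128 * (d * κ) * R ^ 2 * ∑' y, latticeWeight R x y =
      d * (d * ((128 * R ^ 2) * (∑' y, latticeWeight R x y) * κ)) := by ring
  rw [e4, ENNReal.ofReal_mul hd0, ENNReal.ofReal_mul hd0,
    ENNReal.ofReal_mul (by positivity : 0 ≤ 128 * R ^ 2 * ∑' y, latticeWeight R x y),
    ENNReal.ofReal_mul (by positivity : 0 ≤ 128 * R ^ 2), ENNReal.ofReal_natCast]
  ring

end Conductance

end LatticeWeight

/-! ### Logarithms of positive solutions: pointwise and scalar inequalities -/

/-- The nonlocal form of the bound `-∇(ρ/v) ∇v ≥ ρ |∇ log v|² / 2 - |∇ρ|² / ρ`. For a long jump,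
where `κ` is large, the error is of the order of the weights themselves. -/
theorem log_energy_le {a b α β κ : ℝ} (ha : 0 < a) (hb : 0 < b) (hα : 0 < α) (hβ : 0 < β)
    (hκ : 0 ≤ κ) (h1 : α ≤ Real.exp κ * β) (h2 : β ≤ Real.exp κ * α) :
    1 / 2 * (min α β * (Real.log a - Real.log b) ^ 2) - 2 * (min 1 (κ ^ 2) * (α + β)) ≤
      -((α / a - β / b) * (a - b)) := by
  wlog hab : β ≤ α generalizing a b α β
  · have h := this hb ha hβ hα h2 h1 (le_of_not_ge hab)
    rw [min_comm, add_comm α β]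
    have e1 : (Real.log a - Real.log b) ^ 2 = (Real.log b - Real.log a) ^ 2 := by ring
    have e2 : (α / a - β / b) * (a - b) = (β / b - α / a) * (b - a) := by ring
    rw [e1, e2]
    exact h
  rw [min_eq_right hab]
  set X := Real.log b - Real.log a with hX
  have hbX : b / a = Real.exp X := by
    rw [hX, Real.exp_sub, Real.exp_log hb, Real.exp_log ha]
  have haX : a / b = Real.exp (-X) := by
    rw [hX, neg_sub, Real.exp_sub, Real.exp_log hb, Real.exp_log ha]
  have e : -((α / a - β / b) * (a - b)) =
      β * (Real.exp X + Real.exp (-X) - 2) + (α - β) * (Real.exp X - 1) := by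
    rw [← hbX, ← haX]
    field_simp
    ring
  have e1 : (Real.log a - Real.log b) ^ 2 = X ^ 2 := by rw [hX]; ring
  have hcosh : X ^ 2 ≤ Real.exp X + Real.exp (-X) - 2 := by
    have h3 : Real.exp X + Real.exp (-X) - 2 = (2 * Real.sinh (X / 2)) ^ 2 := by
      rw [Real.sinh_eq, mul_div_cancel₀ _ two_ne_zero, sub_sq, mul_assoc, ← Real.exp_add,
        add_neg_cancel, Real.exp_zero, ← Real.exp_nat_mul, ← Real.exp_nat_mul]
      push_cast
      ring_nf
    have h4 : |X / 2| ≤ |Real.sinh (X / 2)| := by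
      rw [Real.abs_sinh]
      exact Real.self_le_sinh_iff.mpr (abs_nonneg _)
    rw [h3, mul_pow, ← sq_abs (Real.sinh _)]
    have h5 := pow_le_pow_left₀ (abs_nonneg _) h4 2
    rw [sq_abs, div_pow] at h5
    linarith
  have h4 := mul_le_mul_of_nonneg_left hcosh hβ.le
  rw [e, e1]
  rcases le_or_gt 1 κ with hk | hk
  · have hmin : min 1 (κ ^ 2) = 1 := min_eq_left (by nlinarith)
    have h5 : (α - β) * (0 - 1) ≤ (α - β) * (Real.exp X - 1) :=
      mul_le_mul_of_nonneg_left (by linarith [Real.exp_pos X]) (by linarith)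
    rw [hmin]
    nlinarith [mul_nonneg hβ.le (sq_nonneg X)]
  · have hmin : min 1 (κ ^ 2) = κ ^ 2 := min_eq_right (by nlinarith)
    have h5 : (α - β) * X ≤ (α - β) * (Real.exp X - 1) :=
      mul_le_mul_of_nonneg_left (by linarith [Real.add_one_le_exp X]) (by linarith)
    have h6 : Real.exp κ ≤ 1 + 2 * κ := by
      have h7 := Real.abs_exp_sub_one_sub_id_le (x := κ) (by rw [abs_of_nonneg hκ]; exact hk.le)
      have h8 := (abs_le.mp h7).2
      nlinarith
    have h9 : α - β ≤ 2 * κ * β := by nlinarith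
    have h10 : (α - β) ^ 2 ≤ (2 * κ * β) ^ 2 := pow_le_pow_left₀ (by linarith) h9 2
    have h11 : -(1 / 2 * (β * X ^ 2)) - 2 * κ ^ 2 * β ≤ (α - β) * X := by
      have h12 : 0 ≤ (β * X + (α - β)) ^ 2 := sq_nonneg _
      have h13 : β * (-(1 / 2 * (β * X ^ 2)) - 2 * κ ^ 2 * β) ≤ β * ((α - β) * X) := by
        nlinarith
      exact le_of_mul_le_mul_left h13 hβ
    rw [hmin]
    have h14 : 0 ≤ κ ^ 2 * α := by positivity
    linarith

/-- The variance of a bounded function with respect to a summable weight, as a double sum. -/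
theorem tsum_pair_sq_sub {α : Type*} {ρ g : α → ℝ} {b : ℝ} (h0 : ∀ x, 0 ≤ ρ x) (hρ : Summable ρ)
    (hg : ∀ x, |g x| ≤ b) :
    (Summable fun p : α × α => ρ p.1 * ρ p.2 * (g p.1 - g p.2) ^ 2) ∧
    ∑' p : α × α, ρ p.1 * ρ p.2 * (g p.1 - g p.2) ^ 2 =
      2 * ((∑' x, ρ x) * ∑' x, ρ x * g x ^ 2 - (∑' x, ρ x * g x) ^ 2) := by
  have hb : ∀ {h : α → ℝ} {c : ℝ}, (∀ x, |h x| ≤ c) → Summable fun x => ‖ρ x * h x‖ := by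
    intro h c hc
    refine Summable.of_nonneg_of_le (fun x => norm_nonneg _) (fun x => ?_) (hρ.mul_right c)
    rw [Real.norm_eq_abs, abs_mul, abs_of_nonneg (h0 x)]
    exact mul_le_mul_of_nonneg_left (hc x) (h0 x)
  have s0 : Summable fun x => ‖ρ x‖ := hρ.norm
  have s1 := hb hg
  have s2 : Summable fun x => ‖ρ x * g x ^ 2‖ := hb (c := b ^ 2) fun x => by
    rw [abs_pow]; exact pow_le_pow_left₀ (abs_nonneg _) (hg x) 2
  have p20 := summable_mul_of_summable_norm s2 s0
  have p02 := summable_mul_of_summable_norm s0 s2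
  have p11 := summable_mul_of_summable_norm s1 s1
  have e : ∀ p : α × α, ρ p.1 * ρ p.2 * (g p.1 - g p.2) ^ 2 =
      (ρ p.1 * g p.1 ^ 2 * ρ p.2 + ρ p.1 * (ρ p.2 * g p.2 ^ 2)) -
        2 * (ρ p.1 * g p.1 * (ρ p.2 * g p.2)) := fun p => by ring
  refine ⟨((p20.add p02).sub (p11.mul_left 2)).congr fun p => (e p).symm, ?_⟩
  rw [tsum_congr e, (p20.add p02).tsum_sub (p11.mul_left 2), p20.tsum_add p02, tsum_mul_left,
    ← tsum_mul_tsum_of_summable_norm s2 s0, ← tsum_mul_tsum_of_summable_norm s0 s2,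
    ← tsum_mul_tsum_of_summable_norm s1 s1]
  ring

/-- A Riccati inequality on an initial time interval bounds the solution from below, whatever its
initial value. Here `s` is the time scale. -/
theorem le_of_riccati {a B τ k : ℝ} (ha : 0 < a) (hB : 0 ≤ B) (hτ : 0 < τ) :
    ∀ (Γ Γ' : ℝ → ℝ) (s t₀ t₁ t₂ : ℝ), 0 < s → 0 < t₀ → t₁ - t₀ = τ * s → t₁ ≤ t₂ → t₂ - t₀ ≤ s →
      (∀ t, 0 < t → HasDerivAt Γ (Γ' t) t) → (∀ t, 0 < t → -B / s ≤ Γ' t) →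
      (∀ t ∈ Set.Icc t₀ t₁, Γ t ≤ k → a / s * (k - Γ t) ^ 2 - B / s ≤ Γ' t) →
      k - (B + 1 + 2 * B / a + 2 / (a * τ)) - B ≤ Γ t₂ := by
  intro Γ Γ' s t₀ t₁ t₂ hs ht₀ h10 h12 h20 hder hlow hric
  have hτs : 0 < τ * s := mul_pos hτ hs
  have ht₁ : 0 < t₁ := by linarith
  have hmono : MonotoneOn (fun t => Γ t + B / s * t) (Set.Ioi 0) := by
    refine monotoneOn_of_hasDerivAt (convex_Ioi 0)
      (fun t ht => (hder t ht).add ((hasDerivAt_id t).const_mul (B / s))) ?_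
    intro t ht
    have := hlow t ht
    rw [neg_div] at this
    linarith
  have hdec : ∀ t t', 0 < t → t ≤ t' → t' - t ≤ s → Γ t ≤ Γ t' + B := by
    intro t t' ht htt' hts
    have h1 := hmono ht (Set.mem_Ioi.mpr (by linarith)) htt'
    simp only at h1
    have h2 : B / s * (t' - t) ≤ B := by
      rw [div_mul_eq_mul_div, div_le_iff₀ hs]
      exact mul_le_mul_of_nonneg_left hts hB
    linarith
  have hfin := hdec t₁ t₂ ht₁ h12 (by linarith)
  suffices h : k - Γ t₁ ≤ B + 1 + 2 * B / a + 2 / (a * τ) by linarith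
  by_contra! hcon
  -- Otherwise `k - Γ` is large on all of `[t₀, t₁]`, where `1 / (k - Γ)` then grows at rate
  -- `a / (2 s)`; at time `t₁` this makes `k - Γ` at most `2 / (a τ)`.
  have hba : 0 ≤ 2 * B / a := by positivity
  have hat : 0 < 2 / (a * τ) := by positivity
  have hY : ∀ t ∈ Set.Icc t₀ t₁, 1 + 2 * B / a ≤ k - Γ t := by
    intro t ht
    have := hdec t t₁ (by linarith [ht.1]) ht.2 (by linarith [ht.1])
    linarith
  have hinv : MonotoneOn (fun t => (k - Γ t)⁻¹ - a / (2 * s) * t) (Set.Icc t₀ t₁) := by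
    refine monotoneOn_of_hasDerivAt (convex_Icc t₀ t₁) (fun t ht =>
      (((hder t (by linarith [ht.1])).const_sub k).inv (by linarith [hY t ht])).sub
        ((hasDerivAt_id t).const_mul (a / (2 * s)))) ?_
    intro t ht
    have hy := hY t ht
    set y := k - Γ t with hydef
    have hy0 : 0 < y := by linarith
    have h1 := hric t ht (by linarith)
    have h2 : B / s ≤ a / (2 * s) * y ^ 2 := by
      have h3 : 2 * B / a ≤ y ^ 2 := by nlinarith
      rw [div_le_iff₀ ha] at h3
      have h4 : B ≤ a / 2 * y ^ 2 := by linarith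
      calc B / s ≤ a / 2 * y ^ 2 / s := div_le_div_of_nonneg_right h4 hs.le
        _ = _ := by field_simp
    have h5 : a / (2 * s) * y ^ 2 ≤ Γ' t := by
      have e : a / s * y ^ 2 = a / (2 * s) * y ^ 2 + a / (2 * s) * y ^ 2 := by
        field_simp; ring
      linarith
    rw [neg_neg, mul_one, sub_nonneg, le_div_iff₀ (by positivity)]
    exact h5
  have h1 := hinv (Set.left_mem_Icc.mpr (by linarith)) (Set.right_mem_Icc.mpr (by linarith))
    (by linarith)
  simp only at h1
  have h2 : 0 < (k - Γ t₀)⁻¹ :=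
    inv_pos.mpr (by linarith [hY t₀ (Set.left_mem_Icc.mpr (by linarith))])
  have h3 : a / (2 * s) * (t₁ - t₀) = a * τ / 2 := by
    rw [h10]; field_simp
  have h4 : a * τ / 2 ≤ (k - Γ t₁)⁻¹ := by linarith
  have h5 : 2 / (a * τ) < k - Γ t₁ := by linarith
  have h6 : (k - Γ t₁)⁻¹ < (2 / (a * τ))⁻¹ := inv_strictAnti₀ hat h5
  rw [inv_div] at h6
  linarith

namespace Conductance

variable {d : ℕ}

/-- The rescaled and regularized density `R^d f_t + δ`. -/
noncomputable def regDensity (C : Conductance d) (R δ : ℝ) (x : IntLattice d) (t : ℝ)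
    (y : IntLattice d) : ℝ := R ^ d * C.flow x t y + δ

/-- The average of the logarithm of the rescaled density of the chain started at `x`, for the
exponential weight of width `R` centred at `x₀`. -/
noncomputable def logMean (C : Conductance d) (R δ : ℝ) (x₀ x : IntLattice d) (t : ℝ) : ℝ :=
  (∑' y, latticeWeight R x₀ y * Real.log (C.regDensity R δ x t y)) / ∑' y, latticeWeight R x₀ y

theorem le_regDensity (C : Conductance d) {R δ : ℝ} (hR : 1 ≤ R) (x : IntLattice d) {t : ℝ}
    (ht : 0 ≤ t) (y : IntLattice d) : δ ≤ C.regDensity R δ x t y := by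
  have := mul_nonneg (by positivity : 0 ≤ R ^ d) (C.flow_nonneg x y ht)
  rw [regDensity]
  linarith

theorem abs_log_regDensity_le (C : Conductance d) {R δ : ℝ} (hR : 1 ≤ R) (hδ : 0 < δ)
    (x : IntLattice d) {t : ℝ} (ht : 0 ≤ t) (y : IntLattice d) :
    |Real.log (C.regDensity R δ x t y)| ≤ |Real.log δ| + |Real.log (R ^ d + δ)| := by
  have h1 := C.le_regDensity (δ := δ) hR x ht y
  have h2 : C.regDensity R δ x t y ≤ R ^ d + δ := by
    have := mul_le_of_le_one_right (by positivity : 0 ≤ R ^ d) (C.flow_le_one x y ht)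
    rw [regDensity]
    linarith
  have h3 := Real.log_le_log hδ h1
  have h4 := Real.log_le_log (by linarith) h2
  rw [abs_le]
  constructor
  · linarith [neg_abs_le (Real.log δ), abs_nonneg (Real.log (R ^ d + δ))]
  · linarith [le_abs_self (Real.log (R ^ d + δ)), abs_nonneg (Real.log δ)]

theorem summable_weight_mul_log (C : Conductance d) {R δ : ℝ} (hR : 1 ≤ R) (hδ : 0 < δ)
    (x₀ x : IntLattice d) {t : ℝ} (ht : 0 ≤ t) :
    Summable fun y => latticeWeight R x₀ y * Real.log (C.regDensity R δ x t y) := by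
  refine Summable.of_norm_bounded ((summable_latticeWeight hR x₀).mul_right
    (|Real.log δ| + |Real.log (R ^ d + δ)|)) fun y => ?_
  rw [Real.norm_eq_abs, abs_mul, abs_of_pos (latticeWeight_pos _ _ _)]
  exact mul_le_mul_of_nonneg_left (C.abs_log_regDensity_le hR hδ x ht y)
    (latticeWeight_pos _ _ _).le

end Conductance

/-! ### Growth of the logarithmic mean -/

namespace Conductance

variable {d : ℕ}

theorem tsum_latticeWeight_pos {R : ℝ} (hR : 1 ≤ R) (x : IntLattice d) :
    0 < ∑' y, latticeWeight R x y :=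
  lt_of_lt_of_le (by positivity) (le_tsum_latticeWeight hR x)

theorem regDensity_pos (C : Conductance d) {R δ : ℝ} (hR : 1 ≤ R) (hδ : 0 < δ) (x : IntLattice d)
    {t : ℝ} (ht : 0 ≤ t) (y : IntLattice d) : 0 < C.regDensity R δ x t y :=
  lt_of_lt_of_le hδ (C.le_regDensity hR x ht y)

theorem abs_weight_div_le (C : Conductance d) {R δ : ℝ} (hR : 1 ≤ R) (hδ : 0 < δ)
    (x₀ x : IntLattice d) {t : ℝ} (ht : 0 ≤ t) (y : IntLattice d) :
    |latticeWeight R x₀ y / C.regDensity R δ x t y| ≤ δ⁻¹ := by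
  have hv := C.le_regDensity (δ := δ) hR x ht y
  have hv0 := C.regDensity_pos hR hδ x ht y
  rw [abs_of_pos (div_pos (latticeWeight_pos _ _ _) hv0), ← one_div]
  exact div_le_div₀ zero_le_one (latticeWeight_le_one (by linarith) _ _) hδ hv

theorem abs_laplacian_flow_le_const (C : Conductance d) {c : ℝ} (hc : ∀ x, C.total x ≤ c)
    (x y : IntLattice d) {t : ℝ} (ht : 0 ≤ t) : |C.laplacian (C.flow x t) y| ≤ 2 * c := by
  refine (C.abs_laplacian_flow_le x y ht).trans ?_
  have h1 : ∑' z, C.val y z * C.flow x t z ≤ C.total y :=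
    Summable.tsum_le_tsum (fun z => mul_le_of_le_one_right (C.nonneg _ _) (C.flow_le_one x z ht))
      (C.summable_mul_of_bounded y (L2.abs_apply_le (C.flow x t))) (C.summable y)
  have h2 := mul_le_of_le_one_right (C.total_nonneg y) (C.flow_le_one x y ht)
  linarith [hc y]

theorem dirichlet_weight_div (C : Conductance d) (R δ : ℝ) (x x₀ : IntLattice d) (t : ℝ) :
    C.dirichlet (fun y => latticeWeight R x₀ y / C.regDensity R δ x t y) (C.regDensity R δ x t) =
      R ^ d * C.dirichlet (fun y => latticeWeight R x₀ y / C.regDensity R δ x t y)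
        (C.flow x t) := by
  rw [dirichlet, dirichlet, ← tsum_mul_left]
  refine tsum_congr fun p => ?_
  have : C.regDensity R δ x t p.1 - C.regDensity R δ x t p.2 =
      R ^ d * (C.flow x t p.1 - C.flow x t p.2) := by
    rw [regDensity, regDensity]; ring
  rw [this]
  ring

theorem hasDerivAt_logMean (C : Conductance d) {R δ : ℝ} (hR : 1 ≤ R) (hδ : 0 < δ)
    (x₀ x : IntLattice d) {t : ℝ} (ht : 0 < t) :
    HasDerivAt (C.logMean R δ x₀ x)
      (-(C.dirichlet (fun y => latticeWeight R x₀ y / C.regDensity R δ x t y)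
        (C.regDensity R δ x t)) / 2 / ∑' y, latticeWeight R x₀ y) t := by
  obtain ⟨c, hc⟩ := C.bounded
  have hc0 : 0 ≤ c := (C.total_nonneg 0).trans (hc 0)
  have hder : ∀ y s, s ∈ Set.Ioi (0 : ℝ) →
      HasDerivAt (fun s => latticeWeight R x₀ y * Real.log (C.regDensity R δ x s y))
        (latticeWeight R x₀ y * (R ^ d * C.laplacian (C.flow x s) y / C.regDensity R δ x s y))
        s := by
    intro y s hs
    have h1 : HasDerivAt (fun s => C.regDensity R δ x s y)
        (R ^ d * C.laplacian (C.flow x s) y) s :=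
      ((C.hasDerivAt_flow_apply x y s).const_mul (R ^ d)).add_const δ
    exact (h1.log (C.regDensity_pos hR hδ x (le_of_lt hs) y).ne').const_mul _
  have hbound : ∀ y s, s ∈ Set.Ioi (0 : ℝ) →
      ‖latticeWeight R x₀ y * (R ^ d * C.laplacian (C.flow x s) y / C.regDensity R δ x s y)‖ ≤
        latticeWeight R x₀ y * (R ^ d * (2 * c) / δ) := by
    intro y s hs
    rw [Real.norm_eq_abs, abs_mul, abs_of_pos (latticeWeight_pos _ _ _), abs_div, abs_mul,
      abs_of_nonneg (by positivity : 0 ≤ R ^ d),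
      abs_of_pos (C.regDensity_pos hR hδ x (le_of_lt hs) y)]
    refine mul_le_mul_of_nonneg_left ?_ (latticeWeight_pos _ _ _).le
    exact div_le_div₀ (by positivity) (mul_le_mul_of_nonneg_left
      (C.abs_laplacian_flow_le_const hc x y (le_of_lt hs)) (by positivity)) hδ
      (C.le_regDensity hR x (le_of_lt hs) y)
  have h := hasDerivAt_tsum_of_isPreconnected ((summable_latticeWeight hR x₀).mul_right _)
    isOpen_Ioi isPreconnected_Ioi hder hbound ht (C.summable_weight_mul_log hR hδ x₀ x ht.le) ht
  refine (h.div_const _).congr_deriv ?_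
  congr 1
  have h1 := C.tsum_mul_laplacian (f := C.flow x t)
    (g := fun y => latticeWeight R x₀ y / C.regDensity R δ x t y)
    (fun y => C.abs_weight_div_le hR hδ x₀ x ht.le y) (C.summable_flow x ht.le)
  rw [dirichlet_weight_div]
  have e : ∀ y, latticeWeight R x₀ y *
      (R ^ d * C.laplacian (C.flow x t) y / C.regDensity R δ x t y) =
      R ^ d * (latticeWeight R x₀ y / C.regDensity R δ x t y * C.laplacian (C.flow x t) y) :=
    fun y => by ring
  rw [tsum_congr e, tsum_mul_left, h1]
  ring

/-- The energy of the logarithm is dissipated, up to the error from the variation of the weight. -/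
theorem HasJumpBound.energy_log_le {C : Conductance d} {R M δ : ℝ} (hM : C.HasJumpBound R M)
    (hR : 1 ≤ R) (hδ : 0 < δ) (x₀ x : IntLattice d) {t : ℝ} (ht : 0 ≤ t) :
    ∃ E : ℝ, 0 ≤ E ∧
      C.energy (latticeWeight R x₀) (fun y => Real.log (C.regDensity R δ x t y)) =
        ENNReal.ofReal E ∧
      E / 4 - 2 * (M / R ^ 2) * ∑' y, latticeWeight R x₀ y ≤
        -(C.dirichlet (fun y => latticeWeight R x₀ y / C.regDensity R δ x t y)
          (C.regDensity R δ x t)) / 2 := by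
  have hR0 : 0 < R := by linarith
  set ρ := latticeWeight R x₀ with hρ
  set v := C.regDensity R δ x t with hv
  have hv0 : ∀ y, 0 < v y := fun y => C.regDensity_pos hR hδ x ht y
  have hρ0 : ∀ y, 0 < ρ y := fun y => latticeWeight_pos _ _ _
  obtain ⟨s1, b1⟩ := hM.tsum_pair_le (fun y => (hρ0 y).le) (summable_latticeWeight hR x₀)
  have s2 : Summable fun p : IntLattice d × IntLattice d =>
      C.val p.1 p.2 * ((ρ p.1 / v p.1 - ρ p.2 / v p.2) * (v p.1 - v p.2)) := by
    refine ((C.summable_dirichlet (fun y => C.abs_weight_div_le hR hδ x₀ x ht y)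
      (C.summable_flow x ht)).mul_left (R ^ d)).congr fun p => ?_
    simp only [hv, hρ, regDensity]
    ring
  set F : IntLattice d × IntLattice d → ℝ := fun p =>
    C.val p.1 p.2 * (min (ρ p.1) (ρ p.2) * (Real.log (v p.1) - Real.log (v p.2)) ^ 2) with hF
  have hF0 : ∀ p, 0 ≤ F p := fun p => mul_nonneg (C.nonneg _ _)
    (mul_nonneg (le_min (hρ0 _).le (hρ0 _).le) (sq_nonneg _))
  have hpt : ∀ p : IntLattice d × IntLattice d, F p ≤
      2 * -(C.val p.1 p.2 * ((ρ p.1 / v p.1 - ρ p.2 / v p.2) * (v p.1 - v p.2))) +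
      4 * (C.val p.1 p.2 * (min 1 ((gridDist p.1 p.2 / R) ^ 2) * (ρ p.1 + ρ p.2))) := by
    intro p
    have h := log_energy_le (hv0 p.1) (hv0 p.2) (hρ0 p.1) (hρ0 p.2)
      (div_nonneg (gridDist_nonneg p.1 p.2) hR0.le) (latticeWeight_le_mul R hR0 x₀ p.1 p.2)
      (by rw [gridDist_comm]; exact latticeWeight_le_mul R hR0 x₀ p.2 p.1)
    have h1 := mul_le_mul_of_nonneg_left h (C.nonneg p.1 p.2)
    simp only [hF]
    linarith
  have s3 := (s2.neg.mul_left 2).add (s1.mul_left 4)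
  have sF : Summable F := Summable.of_nonneg_of_le hF0 hpt s3
  refine ⟨∑' p, F p, tsum_nonneg hF0, tsum_ofReal_eq hF0 sF, ?_⟩
  have h2 := Summable.tsum_le_tsum hpt sF s3
  rw [(s2.neg.mul_left 2).tsum_add (s1.mul_left 4), tsum_mul_left, tsum_mul_left, tsum_neg] at h2
  rw [dirichlet]
  linarith

theorem poincareConst_pos (hd : 1 ≤ d) (m : ℕ) {δ : ℝ} (hδ : 0 < δ) : 0 < poincareConst d m δ := by
  have : (0 : ℝ) < d := by exact_mod_cast hd
  rw [poincareConst]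
  positivity

/-- The mean of the logarithm grows at a rate controlled by the weighted variance. -/
theorem HasChains.logMean_growth {C : Conductance d} {m : ℕ} {δ₀ : ℝ} (hC : C.HasChains m δ₀)
    (hd : 1 ≤ d) (hδ₀ : 0 < δ₀) {R M δ : ℝ} (hM : C.HasJumpBound R M)
    (hR : 1 ≤ R) (hδ : 0 < δ) (x₀ x : IntLattice d) {t : ℝ} (ht : 0 ≤ t)
    (A : Finset (IntLattice d)) {k a : ℝ}
    (hA : a * ∑' y, latticeWeight R x₀ y ≤ ∑ y ∈ A, latticeWeight R x₀ y)
    (hk : ∀ y ∈ A, k ≤ Real.log (C.regDensity R δ x t y)) (hΓ : C.logMean R δ x₀ x t ≤ k) :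
    a / (2 * poincareConst d m δ₀) / R ^ 2 * (k - C.logMean R δ x₀ x t) ^ 2 - 2 * M / R ^ 2 ≤
      -(C.dirichlet (fun y => latticeWeight R x₀ y / C.regDensity R δ x t y)
        (C.regDensity R δ x t)) / 2 / ∑' y, latticeWeight R x₀ y := by
  obtain ⟨E, hE0, hE, hle⟩ := hM.energy_log_le hR hδ x₀ x ht
  have hP := poincareConst_pos hd m hδ₀
  set P := poincareConst d m δ₀ with hPdef
  set ρ := latticeWeight R x₀ with hρ
  set g := fun y => Real.log (C.regDensity R δ x t y) with hg
  set Z := ∑' y, ρ y with hZ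
  set Γ := C.logMean R δ x₀ x t with hΓdef
  have hZ0 : 0 < Z := tsum_latticeWeight_pos hR x₀
  have hρ0 : ∀ y, 0 < ρ y := fun y => latticeWeight_pos _ _ _
  have hgb : ∀ y, |g y| ≤ |Real.log δ| + |Real.log (R ^ d + δ)| := fun y =>
    C.abs_log_regDensity_le hR hδ x ht y
  have hG : ∑' y, ρ y * g y = Γ * Z := by
    rw [hΓdef, logMean, div_mul_cancel₀ _ hZ0.ne']
  obtain ⟨s1, b1⟩ := tsum_pair_sq_sub (fun y => (hρ0 y).le) (summable_latticeWeight hR x₀) hgb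
  have hpoin : ∑' p : IntLattice d × IntLattice d, ρ p.1 * ρ p.2 * (g p.1 - g p.2) ^ 2 ≤
      P * R ^ 2 * Z * E := by
    have h := hC.tsum_poincare hδ₀ hR x₀ g
    rw [hE, ← ENNReal.ofReal_mul (by positivity), tsum_ofReal_eq (fun p =>
      mul_nonneg (mul_nonneg (hρ0 _).le (hρ0 _).le) (sq_nonneg _)) s1] at h
    exact (ENNReal.ofReal_le_ofReal_iff (by positivity)).mp h
  have s2 : Summable fun y => ρ y * (g y - Γ) ^ 2 := by
    refine Summable.of_nonneg_of_le (fun y => mul_nonneg (hρ0 y).le (sq_nonneg _)) (fun y => ?_)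
      ((summable_latticeWeight hR x₀).mul_right
        ((|Real.log δ| + |Real.log (R ^ d + δ)| + |Γ|) ^ 2))
    refine mul_le_mul_of_nonneg_left ?_ (hρ0 y).le
    rw [← sq_abs]
    exact pow_le_pow_left₀ (abs_nonneg _)
      ((abs_sub _ _).trans (add_le_add (hgb y) le_rfl)) 2
  have hvar : ∑' y, ρ y * (g y - Γ) ^ 2 = ∑' y, ρ y * g y ^ 2 - Γ ^ 2 * Z := by
    have t1 : Summable fun y => ρ y * g y := C.summable_weight_mul_log hR hδ x₀ x ht
    have t0 : Summable ρ := summable_latticeWeight hR x₀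
    have t2 : Summable fun y => ρ y * g y ^ 2 := by
      refine ((s2.add (t1.mul_left (2 * Γ))).sub (t0.mul_left (Γ ^ 2))).congr fun y => ?_
      ring
    have e : ∀ y, ρ y * (g y - Γ) ^ 2 =
        ρ y * g y ^ 2 - 2 * Γ * (ρ y * g y) + Γ ^ 2 * ρ y := fun y => by ring
    rw [tsum_congr e, (t2.sub (t1.mul_left (2 * Γ))).tsum_add (t0.mul_left (Γ ^ 2)),
      t2.tsum_sub (t1.mul_left (2 * Γ)), tsum_mul_left, tsum_mul_left, hG]
    ring
  have hAle : a * Z * (k - Γ) ^ 2 ≤ ∑' y, ρ y * (g y - Γ) ^ 2 := by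
    refine le_trans ?_ (s2.sum_le_tsum A fun y _ => mul_nonneg (hρ0 y).le (sq_nonneg _))
    refine (mul_le_mul_of_nonneg_right hA (sq_nonneg _)).trans ?_
    rw [Finset.sum_mul]
    refine Finset.sum_le_sum fun y hy => mul_le_mul_of_nonneg_left ?_ (hρ0 y).le
    exact pow_le_pow_left₀ (by linarith) (by linarith [hk y hy]) 2
  have hmain : 2 * (a * (k - Γ) ^ 2) * Z ≤ P * R ^ 2 * E := by
    rw [b1, hG] at hpoin
    have h1 : 2 * (Z * ∑' y, ρ y * (g y - Γ) ^ 2) ≤ P * R ^ 2 * Z * E := by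
      rw [hvar]
      refine le_trans (le_of_eq ?_) hpoin
      ring
    have h2 := mul_le_mul_of_nonneg_left hAle hZ0.le
    have h3 : Z * (2 * (a * (k - Γ) ^ 2) * Z) ≤ Z * (P * R ^ 2 * E) := by linarith
    exact le_of_mul_le_mul_left h3 hZ0
  rw [le_div_iff₀ hZ0]
  refine le_trans ?_ hle
  have h4 : a / (2 * P) / R ^ 2 * (k - Γ) ^ 2 * Z ≤ E / 4 := by
    have e : a / (2 * P) / R ^ 2 * (k - Γ) ^ 2 * Z =
        2 * (a * (k - Γ) ^ 2) * Z / (4 * (P * R ^ 2)) := by field_simp; ring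
    rw [e, div_le_div_iff₀ (by positivity) (by norm_num)]
    linarith
  rw [sub_mul]
  have e : 2 * M / R ^ 2 * Z = 2 * (M / R ^ 2) * Z := by ring
  rw [e]
  linarith

theorem HasJumpBound.logMean_growth_ge {C : Conductance d} {R M δ : ℝ} (hM : C.HasJumpBound R M)
    (hR : 1 ≤ R) (hδ : 0 < δ) (x₀ x : IntLattice d) {t : ℝ} (ht : 0 ≤ t) :
    -(2 * M) / R ^ 2 ≤
      -(C.dirichlet (fun y => latticeWeight R x₀ y / C.regDensity R δ x t y)
        (C.regDensity R δ x t)) / 2 / ∑' y, latticeWeight R x₀ y := by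
  obtain ⟨E, hE0, -, hle⟩ := hM.energy_log_le hR hδ x₀ x ht
  rw [le_div_iff₀ (tsum_latticeWeight_pos hR x₀)]
  have e : -(2 * M) / R ^ 2 * ∑' y, latticeWeight R x₀ y =
      -(2 * (M / R ^ 2) * ∑' y, latticeWeight R x₀ y) := by ring
  rw [e]
  linarith

end Conductance

/-! ### The lower bound -/

theorem sq_rpow_neg_half {d : ℕ} {R : ℝ} (hR : 0 < R) : (R ^ 2) ^ (-(d : ℝ) / 2) = (R ^ d)⁻¹ := by
  rw [← Real.rpow_natCast R 2, ← Real.rpow_mul hR.le, ← Real.rpow_natCast R d,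
    ← Real.rpow_neg hR.le]
  congr 1
  push_cast
  ring

namespace Conductance

variable {d : ℕ}

/-- At the times where half of the mass is still near the starting point and the density is bounded
by a multiple of `R^{-d}`, the density is at least a multiple of `R^{-d}` on a set of positive
proportion. -/
theorem card_superlevel_ge (C : Conductance d) {R Q : ℝ} (hR : 1 ≤ R) (hQ : 0 < Q)
    (x : IntLattice d) {t : ℝ}
    (hmass : 1 / 2 ≤ ∑ y ∈ latticeBox x ⌊R⌋₊, C.flow x t y)
    (hup : ∀ y, R ^ d * C.flow x t y ≤ Q) :
    R ^ d / (4 * Q) ≤ (((latticeBox x ⌊R⌋₊).filter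
      fun y => 1 / (4 * 3 ^ d) ≤ R ^ d * C.flow x t y).card : ℝ) := by
  have hRd : 0 < R ^ d := by positivity
  set B := latticeBox x ⌊R⌋₊ with hB
  set A := B.filter fun y => 1 / (4 * 3 ^ d) ≤ R ^ d * C.flow x t y with hA
  have h1 : ∀ y ∈ B, R ^ d * C.flow x t y ≤
      1 / (4 * 3 ^ d) + (if 1 / (4 * 3 ^ d) ≤ R ^ d * C.flow x t y then Q else 0) := by
    intro y _
    have h0 : (0 : ℝ) < 1 / (4 * 3 ^ d) := by positivity
    split_ifs with h
    · linarith [hup y]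
    · linarith
  have h2 := Finset.sum_le_sum h1
  rw [← Finset.mul_sum, Finset.sum_add_distrib, ← Finset.sum_filter, ← hA, Finset.sum_const,
    Finset.sum_const, nsmul_eq_mul, nsmul_eq_mul] at h2
  have h3 := mul_le_mul_of_nonneg_left hmass hRd.le
  have h4 := mul_le_mul_of_nonneg_right (card_latticeBox_floor_le x hR)
    (by positivity : (0 : ℝ) ≤ 1 / (4 * 3 ^ d))
  have h5 : (3 : ℝ) ^ d * R ^ d * (1 / (4 * 3 ^ d)) = R ^ d / 4 := by field_simp
  rw [div_le_iff₀ (by positivity)]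
  linarith

/-- The logarithmic mean at time `R²` is bounded below, independently of the regularization. -/
theorem exists_le_logMean (hd : 1 ≤ d) (m : ℕ) {δ₀ : ℝ} (hδ₀ : 0 < δ₀) {M : ℝ} (hM0 : 0 ≤ M)
    {K : ℝ} :
    ∃ L : ℝ, 0 ≤ L ∧ ∀ C : Conductance d, C.HasChains m δ₀ → ∀ R : ℝ, 1 ≤ R →
      C.HasJumpBound R M → ∀ x₀ x : IntLattice d, gridDist x₀ x ≤ K * R → ∀ δ : ℝ, 0 < δ →
        -L ≤ C.logMean R δ x₀ x (R ^ 2) := by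
  obtain ⟨A, hA, hup⟩ := exists_flow_le hd m hδ₀
  obtain ⟨η, hη, hη1, hmass⟩ := exists_half_le_sum_flow hd m hδ₀ hM0
  set Q : ℝ := A * (η / 2) ^ (-(d : ℝ) / 2) with hQ
  have hQ0 : 0 < Q := by positivity
  have hP := poincareConst_pos hd m hδ₀
  set a : ℝ := Real.exp (-(K + d)) / (4 * Q * 4 ^ d) with ha
  have ha0 : 0 < a := by positivity
  set k : ℝ := Real.log (1 / (4 * 3 ^ d)) with hk
  set a' : ℝ := a / (2 * poincareConst d m δ₀) with ha'
  have ha'0 : 0 < a' := by positivity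
  set L₀ := k - (2 * M + 1 + 2 * (2 * M) / a' + 2 / (a' * (η / 2))) - 2 * M with hL₀
  refine ⟨|L₀|, abs_nonneg _, ?_⟩
  intro C hC R hR hM x₀ x hx δ hδ
  have hR0 : 0 < R := by linarith
  have hR2 : 0 < R ^ 2 := by positivity
  refine (neg_abs_le L₀).trans ?_
  refine le_of_riccati (k := k) ha'0 (by positivity : 0 ≤ 2 * M) (by positivity : 0 < η / 2)
    (C.logMean R δ x₀ x) _ (R ^ 2) (η / 2 * R ^ 2) (η * R ^ 2) (R ^ 2) hR2 (by positivity)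
    (by ring) (by nlinarith) (by nlinarith)
    (fun t ht => C.hasDerivAt_logMean hR hδ x₀ x ht)
    (fun t ht => hM.logMean_growth_ge hR hδ x₀ x ht.le) ?_
  intro t ht hΓ
  have ht0 : 0 < t := lt_of_lt_of_le (by positivity) ht.1
  have hupt : ∀ y, R ^ d * C.flow x t y ≤ Q := by
    intro y
    have h1 := hup C hC x y t ht0
    have h2 : t ^ (-(d : ℝ) / 2) ≤ (η / 2 * R ^ 2) ^ (-(d : ℝ) / 2) :=
      Real.rpow_le_rpow_of_nonpos (by positivity) ht.1
        (by rw [neg_div]; exact neg_nonpos.mpr (by positivity))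
    rw [Real.mul_rpow (by positivity) (by positivity), sq_rpow_neg_half hR0] at h2
    have h3 := mul_le_mul_of_nonneg_left (h1.trans (mul_le_mul_of_nonneg_left h2 hA.le))
      (by positivity : 0 ≤ R ^ d)
    refine h3.trans (le_of_eq ?_)
    rw [hQ]
    field_simp
  have hcard := C.card_superlevel_ge hR hQ0 x (hmass C hC R hR hM x t ht0 ht.2) hupt
  set S := (latticeBox x ⌊R⌋₊).filter fun y => 1 / (4 * 3 ^ d) ≤ R ^ d * C.flow x t y with hS
  refine hC.logMean_growth hd hδ₀ hM hR hδ x₀ x ht0.le S ?_ ?_ hΓ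
  · have h1 : ∀ y ∈ S, Real.exp (-(K + d)) ≤ latticeWeight R x₀ y := by
      intro y hy
      have h2 := gridDist_le_of_mem_latticeBox (Finset.mem_filter.mp hy).1
      have h3 := mul_le_mul_of_nonneg_left (Nat.floor_le hR0.le) (Nat.cast_nonneg d : (0 : ℝ) ≤ d)
      have h4 := gridDist_triangle x₀ x y
      rw [latticeWeight, Real.exp_le_exp, neg_div, neg_le_neg_iff, div_le_iff₀ hR0]
      linarith
    refine le_trans ?_ (Finset.card_nsmul_le_sum _ _ _ h1)
    rw [nsmul_eq_mul]
    have h5 := mul_le_mul_of_nonneg_left (tsum_latticeWeight_le hR x₀) ha0.le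
    have h6 := mul_le_mul_of_nonneg_right hcard (Real.exp_pos (-(K + d))).le
    refine h5.trans (le_trans (le_of_eq ?_) h6)
    rw [ha, mul_pow]
    field_simp
  · intro y hy
    refine Real.log_le_log (by positivity) ?_
    have := (Finset.mem_filter.mp hy).2
    rw [regDensity]
    linarith

/-- At time `R²` the density is at least a multiple of `R^{-d}` off a set of small weight. -/
theorem exists_tsum_sublevel_le (hd : 1 ≤ d) (m : ℕ) {δ₀ : ℝ} (hδ₀ : 0 < δ₀) {M : ℝ}
    (hM0 : 0 ≤ M) {K : ℝ} :
    ∃ ε : ℝ, 0 < ε ∧ ∀ C : Conductance d, C.HasChains m δ₀ → ∀ R : ℝ, 1 ≤ R →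
      C.HasJumpBound R M → ∀ x₀ x : IntLattice d, gridDist x₀ x ≤ K * R →
        (Summable fun y => if R ^ d * C.flow x (R ^ 2) y < ε then latticeWeight R x₀ y else 0) ∧
        ∑' y, (if R ^ d * C.flow x (R ^ 2) y < ε then latticeWeight R x₀ y else 0) ≤
          (∑' y, latticeWeight R x₀ y) / 4 := by
  obtain ⟨A, hA, hup⟩ := exists_flow_le hd m hδ₀
  obtain ⟨L, hL, hlog⟩ := exists_le_logMean hd m hδ₀ hM0 (K := K)
  set ε : ℝ := Real.exp (-(4 * (L + A) + 1)) / 2 with hε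
  have hε0 : 0 < ε := by positivity
  have hε1 : ε ≤ 1 := by
    have : Real.exp (-(4 * (L + A) + 1)) ≤ 1 := Real.exp_le_one_iff.mpr (by linarith)
    rw [hε]; linarith
  have hlogε : Real.log (2 * ε) = -(4 * (L + A) + 1) := by
    rw [hε, mul_div_cancel₀ _ two_ne_zero, Real.log_exp]
  refine ⟨ε, hε0, fun C hC R hR hM x₀ x hx => ?_⟩
  have hR0 : 0 < R := by linarith
  have hR2 : 0 < R ^ 2 := by positivity
  set ρ := latticeWeight R x₀ with hρ
  have hρ0 : ∀ y, 0 < ρ y := fun y => latticeWeight_pos _ _ _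
  have sρ : Summable ρ := summable_latticeWeight hR x₀
  set Z := ∑' y, ρ y with hZ
  have hZ0 : 0 < Z := tsum_latticeWeight_pos hR x₀
  set h : IntLattice d → ℝ := fun y => if R ^ d * C.flow x (R ^ 2) y < ε then ρ y else 0 with hh
  have sh : Summable h := by
    refine Summable.of_nonneg_of_le (fun y => ?_) (fun y => ?_) sρ <;> simp only [hh] <;>
      split_ifs <;> linarith [hρ0 y]
  refine ⟨sh, ?_⟩
  have h1 := hlog C hC R hR hM x₀ x hx ε hε0
  rw [logMean, le_div_iff₀ hZ0] at h1
  have h2 : ∀ y, ρ y * Real.log (C.regDensity R ε x (R ^ 2) y) ≤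
      A * ρ y + Real.log (2 * ε) * h y := by
    intro y
    have hpos := C.regDensity_pos hR hε0 x hR2.le y
    have h3 : C.regDensity R ε x (R ^ 2) y - 1 ≤ A := by
      have h4 := hup C hC x y (R ^ 2) hR2
      rw [sq_rpow_neg_half hR0] at h4
      have h5 := mul_le_mul_of_nonneg_left h4 (by positivity : 0 ≤ R ^ d)
      have h6 : R ^ d * (A * (R ^ d)⁻¹) = A := by field_simp
      rw [regDensity]
      linarith
    simp only [hh]
    split_ifs with hlt
    · have h4 : Real.log (C.regDensity R ε x (R ^ 2) y) ≤ Real.log (2 * ε) := by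
        refine Real.log_le_log hpos ?_
        rw [regDensity]
        linarith
      have h5 := mul_le_mul_of_nonneg_left h4 (hρ0 y).le
      have h6 := mul_nonneg hA.le (hρ0 y).le
      linarith
    · have h4 := (Real.log_le_sub_one_of_pos hpos).trans h3
      have h5 := mul_le_mul_of_nonneg_left h4 (hρ0 y).le
      linarith
  have h3 := Summable.tsum_le_tsum h2 (C.summable_weight_mul_log hR hε0 x₀ x hR2.le)
    ((sρ.mul_left A).add (sh.mul_left (Real.log (2 * ε))))
  rw [(sρ.mul_left A).tsum_add (sh.mul_left (Real.log (2 * ε))), tsum_mul_left, tsum_mul_left,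
    hlogε] at h3
  have h4 : 0 ≤ ∑' y, h y := tsum_nonneg fun y => by
    simp only [hh]; split_ifs <;> linarith [hρ0 y]
  have h5 : (L + A) * (4 * ∑' y, h y) ≤ (L + A) * Z := by linarith
  have h6 := le_of_mul_le_mul_left h5 (by linarith)
  linarith

/-- The near-diagonal lower bound, in the unscaled lattice. -/
theorem exists_le_flow (hd : 1 ≤ d) (m : ℕ) {δ₀ : ℝ} (hδ₀ : 0 < δ₀) {M : ℝ} (hM0 : 0 ≤ M)
    {K : ℝ} (hK : 0 ≤ K) :
    ∃ ε : ℝ, 0 < ε ∧ ∀ C : Conductance d, C.HasChains m δ₀ → ∀ R : ℝ, 1 ≤ R →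
      C.HasJumpBound R M → ∀ x y : IntLattice d, gridDist x y ≤ K * R →
        ε * (R ^ d)⁻¹ ≤ C.flow y (2 * R ^ 2) x := by
  obtain ⟨ε, hε, hsub⟩ := exists_tsum_sublevel_le hd m hδ₀ hM0 (K := K)
  refine ⟨ε ^ 2 * Real.exp (-d) / 2, by positivity, fun C hC R hR hM x y hxy => ?_⟩
  have hR0 : 0 < R := by linarith
  have hR2 : 0 ≤ R ^ 2 := by positivity
  have hRd : 0 < R ^ d := by positivity
  obtain ⟨s1, b1⟩ := hsub C hC R hR hM x x (by rw [gridDist_self]; positivity)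
  obtain ⟨s2, b2⟩ := hsub C hC R hR hM x y hxy
  set ρ := latticeWeight R x with hρ
  have hρ0 : ∀ y, 0 < ρ y := fun y => latticeWeight_pos _ _ _
  have sρ : Summable ρ := summable_latticeWeight hR x
  rw [two_mul, flow_add]
  set κ : ℝ := (ε * (R ^ d)⁻¹) ^ 2 with hκ
  have hκ0 : 0 ≤ κ := by positivity
  have hpt : ∀ z, κ * (ρ z - (if R ^ d * C.flow x (R ^ 2) z < ε then ρ z else 0) -
      (if R ^ d * C.flow y (R ^ 2) z < ε then ρ z else 0)) ≤
        C.flow x (R ^ 2) z * C.flow y (R ^ 2) z := by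
    intro z
    have hnn := mul_nonneg (C.flow_nonneg x z hR2) (C.flow_nonneg y z hR2)
    have hz := hρ0 z
    by_cases h1 : R ^ d * C.flow x (R ^ 2) z < ε
    · refine le_trans (mul_nonpos_of_nonneg_of_nonpos hκ0 ?_) hnn
      rw [if_pos h1]
      split_ifs <;> linarith
    by_cases h2 : R ^ d * C.flow y (R ^ 2) z < ε
    · refine le_trans (mul_nonpos_of_nonneg_of_nonpos hκ0 ?_) hnn
      rw [if_pos h2, if_neg h1]
      linarith
    rw [if_neg h1, if_neg h2, sub_zero, sub_zero]
    have h3 : ε * (R ^ d)⁻¹ ≤ C.flow x (R ^ 2) z := by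
      rw [← div_eq_mul_inv, div_le_iff₀ hRd]; linarith
    have h4 : ε * (R ^ d)⁻¹ ≤ C.flow y (R ^ 2) z := by
      rw [← div_eq_mul_inv, div_le_iff₀ hRd]; linarith
    refine (mul_le_of_le_one_right hκ0 (latticeWeight_le_one hR0 x z)).trans ?_
    rw [hκ, sq]
    exact mul_le_mul h3 h4 (by positivity) (C.flow_nonneg x z hR2)
  have h := Summable.tsum_le_tsum hpt (((sρ.sub s1).sub s2).mul_left κ)
    (summable_mul (C.flow x (R ^ 2)) (C.flow y (R ^ 2)))
  rw [tsum_mul_left, (sρ.sub s1).tsum_sub s2, sρ.tsum_sub s1] at h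
  refine le_trans ?_ h
  have hZ := le_tsum_latticeWeight hR x
  have h5 : Real.exp (-d) * R ^ d / 2 ≤ ∑' y, ρ y -
      ∑' z, (if R ^ d * C.flow x (R ^ 2) z < ε then ρ z else 0) -
      ∑' z, (if R ^ d * C.flow y (R ^ 2) z < ε then ρ z else 0) := by
    linarith
  refine le_trans (le_of_eq ?_) (mul_le_mul_of_nonneg_left h5 hκ0)
  rw [hκ]
  field_simp

end Conductance

/-! ### Rescaling -/

theorem dist_latticePoint {d : ℕ} (n : ℕ) (x y : IntLattice d) :
    dist (latticePoint n x) (latticePoint n y) =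
      √(∑ i, ((x i : ℝ) - y i) ^ 2) / n := by
  rw [latticePoint, latticePoint, EuclideanSpace.dist_eq]
  have e : ∀ i, dist ((x i : ℝ) / n) ((y i : ℝ) / n) ^ 2 =
      ((x i : ℝ) - y i) ^ 2 / (n : ℝ) ^ 2 := fun i => by
    rw [Real.dist_eq, sq_abs, ← sub_div, div_pow]
  simp only [e]
  rw [← Finset.sum_div, Real.sqrt_div' _ (sq_nonneg _), Real.sqrt_sq (Nat.cast_nonneg n)]

theorem abs_sub_le_dist_latticePoint {d : ℕ} {n : ℕ} (hn : 1 ≤ n) (x y : IntLattice d) (i : Fin d) :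
    |(x i : ℝ) - y i| ≤ n * dist (latticePoint n x) (latticePoint n y) := by
  have hn0 : (0 : ℝ) < n := by exact_mod_cast hn
  rw [dist_latticePoint, mul_div_cancel₀ _ hn0.ne']
  refine Real.abs_le_sqrt ?_
  exact Finset.single_le_sum (f := fun i => ((x i : ℝ) - y i) ^ 2) (fun _ _ => sq_nonneg _)
    (Finset.mem_univ i)

theorem gridDist_le_dist_latticePoint {d : ℕ} {n : ℕ} (hn : 1 ≤ n) (x y : IntLattice d) :
    gridDist x y ≤ d * (n * dist (latticePoint n x) (latticePoint n y)) := by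
  refine (Finset.sum_le_sum fun i _ => abs_sub_le_dist_latticePoint hn x y i).trans (le_of_eq ?_)
  simp

theorem dist_latticePoint_add_single {d : ℕ} (n : ℕ) (x : IntLattice d) (i : Fin d) :
    dist (latticePoint n x) (latticePoint n (x + Pi.single i 1)) = (n : ℝ)⁻¹ := by
  have e : ∀ j, ((x j : ℝ) - ((x + Pi.single i 1 : IntLattice d) j : ℤ)) ^ 2 =
      if j = i then 1 else 0 := by
    intro j
    by_cases hj : j = i
    · subst hj; simp
    · simp [hj]
  rw [dist_latticePoint]
  simp only [e]
  simp

theorem lemma4p4 (d : ℕ) (C : ℕ → Conductance d)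
    (hA1 : ∃ c₁ c₂ : ℝ, 0 < c₁ ∧ 0 < c₂ ∧ ∀ n : ℕ, 1 ≤ n → ∀ x : IntLattice d,
      c₁ ≤ (C n).total x ∧ (C n).total x ≤ c₂)
    (hA2 : ∃ M₀ δ : ℝ, 1 ≤ M₀ ∧ 0 < δ ∧ ∀ n : ℕ, 1 ≤ n → ∀ x y : IntLattice d,
      dist (latticePoint n x) (latticePoint n y) = (n : ℝ)⁻¹ →
        ∃ N : ℕ, 2 ≤ N ∧ ∃ z : ℕ → IntLattice d, z 1 = x ∧ z N = y ∧
          (∀ i, 1 ≤ i → i ≤ N →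
            dist (latticePoint n x) (latticePoint n (z i)) < (n : ℝ)⁻¹ * M₀) ∧
          ∀ i, 1 ≤ i → i < N → δ ≤ (C n).val (z i) (z (i + 1)))
    (hA3 : ∃ M : ℝ, ∀ n : ℕ, 1 ≤ n → ∀ x : IntLattice d,
      (n : ℝ) ^ 2 * ∑' y : IntLattice d,
        min 1 (dist (latticePoint n x) (latticePoint n y) ^ 2) * (C n).val x y ≤ M) :
    ∃ ε : ℝ, 0 < ε ∧ ∀ n : ℕ, 1 ≤ n → ∀ t : ℝ, (n : ℝ)⁻¹ < t → t ≤ 1 → ∀ x y : IntLattice d,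
      dist (latticePoint n x) (latticePoint n y) ≤ 2 * √t →
        ε * t ^ (-(d : ℝ) / 2) ≤ (C n).heatKernel n t x y := by
  obtain ⟨c₁, c₂, hc₁, -, htot⟩ := hA1
  obtain ⟨M₀, δ, hM₀, hδ, hchain⟩ := hA2
  obtain ⟨M, hM⟩ := hA3
  -- In dimension `0` the total conductance vanishes, against the lower bound on it.
  have hd : 1 ≤ d := by
    by_contra! h
    obtain rfl : d = 0 := by omega
    have h1 := (htot 1 le_rfl 0).1
    have h2 : (C 1).total 0 = 0 := by
      rw [Conductance.total]
      refine (tsum_congr fun y => ?_).trans tsum_zero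
      rw [Subsingleton.elim y 0, (C 1).diag]
    linarith
  have hd1 : (1 : ℝ) ≤ d := by exact_mod_cast hd
  set m := ⌊M₀⌋₊ with hm
  have hch : ∀ n : ℕ, 1 ≤ n → (C n).HasChains m δ := by
    intro n hn x i
    have hn0 : (0 : ℝ) < n := by exact_mod_cast hn
    obtain ⟨N, hN, z, h1, h2, h3, h4⟩ := hchain n hn x _ (dist_latticePoint_add_single n x i)
    refine ⟨N, by omega, z, h1, h2, fun j hj1 hj2 => ?_, h4⟩
    rw [mem_latticeBox]
    intro k
    have h5 := abs_sub_le_dist_latticePoint hn x (z j) k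
    have h6 : |(x k : ℝ) - z j k| ≤ M₀ := by
      have h7 := mul_lt_mul_of_pos_left (h3 j hj1 hj2) hn0
      rw [mul_inv_cancel_left₀ hn0.ne'] at h7
      linarith
    have h8 : ((x k - z j k).natAbs : ℝ) ≤ M₀ := by
      rw [Nat.cast_natAbs]
      push_cast
      exact h6
    have h9 := Nat.le_floor h8
    rw [Int.abs_eq_natAbs]
    exact_mod_cast h9
  have hM0 : 0 ≤ M := by
    refine le_trans ?_ (hM 1 le_rfl 0)
    exact mul_nonneg (by positivity) (tsum_nonneg fun y =>
      mul_nonneg (le_min zero_le_one (sq_nonneg _)) ((C 1).nonneg _ _))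
  have hjump : ∀ n : ℕ, 1 ≤ n → ∀ R : ℝ, 0 < R → R ≤ n → (C n).HasJumpBound R (d ^ 2 * M) := by
    intro n hn R hR hRn x
    have hn0 : (0 : ℝ) < n := by exact_mod_cast hn
    have h1 : ∀ y, (C n).val x y * min 1 ((gridDist x y / R) ^ 2) ≤
        (d ^ 2 * (n : ℝ) ^ 2 / R ^ 2) *
          (min 1 (dist (latticePoint n x) (latticePoint n y) ^ 2) * (C n).val x y) := by
      intro y
      set D := dist (latticePoint n x) (latticePoint n y) with hD
      have h2 : min 1 ((gridDist x y / R) ^ 2) ≤ d ^ 2 * (n : ℝ) ^ 2 / R ^ 2 * min 1 (D ^ 2) := by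
        rw [mul_min_of_nonneg _ _ (by positivity), mul_one]
        refine min_le_min ?_ ?_
        · rw [le_div_iff₀ (by positivity), one_mul, ← mul_pow]
          exact pow_le_pow_left₀ hR.le (by nlinarith) 2
        · rw [div_pow, div_mul_eq_mul_div]
          refine div_le_div_of_nonneg_right ?_ (by positivity)
          refine (pow_le_pow_left₀ (gridDist_nonneg x y)
            (gridDist_le_dist_latticePoint hn x y) 2).trans (le_of_eq ?_)
          ring
      have h3 := mul_le_mul_of_nonneg_left h2 ((C n).nonneg x y)
      linarith
    have hs : Summable fun y =>
        min 1 (dist (latticePoint n x) (latticePoint n y) ^ 2) * (C n).val x y :=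
      ((C n).summable_mul_of_bounded x (b := 1) fun y => by
        rw [abs_of_nonneg (le_min zero_le_one (sq_nonneg _))]
        exact min_le_left _ _).congr fun y => mul_comm _ _
    refine (Summable.tsum_le_tsum h1 ((C n).summable_val_mul_min x R) (hs.mul_left _)).trans ?_
    rw [tsum_mul_left]
    have h4 := mul_le_mul_of_nonneg_left (hM n hn x) (by positivity : 0 ≤ (d : ℝ) ^ 2 / R ^ 2)
    refine le_trans (le_of_eq ?_) (h4.trans (le_of_eq ?_)) <;> ring
  obtain ⟨ε, hε, hlow⟩ := Conductance.exists_le_flow hd m hδ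
    (by positivity : 0 ≤ (d : ℝ) ^ 2 * M) (K := d * (2 * √2)) (by positivity)
  refine ⟨ε, hε, fun n hn t hnt ht1 x y hxy => ?_⟩
  have hn0 : (0 : ℝ) < n := by exact_mod_cast hn
  have ht0 : 0 < t := lt_trans (by positivity) hnt
  have hnt1 : 1 < n * t := by
    rwa [inv_lt_iff_one_lt_mul₀ hn0, mul_comm] at hnt
  have hn2 : (2 : ℝ) ≤ n := by
    have : (1 : ℝ) < n := by nlinarith
    have h1 : 1 < n := by exact_mod_cast this
    exact_mod_cast h1
  -- The kernel at time `n² t = 2 R²` is a convolution of two kernels at time `R²`.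
  set R : ℝ := n * √(t / 2) with hR
  have hR0 : 0 < R := by positivity
  have hR2 : 2 * R ^ 2 = (n : ℝ) ^ 2 * t := by
    rw [hR, mul_pow, Real.sq_sqrt (by positivity)]; ring
  have hR1 : 1 ≤ R := by
    have : 1 ≤ R ^ 2 := by nlinarith
    nlinarith
  have hRn : R ≤ n := by
    rw [hR]
    refine mul_le_of_le_one_right hn0.le ?_
    rw [Real.sqrt_le_one]
    linarith
  have hdist : gridDist x y ≤ d * (2 * √2) * R := by
    refine (gridDist_le_dist_latticePoint hn x y).trans ?_
    have e : √2 * √(t / 2) = √t := by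
      rw [← Real.sqrt_mul (by norm_num)]
      congr 1
      ring
    have h1 : d * (2 * √2) * R = d * (n * (2 * √t)) := by rw [hR, ← e]; ring
    rw [h1]
    gcongr
  have h := hlow (C n) (hch n hn) R hR1 (hjump n hn R hR0 hRn) x y hdist
  rw [Conductance.heatKernel_eq, ← hR2]
  have h1 := mul_le_mul_of_nonneg_left h (by positivity : (0 : ℝ) ≤ (n : ℝ) ^ d)
  refine le_trans ?_ h1
  have h2 : t ^ (-(d : ℝ) / 2) = (√t ^ d)⁻¹ := by
    rw [← sq_rpow_neg_half (Real.sqrt_pos.mpr ht0), Real.sq_sqrt ht0.le]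
  have h3 : (n : ℝ) ^ d * (R ^ d)⁻¹ = (√(t / 2) ^ d)⁻¹ := by
    rw [hR, mul_pow]; field_simp
  calc ε * t ^ (-(d : ℝ) / 2) ≤ ε * (√(t / 2) ^ d)⁻¹ := by
        rw [h2]
        refine mul_le_mul_of_nonneg_left (inv_anti₀ (by positivity) ?_) hε.le
        exact pow_le_pow_left₀ (Real.sqrt_nonneg _) (Real.sqrt_le_sqrt (by linarith)) d
    _ = (n : ℝ) ^ d * (ε * (R ^ d)⁻¹) := by rw [← h3]; ring
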